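/- **Setting.** Let $l\le r$ be integers, $\underline a=(a_l,\dots,a_r)\in\{L,R\}^{[l..r]}$, $\underline b=(b_l,\dots,b_r)\in\{+,-\}^{[l..r]}$. The rail-yard graph $RYG(l,r,\underline a,\underline b)$ has vertex set $[2l-1..2r+1]\times(\mathbb Z+\frac12)$; each vertex $(2m,y)$, $m\in[l..r]$, is joined to $(2m-1,y)$, to $(2m+1,y)$, and by one diagonal edge to $(2m-1,y\pm1)$ if $(a_m,b_m)=(L,\pm)$, to $(2m+1,y\pm1)$ if $(a_m,b_m)=(R,\pm)$. Given weights $(y_m)_{m\in[l..r]}$, horizontal edges have weight $1$ and the diagonal edges at abscissa $2m$ have weight $y_m$. A dimer covering is a set of edges with finitely many diagonal edges which covers every vertex of abscissa in $[2l..2r]$ exactly once and every vertex of abscissa $2l-1$ or $2r+1$ at most once; its weight is the product of the weights of its edges. In the column of abscissa $2m-1$ ($m\in[l..r+1]$), a vertex is a particle if it is covered from the left, or is on the left boundary and uncovered, and is a hole otherwise; the partition of that column has as $i$th part the number of holes below the $i$th highest particle. Boundary conditions are partitions of the columns $2l-1$ and $2r+1$, with the charge (the number of particles above height $0$ minus the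 number of holes below height $0$) equal to $0$. Given boundary conditions, a covering is chosen with probability proportional to its weight. Let $x_l,\dots,x_r\ge 0$ with $x_j>0$ whenever $(a_j,b_j)=(L,-)$. Assume that $(a_j,b_j)\ne(R,-)$ for all $j\in[l..r]$, that $x_ix_j<1$ whenever $i<j$, $a_i=a_j$, $b_i=+$, $b_j=-$, and that $N:=|\{j\in[l..r]:(a_j,b_j)=(L,-)\}|\ge1$. Let $n$ be the number of distinct elements of $\{x_j:(a_j,b_j)=(L,-)\}$. For $i\in[n]$ say that $j\in[l..r]$ has class $i$ if $(a_j,b_j)=(L,-)$ and $x_j$ is the $i$th greatest element of this set. Let $\lambda=(\lambda_1\ge\dots\ge\lambda_N\ge0)$ be a partition, $\sigma$ any bijection from $[N]$ to $\{j\in[l..r]:(a_j,b_j)=(L,-)\}$, and let $\lambda^{(i,\sigma)}$ be the partition formed by the $\lambda_q$ (with multiplicity) for which $\sigma(q)$ has class $i$. Fix $t\in[l..r]$ and put $N^{(>t)}=|\{j\in[t+1..r]:(a_j,b_j)=(L,-)\}|$, $N^{(>t)}_i=|\{j\in[t+1..r]:j\text{ has class }i\}|$. For complex variables $u_j$, let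 $\mathbf u^{(>t,i)}=(u_j)_{j>t}$, $\underline u^{(i)}=(u_j/x_j)_{j>t}$, $\mathbf x^{(\le t,i)}=(x_j)_{j\le t}$ and $\mathbf x^{(i)}=(x_j)$, where in each case $j$ runs over the indices of class $i$ in the indicated range. Let $w_j=u_j$ if $j>t$ and $(a_j,b_j)=(L,-)$, and $w_j=x_j$ otherwise. Let $z_{ij}=1+x_ix_j$, $\xi_{ij}=1+w_iw_j$ if $a_i\neq a_j$, and $z_{ij}=\frac1{1-x_ix_j}$, $\xi_{ij}=\frac1{1-w_iw_j}$ if $a_i=a_j$. Let $\mathbb Y_M$ be the set of partitions $\mu_1\ge\dots\ge\mu_M\ge0$, and $s_\mu=\det(h_{\mu_p-p+q})_{p,q=1}^{M}$ the Schur function. **Auxiliary measures.** Let $\tilde\rho^t_{\lambda^{(1,\sigma)}}$ be the law of the partition of the column of abscissa $2t+1$ (the odd column between the even columns $2t$ and $2t+2$) on $RYG(l,r,\underline a,\underline b)$ with left boundary condition $\tilde\lambda^{(1,\sigma)}=(\lambda^{(1,\sigma)},0,\dots,0)$ (of length $N$), right boundary condition $\emptyset$, and diagonal weights $0$ for those $j$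 with $(a_j,b_j)=(L,-)$ that are not of class $1$, and $x_j$ for all other $j$. For $i\in[2..n]$, let $\tilde\rho^t_{\lambda^{(i,\sigma)}}$ be the law of the partition of the same column on $RYG(l,r,(L,\dots,L),\underline b)$ with left boundary condition $\tilde\lambda^{(i,\sigma)}=(\lambda^{(i,\sigma)},0,\dots,0)$ (of length $N$), right boundary condition $\emptyset$, and diagonal weights $x_j$ for $j$ of class $i$, and $0$ for all other $j$. **Lemma.** These measures are well defined: in each case the total weight of the coverings is finite and positive, and the law is a probability measure on $\mathbb Y_{N^{(>t)}}$. Moreover: (1) If $|x_iu_j|<1$ for all $i\in[l..t]$ with $(a_i,b_i)=(L,+)$ and all $j\in[t+1..r]$ of class $1$, then $$\frac{s_{\lambda^{(1,\sigma)}}(\mathbf u^{(>t,1)},\mathbf x^{(\le t,1)})}{s_{\lambda^{(1,\sigma)}}(\mathbf x^{(1)})}\prod_{\substack{i\in[l..t]\\ b_i=+}}\ \prod_{\substack{j\in[t+1..r]\\ j\text{ of class }1}}\frac{\xi_{ij}}{z_{ij}}=\sum_{\mu\in\mathbb Y_{N^{(>t)}}}\tilde\rho^t_{\lambda^{(1,\sigma)}}(\mu)\,\frac{s_\mu(\underline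 u^{(1)},0^{N^{(>t)}-N^{(>t)}_1})}{s_\mu(1^{N^{(>t)}_1},0^{N^{(>t)}-N^{(>t)}_1})},$$ where the series converges absolutely. (2) For every $i\in[2..n]$ and all complex $u_j$, $$\frac{s_{\lambda^{(i,\sigma)}}(\mathbf u^{(>t,i)},\mathbf x^{(\le t,i)})}{s_{\lambda^{(i,\sigma)}}(\mathbf x^{(i)})}=\sum_{\mu\in\mathbb Y_{N^{(>t)}}}\tilde\rho^t_{\lambda^{(i,\sigma)}}(\mu)\,\frac{s_\mu(\underline u^{(i)},0^{N^{(>t)}-N^{(>t)}_i})}{s_\mu(1^{N^{(>t)}_i},0^{N^{(>t)}-N^{(>t)}_i})}.$$ Here a term whose denominator vanishes is read as $0$. -/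

import Mathlib

/-! ### Partitions and Schur functions -/

/-- Length-`N` partitions: non-increasing sequences of `N` non-negative integers. -/
def YY (N : ℕ) : Type := {mu : Fin N → ℕ // Antitone mu}

/-- Extension of a finite sequence by infinitely many zeros. -/
def zeroPad {N : ℕ} (mu : Fin N → ℕ) : ℕ → ℕ :=
  fun i => if h : i < N then mu ⟨i, h⟩ else 0

/-- The complete homogeneous symmetric function `h_k` evaluated at the finite family `v`;
it is `0` for negative `k`. -/
noncomputable def completeHom {ι : Type*} [Fintype ι] [DecidableEq ι] (v : ι → ℂ) (k : ℤ) : ℂ :=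
  if k < 0 then 0 else MvPolynomial.eval v (MvPolynomial.hsymm ι ℂ k.toNat)

/-- The Schur function `s_mu = det (h_{mu_i - i + j})` evaluated at the finite family `v`. -/
noncomputable def schur {N : ℕ} (mu : Fin N → ℕ) {ι : Type*} [Fintype ι] [DecidableEq ι]
    (v : ι → ℂ) : ℂ :=
  Matrix.det (Matrix.of fun i j : Fin N =>
    completeHom v ((mu i : ℤ) - ((i : ℕ) : ℤ) + ((j : ℕ) : ℤ)))

/-! ### Rail-yard graphs -/

/-- The letters of an `LR` sequence. -/
inductive LR : Type
  | L : LR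
  | R : LR
  deriving DecidableEq

/-- The letters of a sign sequence. -/
inductive PM : Type
  | plus : PM
  | minus : PM
  deriving DecidableEq

/-- The data `(l, r, a, b)` of a rail-yard graph. Only the values of `a`, `b` on `[l..r]` matter. -/
structure RailYard : Type where
  l : ℤ
  r : ℤ
  hlr : l ≤ r
  a : ℤ → LR
  b : ℤ → PM

/-- An even vertex has three edges: the two horizontal ones and a diagonal one. -/
inductive EdgeKind : Type
  | left : EdgeKind
  | right : EdgeKind
  | diag : EdgeKind
  deriving DecidableEq

/-- The edge of kind `kind` at the even vertex `(2 * col, height + 1/2)`. Every edge of a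
rail-yard graph has exactly one even endpoint, so each edge is described exactly once. -/
structure RailEdge : Type where
  col : ℤ
  height : ℤ
  kind : EdgeKind

namespace RailEdge

/-- The even endpoint. A pair `(p, k)` stands for the vertex `(p, k + 1/2)`. -/
def evenEnd (e : RailEdge) : ℤ × ℤ := (2 * e.col, e.height)

end RailEdge

namespace RailYard

/-- The odd endpoint of the diagonal edge at the even vertex `(2 * m, k + 1/2)`. -/
def diagEnd (G : RailYard) (m k : ℤ) : ℤ × ℤ :=
  match G.a m, G.b m with
  | LR.L, PM.plus => (2 * m - 1, k + 1)
  | LR.L, PM.minus => (2 * m - 1, k - 1)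
  | LR.R, PM.plus => (2 * m + 1, k + 1)
  | LR.R, PM.minus => (2 * m + 1, k - 1)

/-- The odd endpoint of an edge. -/
def oddEnd (G : RailYard) (e : RailEdge) : ℤ × ℤ :=
  match e.kind with
  | EdgeKind.left => (2 * e.col - 1, e.height)
  | EdgeKind.right => (2 * e.col + 1, e.height)
  | EdgeKind.diag => G.diagEnd e.col e.height

/-- The edge `e` is incident to the vertex `v`. -/
def Incident (G : RailYard) (e : RailEdge) (v : ℤ × ℤ) : Prop :=
  e.evenEnd = v ∨ G.oddEnd e = v

/-- Dimer coverings of the rail-yard graph. -/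
structure IsDimerCovering (G : RailYard) (M : Set RailEdge) : Prop where
  isEdge : ∀ e ∈ M, G.l ≤ e.col ∧ e.col ≤ G.r
  inner : ∀ v : ℤ × ℤ, 2 * G.l - 1 < v.1 → v.1 < 2 * G.r + 1 → ∃! e, e ∈ M ∧ G.Incident e v
  boundary : ∀ v : ℤ × ℤ, v.1 = 2 * G.l - 1 ∨ v.1 = 2 * G.r + 1 →
    {e | e ∈ M ∧ G.Incident e v}.Subsingleton
  finite_diag : {e | e ∈ M ∧ e.kind = EdgeKind.diag}.Finite

/-- In column `m` (abscissa `2 * m - 1`, `m ∈ [l..r+1]`), the vertex `(2 * m - 1, k + 1/2)` carries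
a particle if it is covered by an edge on its left, or if it lies on the left boundary and is not
covered. Otherwise it carries a hole: it is covered by an edge on its right, or lies on the right
boundary and is not covered. -/
def IsParticle (G : RailYard) (M : Set RailEdge) (m k : ℤ) : Prop :=
  (∃ e ∈ M, G.oddEnd e = (2 * m - 1, k) ∧ e.col = m - 1) ∨
    (m = G.l ∧ ∀ e ∈ M, G.oddEnd e ≠ (2 * m - 1, k))

/-- The configuration in column `m` corresponds to the partition `nu`: the part `nu i` (parts are
numbered from `0`) is the number of holes below the particle that has exactly `i` particles
above it. -/
def HasPartition (G : RailYard) (M : Set RailEdge) (m : ℤ) (nu : ℕ → ℕ) : Prop :=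
  ∀ i : ℕ, ∃ k : ℤ, G.IsParticle M m k ∧
    {k' : ℤ | k < k' ∧ G.IsParticle M m k'}.encard = (i : ℕ∞) ∧
    {k' : ℤ | k' < k ∧ ¬ G.IsParticle M m k'}.encard = (nu i : ℕ∞)

/-- The charge of column `m`: the number of particles in the upper half plane minus the number of
holes in the lower half plane (both finite in a column that has a partition). -/
noncomputable def charge (G : RailYard) (M : Set RailEdge) (m : ℤ) : ℤ :=
  ({k : ℤ | 0 ≤ k ∧ G.IsParticle M m k}.ncard : ℤ) -
    ({k : ℤ | k < 0 ∧ ¬ G.IsParticle M m k}.ncard : ℤ)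

/-- Dimer coverings with left and right boundary conditions `alpha` and `beta`. The charge is
normalized to `0`, which fixes the vertical position of the boundary configurations. -/
def coverings (G : RailYard) (alpha beta : ℕ → ℕ) : Set (Set RailEdge) :=
  {M | G.IsDimerCovering M ∧
    G.HasPartition M G.l alpha ∧ G.charge M G.l = 0 ∧
    G.HasPartition M (G.r + 1) beta ∧ G.charge M (G.r + 1) = 0}

/-- The weight of a dimer covering: each diagonal edge at an even vertex of abscissa `2 * i` has
weight `y i`, horizontal edges have weight `1`. -/
noncomputable def weight (G : RailYard) (y : ℤ → ℝ) (M : Set RailEdge) : ℝ :=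
  ∏ i ∈ Finset.Icc G.l G.r, y i ^ {e | e ∈ M ∧ e.kind = EdgeKind.diag ∧ e.col = i}.ncard

/-- The partition function with boundary conditions `alpha`, `beta` and weights `y`. -/
noncomputable def partitionFunction (G : RailYard) (y : ℤ → ℝ) (alpha beta : ℕ → ℕ) : ℝ :=
  ∑' M : G.coverings alpha beta, G.weight y M.1

/-- The probability that the partition of column `m` is `nu`, when a covering `M` with boundary
conditions `alpha`, `beta` has probability `weight M / partitionFunction`. -/
noncomputable def columnLaw (G : RailYard) (y : ℤ → ℝ) (alpha beta : ℕ → ℕ) (m : ℤ)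
    (nu : ℕ → ℕ) : ℝ :=
  ∑' M : {M : Set RailEdge // M ∈ G.coverings alpha beta ∧ G.HasPartition M m nu},
    G.weight y M.1 / G.partitionFunction y alpha beta

/-! ### Weight classes -/

/-- The set of `j ∈ [l..r]` with `(a_j, b_j) = (L, -)`. -/
noncomputable def LM (G : RailYard) : Finset ℤ :=
  (Finset.Icc G.l G.r).filter fun j => G.a j = LR.L ∧ G.b j = PM.minus

/-- The set of the distinct weights of the `(L, -)` columns. -/
noncomputable def values (G : RailYard) (x : ℤ → ℝ) : Finset ℝ := G.LM.image x

/-- `v` is the `i`th greatest element of the set of distinct weights of the `(L, -)` columns. -/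
def IsNthGreatest (G : RailYard) (x : ℤ → ℝ) (i : ℕ) (v : ℝ) : Prop :=
  v ∈ G.values x ∧ ((G.values x).filter fun v' => v < v').card + 1 = i

open Classical in
/-- The `(L, -)` columns of weight class `i`. -/
noncomputable def cls (G : RailYard) (x : ℤ → ℝ) (i : ℕ) : Finset ℤ :=
  G.LM.filter fun j => G.IsNthGreatest x i (x j)

/-- The `(L, -)` columns in `[t+1..r]`. -/
noncomputable def LMgt (G : RailYard) (t : ℤ) : Finset ℤ := G.LM.filter fun j => t < j

open Classical in
/-- The positions `q` for which `x (sigma q)` is the `i`th greatest weight. -/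
noncomputable def positions (G : RailYard) (x : ℤ → ℝ) (sigma : Fin G.LM.card ≃ G.LM) (i : ℕ) :
    Finset (Fin G.LM.card) :=
  Finset.univ.filter fun q => G.IsNthGreatest x i (x (sigma q))

/-- The partition formed by the `lam q` for which `x (sigma q)` is the `i`th greatest weight. It is
listed in increasing order of `q`, hence decreasingly when `lam` is a partition. -/
noncomputable def lamClass (G : RailYard) (x : ℤ → ℝ) (lam : Fin G.LM.card → ℕ)
    (sigma : Fin G.LM.card ≃ G.LM) (i : ℕ) : Fin (G.positions x sigma i).card → ℕ :=
  fun k => lam ((G.positions x sigma i).orderEmbOfFin rfl k)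

/-- `w_j`: the variable `u_j` at the `(L, -)` columns in `[t+1..r]`, and `x_j` otherwise. -/
noncomputable def mixed (G : RailYard) (x : ℤ → ℝ) (u : ℤ → ℂ) (t : ℤ) (j : ℤ) : ℂ :=
  if j ∈ G.LMgt t then u j else (x j : ℂ)

/-- The factor `1 + y_i y_j` if `a_i ≠ a_j` and `1 / (1 - y_i y_j)` if `a_i = a_j`. -/
noncomputable def pairFactor (G : RailYard) (y : ℤ → ℂ) (i j : ℤ) : ℂ :=
  if G.a i = G.a j then 1 / (1 - y i * y j) else 1 + y i * y j

/-- The ratio of Schur functions of the partition `lamClass` of class `i`, at the class `i`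
variables `w_j` over the class `i` weights `x_j`. -/
noncomputable def schurRatio (G : RailYard) (x : ℤ → ℝ) (lam : Fin G.LM.card → ℕ)
    (sigma : Fin G.LM.card ≃ G.LM) (i : ℕ) (t : ℤ) (u : ℤ → ℂ) : ℂ :=
  schur (G.lamClass x lam sigma i) (fun j : G.cls x i => G.mixed x u t j) /
    schur (G.lamClass x lam sigma i) (fun j : G.cls x i => (x j : ℂ))

open Classical in
/-- The product of `xi_ij / z_ij` over `i ∈ [l..t]` with `b_i = +` and over the `(L, -)` columns
`j ∈ [t+1..r]` of greatest weight. -/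
noncomputable def xizProd (G : RailYard) (x : ℤ → ℝ) (t : ℤ) (u : ℤ → ℂ) : ℂ :=
  ∏ i ∈ (Finset.Icc G.l t).filter (fun i => G.b i = PM.plus),
    ∏ j ∈ (G.LMgt t).filter (fun j => j ∈ G.cls x 1),
      G.pairFactor (G.mixed x u t) i j / G.pairFactor (fun k => (x k : ℂ)) i j

open Classical in
/-- The weights of the first auxiliary graph: among the `(L, -)` columns, only those of greatest
weight keep their weight; all other columns keep theirs. -/
noncomputable def firstWeight (G : RailYard) (x : ℤ → ℝ) (j : ℤ) : ℝ :=
  if j ∈ G.LM ∧ j ∉ G.cls x 1 then 0 else x j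

open Classical in
/-- The weights of the auxiliary graph of class `i ≥ 2`: only the `(L, -)` columns of class `i` keep
their weight. -/
noncomputable def otherWeight (G : RailYard) (x : ℤ → ℝ) (i : ℕ) (j : ℤ) : ℝ :=
  if j ∈ G.cls x i then x j else 0

/-- The rail-yard graph with the same sign sequence and the `LR` sequence `(L, ..., L)`. -/
def allL (G : RailYard) : RailYard :=
  { G with a := fun _ => LR.L }

open Classical in
/-- The ratio `s_mu(u_j / x_j, 0, ..., 0) / s_mu(1, ..., 1, 0, ..., 0)`: there is one variable for
each `(L, -)` column in `[t+1..r]`, and it is `0` unless the column has class `i`. -/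
noncomputable def normalizedSchur (G : RailYard) (x : ℤ → ℝ) (i : ℕ) (t : ℤ) (u : ℤ → ℂ)
    {N : ℕ} (mu : Fin N → ℕ) : ℂ :=
  schur mu (fun j : G.LMgt t => if (j : ℤ) ∈ G.cls x i then u j / (x j : ℂ) else 0) /
    schur mu (fun j : G.LMgt t => if (j : ℤ) ∈ G.cls x i then (1 : ℂ) else 0)

/-- The law, on the column of odd vertices between the even columns `2 * t` and `2 * t + 2` (that
is, column `t + 1`, of abscissa `2 * t + 1`), of the random partition of the dimer model on the
first auxiliary graph. -/
noncomputable def rhoFirst (G : RailYard) (x : ℤ → ℝ) (lam : Fin G.LM.card → ℕ)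
    (sigma : Fin G.LM.card ≃ G.LM) (t : ℤ) (mu : YY (G.LMgt t).card) : ℝ :=
  G.columnLaw (G.firstWeight x) (zeroPad (G.lamClass x lam sigma 1)) (fun _ => 0) (t + 1)
    (zeroPad mu.1)

/-- The law, on the same column, of the random partition of the dimer model on the auxiliary graph
of class `i`. -/
noncomputable def rhoOther (G : RailYard) (x : ℤ → ℝ) (lam : Fin G.LM.card → ℕ)
    (sigma : Fin G.LM.card ≃ G.LM) (i : ℕ) (t : ℤ) (mu : YY (G.LMgt t).card) : ℝ :=
  G.allL.columnLaw (G.otherWeight x i) (zeroPad (G.lamClass x lam sigma i)) (fun _ => 0) (t + 1)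
    (zeroPad mu.1)

/-- The Gibbs measure with weights `y` and boundary conditions `alpha`, `beta` is well defined: the
weights are non-negative and summable over the coverings, with a positive sum. -/
def GibbsWellDefined (G : RailYard) (y : ℤ → ℝ) (alpha beta : ℕ → ℕ) : Prop :=
  (∀ M ∈ G.coverings alpha beta, 0 ≤ G.weight y M) ∧
    Summable (fun M : G.coverings alpha beta => G.weight y M.1) ∧
    0 < G.partitionFunction y alpha beta

end RailYard

/-! ### Complete homogeneous symmetric functions as coefficients of a power series -/

/-! In the absence of `(R,-)` columns, a covering is the same thing as the sequence of partitions
carried by its odd columns. From left to right, an `(L,-)` column removes a horizontal strip, an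
`(L,+)` column adds one, and an `(R,+)` column adds a vertical strip; the number of diagonal edges
is the number of boxes of the strip. The right boundary is empty and, read from right to left, only
an `(L,-)` column can lengthen the partition, by at most one part. So all partitions have bounded
length.

Each column thus acts as a kernel on functions of partitions, and it maps Schur functions in the
variables of the later `(L,-)` columns to Schur functions: an `(L,-)` column adds its own variable
(branching rule), a `+` column multiplies by Cauchy factors `1 / (1 - y v_j)` or `1 + y v_j` (Pieri
rules). See `hasSum_stepWeight_mul_jt`. Starting on the right from the Schur function in no
variables, which is the indicator of the empty partition, one obtains the partition function as a
product of factors times a Schur function of the left boundary partition.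

For the expectation, the normalized Schur function is inserted at column `t + 1`. In each auxiliary
graph the nonzero `(L,-)` weights share one value `X`; by homogeneity the Schur function at these
weights is a power of `X` times its value at ones and zeros. Multiplication by the inserted ratio
therefore replaces the weights `x_j` by the variables `u_j` (`jt_extendZero_div_mul`). The recursion
continues to the left with the new variables, and division by the partition function leaves the
ratio of Schur functions and the quotients of the factors that have changed
(`IsClassWeight.prod_colFactor_div`, `IsClassWeight.hasSum_columnLaw_mul`). For classes from 2 on,
the `+` columns have weight 0 and no factor remains.

Schur functions are treated as Jacobi-Trudi determinants, and the strip rules come from row and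
column operations. Absolute convergence follows from `norm_jt_hgen_le`: the recursion run with
absolute values dominates the original one (`hasSum_pathProd`). -/

section Algebra

variable {K : Type*} [Field K]

/-- The coefficients of a power series, extended by `0` to negative indices. -/
noncomputable def hcoef (H : PowerSeries K) (k : ℤ) : K :=
  if k < 0 then 0 else PowerSeries.coeff k.toNat H

theorem hcoef_of_neg (H : PowerSeries K) {k : ℤ} (hk : k < 0) : hcoef H k = 0 := if_pos hk

theorem hcoef_natCast (H : PowerSeries K) (n : ℕ) : hcoef H n = PowerSeries.coeff n H := by
  simp [hcoef]

/-- The generating series `∏ 1 / (1 - v j X)` of the complete homogeneous symmetric functions. -/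
noncomputable def hgen (s : Finset ℤ) (v : ℤ → K) : PowerSeries K :=
  ∏ j ∈ s, PowerSeries.mk fun n => v j ^ n

/-- The polynomial `∏ (1 - v j X)`, inverse to `hgen`. -/
noncomputable def epoly (s : Finset ℤ) (v : ℤ → K) : Polynomial K :=
  ∏ j ∈ s, (1 - Polynomial.C (v j) * Polynomial.X)

theorem one_sub_mul_mk_pow (a : K) :
    (1 - PowerSeries.C a * PowerSeries.X) * PowerSeries.mk (fun n => a ^ n) = 1 := by
  ext n
  rw [sub_mul, one_mul, map_sub, mul_assoc, PowerSeries.coeff_C_mul]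
  cases n with
  | zero => simp
  | succ n => simp [PowerSeries.coeff_succ_X_mul, pow_succ']

theorem epoly_mul_hgen (s : Finset ℤ) (v : ℤ → K) :
    ((epoly s v : Polynomial K) : PowerSeries K) * hgen s v = 1 := by
  have : ((epoly s v : Polynomial K) : PowerSeries K)
      = ∏ j ∈ s, (1 - PowerSeries.C (v j) * PowerSeries.X) := by
    rw [epoly, ← Polynomial.coeToPowerSeries.ringHom_apply, map_prod]
    simp
  rw [this, hgen, ← Finset.prod_mul_distrib]
  exact Finset.prod_eq_one fun j _ => one_sub_mul_mk_pow (v j)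

theorem natDegree_epoly_le (s : Finset ℤ) (v : ℤ → K) : (epoly s v).natDegree ≤ s.card := by
  refine (Polynomial.natDegree_prod_le _ _).trans ?_
  refine (Finset.sum_le_card_nsmul _ _ 1 fun j _ => ?_).trans (by simp)
  refine (Polynomial.natDegree_sub_le _ _).trans ?_
  simp only [Polynomial.natDegree_one, zero_le, sup_of_le_right]
  exact Polynomial.natDegree_C_mul_le _ _ |>.trans Polynomial.natDegree_X_le

theorem coeff_zero_epoly (s : Finset ℤ) (v : ℤ → K) : (epoly s v).coeff 0 = 1 := by
  simp [epoly, Polynomial.coeff_zero_prod]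

theorem eval_epoly (s : Finset ℤ) (v : ℤ → K) (y : K) :
    (epoly s v).eval y = ∏ j ∈ s, (1 - y * v j) := by
  rw [epoly, Polynomial.eval_prod]
  refine Finset.prod_congr rfl fun j _ => ?_
  simp only [Polynomial.eval_sub, Polynomial.eval_one, Polynomial.eval_mul, Polynomial.eval_C,
    Polynomial.eval_X]
  ring

theorem hcoef_one {k : ℤ} (hk : k ≠ 0) : hcoef (1 : PowerSeries K) k = 0 := by
  unfold hcoef
  split_ifs
  · rfl
  · rw [PowerSeries.coeff_one, if_neg]; omega

theorem hcoef_add (F H : PowerSeries K) (k : ℤ) : hcoef (F + H) k = hcoef F k + hcoef H k := by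
  unfold hcoef; split_ifs <;> simp

theorem hcoef_C_mul_X_pow_mul (a : K) (n : ℕ) (H : PowerSeries K) (k : ℤ) :
    hcoef (PowerSeries.C a * PowerSeries.X ^ n * H) k = a * hcoef H (k - n) := by
  unfold hcoef
  rw [mul_assoc, PowerSeries.coeff_C_mul, PowerSeries.coeff_X_pow_mul']
  by_cases hk : k < 0
  · rw [if_pos hk, if_pos (by omega), mul_zero]
  · rw [if_neg hk]
    by_cases hk' : k - n < 0
    · rw [if_pos hk', if_neg (by omega)]
    · rw [if_neg hk', if_pos (by omega)]
      congr 3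
      omega

theorem hcoef_polynomial_mul (p : Polynomial K) (H : PowerSeries K) {N : ℕ}
    (hp : p.natDegree ≤ N) (k : ℤ) :
    hcoef ((p : PowerSeries K) * H) k =
      ∑ i ∈ Finset.range (N + 1), p.coeff i * hcoef H (k - i) := by
  have hsum : ((p : PowerSeries K) * H) = ∑ i ∈ Finset.range (N + 1),
      PowerSeries.C (p.coeff i) * PowerSeries.X ^ i * H := by
    conv_lhs => rw [p.as_sum_range' (N + 1) (by omega)]
    rw [← Polynomial.coeToPowerSeries.ringHom_apply, map_sum, Finset.sum_mul]
    refine Finset.sum_congr rfl fun i _ => ?_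
    rw [Polynomial.coeToPowerSeries.ringHom_apply, Polynomial.coe_monomial,
      PowerSeries.monomial_eq_mk]
    congr 1
    ext m
    simp [PowerSeries.coeff_C_mul, PowerSeries.coeff_X_pow]
  rw [hsum]
  clear hsum
  generalize Finset.range (N + 1) = r
  induction r using Finset.induction_on with
  | empty => simp [hcoef]
  | insert a r ha ih =>
    rw [Finset.sum_insert ha, Finset.sum_insert ha, hcoef_add, ih, hcoef_C_mul_X_pow_mul]

/-- Compare coefficients in `epoly_mul_hgen`. This is the linear recurrence required by
`det_sub_mul_succ`; it fails only at `k = 0`, an index that the matrices below never reach. -/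
theorem sum_coeff_epoly_mul_hcoef (s : Finset ℤ) (v : ℤ → K) {N : ℕ} (hs : s.card ≤ N) {k : ℤ}
    (hk : k ≠ 0) :
    ∑ i ∈ Finset.range (N + 1), (epoly s v).coeff i * hcoef (hgen s v) (k - i) = 0 := by
  rw [← hcoef_polynomial_mul _ _ ((natDegree_epoly_le s v).trans hs), epoly_mul_hgen, hcoef_one hk]

theorem hcoef_hgen_insert {s : Finset ℤ} {j : ℤ} (hj : j ∉ s) (v : ℤ → K) (k : ℤ) :
    hcoef (hgen (insert j s) v) k =
      hcoef (hgen s v) k + v j * hcoef (hgen (insert j s) v) (k - 1) := by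
  have h : hgen (insert j s) v = hgen s v +
      PowerSeries.C (v j) * PowerSeries.X ^ 1 * hgen (insert j s) v := by
    rw [hgen, Finset.prod_insert hj]
    have := one_sub_mul_mk_pow (v j)
    change _ * hgen s v = hgen s v + _ * (_ * hgen s v)
    linear_combination (hgen s v) * this
  conv_lhs => rw [h]
  rw [hcoef_add, hcoef_C_mul_X_pow_mul]
  simp

theorem hcoef_hgen_mul (s : Finset ℤ) (v : ℤ → K) (c : K) (n : ℕ) :
    hcoef (hgen s fun j => c * v j) n = c ^ n * hcoef (hgen s v) n := by
  have h : (hgen s fun j => c * v j) = PowerSeries.rescale c (hgen s v) := by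
    rw [hgen, hgen, map_prod]
    refine Finset.prod_congr rfl fun j _ => ?_
    ext n
    simp [PowerSeries.coeff_rescale, mul_pow]
  rw [h, hcoef_natCast, hcoef_natCast, PowerSeries.coeff_rescale]

theorem hgen_eq_of_zero {s s' : Finset ℤ} (hs : s' ⊆ s) {v w : ℤ → K} (hv : ∀ j ∈ s, j ∉ s' → v j = 0)
    (hvw : ∀ j ∈ s', v j = w j) : hgen s v = hgen s' w := by
  rw [hgen, hgen, ← Finset.prod_subset hs]
  · exact Finset.prod_congr rfl fun j hj => by rw [hvw j hj]
  · intro j hj hj'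
    rw [hv j hj hj']
    ext n
    rcases n with _ | n <;> simp [PowerSeries.coeff_one]

/-- The Jacobi-Trudi determinant attached to a power series. -/
noncomputable def jt (H : PowerSeries K) {N : ℕ} (mu : Fin N → ℕ) : K :=
  Matrix.det (Matrix.of fun i j : Fin N => hcoef H ((mu i : ℤ) - ((i : ℕ) : ℤ) + ((j : ℕ) : ℤ)))

end Algebra

/-- Expanding the product of geometric series gives one monomial per exponent vector of total degree
`n`, and exponent vectors correspond to multisets of size `n`. -/
theorem completeHom_eq_hcoef (s : Finset ℤ) (v : ℤ → ℂ) (k : ℤ) :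
    completeHom (fun j : s => v j) k = hcoef (hgen s v) k := by
  unfold completeHom hcoef
  congr 1
  generalize k.toNat = n
  rw [hgen, PowerSeries.coeff_prod, MvPolynomial.hsymm, map_sum,
    ← Finset.sum_coe_sort (Finset.finsuppAntidiag s n)]
  refine Fintype.sum_equiv (Finset.finsuppAntidiagEquiv s n).symm _ _ fun x => ?_
  rw [← Finset.prod_coe_sort s]
  simp only [PowerSeries.coeff_mk, Finset.finsuppAntidiagEquiv_symm_apply_apply]
  rw [map_multiset_prod, Multiset.map_map]
  simp only [Function.comp_def, MvPolynomial.eval_X]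
  rw [Finset.prod_multiset_map_count]
  refine Finset.prod_subset (Finset.subset_univ _) fun j _ hj => ?_
  rw [Multiset.mem_toFinset, ← Multiset.count_eq_zero] at hj
  rw [hj, pow_zero]

theorem schur_eq_jt {N : ℕ} (mu : Fin N → ℕ) (s : Finset ℤ) (v : ℤ → ℂ) :
    schur mu (fun j : s => v j) = jt (hgen s v) mu := by
  simp only [schur, jt, completeHom_eq_hcoef]

/-! ### Determinant identities -/

section Determinants

variable {R : Type*} [CommRing R] {N : ℕ}

/-- The relation says `(1 - C) * A = B` with `1 - C` unitriangular. It serves to discard from each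
row a multiple of a later row; the strictly lower variant discards multiples of earlier rows. -/
theorem det_eq_of_eq_add_strictUpper_mul (A B C : Matrix (Fin N) (Fin N) R)
    (hC : ∀ i k, k ≤ i → C i k = 0) (h : A = B + C * A) : A.det = B.det := by
  have hB : (1 - C) * A = B := by
    rw [sub_mul, one_mul, sub_eq_iff_eq_add]
    exact h
  have hdet : (1 - C).det = 1 := by
    rw [Matrix.det_of_isUpperTriangular]
    · exact Finset.prod_eq_one fun i _ => by simp [hC i i le_rfl]
    · intro i k hik
      have hik' : k < i := hik
      simp [hC i k hik'.le, Matrix.one_apply_ne hik'.ne']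
  rw [← hB, Matrix.det_mul, hdet, one_mul]

theorem det_eq_of_eq_add_strictLower_mul (A B C : Matrix (Fin N) (Fin N) R)
    (hC : ∀ i k, i ≤ k → C i k = 0) (h : A = B + C * A) : A.det = B.det := by
  have hB : (1 - C) * A = B := by
    rw [sub_mul, one_mul, sub_eq_iff_eq_add]
    exact h
  have hdet : (1 - C).det = 1 := by
    rw [Matrix.det_of_isLowerTriangular]
    · exact Finset.prod_eq_one fun i _ => by simp [hC i i le_rfl]
    · intro i k hik
      have hik' : i < k := hik
      simp [hC i k hik'.le, Matrix.one_apply_ne hik'.ne]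
  rw [← hB, Matrix.det_mul, hdet, one_mul]

/-- If the columns `X_0, ..., X_N` satisfy the linear recurrence with characteristic coefficients
`p`, the column operation `X_j - y X_{j+1}` multiplies the determinant by `∑ p_k y^k`. -/
theorem det_sub_mul_succ (X : Fin N → ℕ → R) (p : ℕ → R) (hp : p 0 = 1) (y : R)
    (hX : ∀ i, ∑ k ∈ Finset.range (N + 1), p k * X i (N - k) = 0) :
    Matrix.det (Matrix.of fun i j : Fin N => X i j - y * X i (j + 1)) =
      (∑ k ∈ Finset.range (N + 1), p k * y ^ k) *
        Matrix.det (Matrix.of fun i j : Fin N => X i j) := by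
  set A : Matrix (Fin N) (Fin N) R := Matrix.of fun i j : Fin N => X i j with hA
  set B : Matrix (Fin N) (Fin N) R := Matrix.of fun i j : Fin N => X i j - y * X i (j + 1) with hB
  -- Unitriangular matrix of powers of `y`: column `j` of `B * T` is a geometric combination of the
  -- columns `X_m - y X_{m+1}` with `m ≥ j`, which telescopes to `X_j - y^(N-j) X_N`.
  let T : Matrix (Fin N) (Fin N) R := Matrix.of fun m j : Fin N =>
    if j ≤ m then y ^ ((m : ℕ) - j) else 0
  have hT : T.det = 1 := by
    rw [Matrix.det_of_isLowerTriangular]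
    · exact Finset.prod_eq_one fun i _ => by simp [T]
    · intro i k hik
      have hik' : i < k := hik
      simp [T, hik'.not_ge]
  have htel : ∀ i : Fin N, ∀ n j : ℕ,
      ∑ m ∈ Finset.range n, y ^ m * (X i (j + m) - y * X i (j + m + 1)) =
        X i j - y ^ n * X i (j + n) := by
    intro i n j
    induction n with
    | zero => simp
    | succ n ih => rw [Finset.sum_range_succ, ih, ← add_assoc]; ring
  have hBT : B * T = Matrix.of fun i j : Fin N => X i j - y ^ (N - (j : ℕ)) * X i N := by
    ext i j
    have h := htel i (N - j) j
    rw [show (j : ℕ) + (N - j) = N by omega] at h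
    rw [Matrix.mul_apply, Matrix.of_apply, ← h]
    simp only [T, hB, Matrix.of_apply, mul_ite, mul_zero]
    rw [← Finset.sum_filter]
    refine Finset.sum_bij' (t := Finset.range (N - (j : ℕ))) (fun (m : Fin N) _ => (m : ℕ) - (j : ℕ))
      (fun (m : ℕ) (hm : m ∈ Finset.range (N - (j : ℕ))) =>
        (⟨j + m, by have := Finset.mem_range.1 hm; omega⟩ : Fin N)) ?_ ?_ ?_ ?_ ?_
    · intro m hm
      have : j ≤ m := (Finset.mem_filter.1 hm).2
      have : (j : ℕ) ≤ m := this
      exact Finset.mem_range.2 (by omega)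
    · intro m hm
      exact Finset.mem_filter.2 ⟨Finset.mem_univ _, Fin.le_def.2 (by simp)⟩
    · intro m hm
      have : j ≤ m := (Finset.mem_filter.1 hm).2
      have : (j : ℕ) ≤ m := this
      ext; simp; omega
    · intro m hm
      simp
    · intro m hm
      have : j ≤ m := (Finset.mem_filter.1 hm).2
      have : (j : ℕ) ≤ m := this
      rw [show (j : ℕ) + (m - j) = m by omega]
      ring
  -- Since `p 0 = 1`, the recurrence expresses the column `X_N` through the columns of `A`.
  have hXN : ∀ i, X i N = -∑ k : Fin N, X i k * p (N - k) := by
    intro i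
    have h := hX i
    rw [← Finset.sum_range_reflect] at h
    simp only [Nat.add_sub_cancel] at h
    rw [Finset.sum_range_succ, ← Fin.sum_univ_eq_sum_range
      (fun j => p (N - j) * X i (N - (N - j)))] at h
    simp only [Nat.sub_self, hp, one_mul, Nat.sub_zero] at h
    rw [eq_neg_iff_add_eq_zero, add_comm, ← h]
    congr 1
    refine Finset.sum_congr rfl fun k _ => ?_
    rw [show N - (N - (k : ℕ)) = k by omega, mul_comm]
  -- Hence `B * T` is `A` times a rank-one perturbation of the identity, and the matrix determinant
  -- lemma yields the scalar `∑ p_k y^k`.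
  have hBT' : B * T = A * (1 + Matrix.replicateCol Unit (fun k : Fin N => p (N - k)) *
      Matrix.replicateRow Unit (fun j : Fin N => y ^ (N - (j : ℕ)))) := by
    rw [hBT, mul_add, mul_one]
    ext i j
    rw [← Matrix.mul_assoc, Matrix.add_apply, Matrix.mul_apply, Matrix.of_apply, hXN i]
    simp only [Finset.univ_unique, Finset.sum_singleton, Matrix.replicateRow_apply,
      Matrix.mul_apply, Matrix.replicateCol_apply, hA, Matrix.of_apply]
    ring
  have hdet := congrArg Matrix.det hBT'
  rw [Matrix.det_mul, Matrix.det_mul, hT, mul_one,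
    Matrix.det_one_add_replicateCol_mul_replicateRow] at hdet
  rw [hdet, mul_comm]
  congr 1
  rw [← Finset.sum_range_reflect]
  simp only [Nat.add_sub_cancel]
  rw [Finset.sum_range_succ, ← Fin.sum_univ_eq_sum_range
    (fun j => p (N - j) * y ^ (N - j))]
  simp only [Nat.sub_self, hp, pow_zero, mul_one, dotProduct]
  rw [add_comm]
  congr 1
  exact Finset.sum_congr rfl fun k _ => mul_comm _ _

end Determinants

/-! ### Multilinear expansion of determinants into absolutely convergent sums -/

section Sums

variable {K : Type*} [RCLike K] {N : ℕ}

theorem summable_norm_of_hasSum {α : Type*} {f : α → K} {a : K} (h : HasSum f a) :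
    Summable fun x => ‖f x‖ :=
  (summable_norm_iff (E := K)).2 h.summable

theorem HasSum.mul_of_rclike {α β : Type*} {f : α → K} {g : β → K} {a b : K} (h : HasSum f a)
    (h' : HasSum g b) : HasSum (fun x : α × β => f x.1 * g x.2) (a * b) :=
  h.mul h' (summable_mul_of_summable_norm (summable_norm_of_hasSum h) (summable_norm_of_hasSum h'))

/-- Over the real or complex numbers summability is absolute, so sums over independent indices may
be multiplied; induction on the number of factors. -/
theorem hasSum_pi_prod {n : ℕ} (f : Fin n → ℕ → K) (a : Fin n → K)
    (h : ∀ i, HasSum (f i) (a i)) :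
    HasSum (fun c : Fin n → ℕ => ∏ i, f i (c i)) (∏ i, a i) := by
  induction n with
  | zero => simp [hasSum_unique]
  | succ n ih =>
    have ih' := ih (fun i => f i.succ) (fun i => a i.succ) fun i => h i.succ
    have hm := (h 0).mul_of_rclike ih'
    let e : ℕ × (Fin n → ℕ) ≃ (Fin (n + 1) → ℕ) := Fin.consEquiv fun _ => ℕ
    rw [← e.hasSum_iff, Fin.prod_univ_succ]
    refine hm.congr_fun fun x => ?_
    simp [e, Fin.consEquiv, Fin.prod_univ_succ]

theorem hasSum_det (r : Fin N → ℕ → Fin N → K) (B : Matrix (Fin N) (Fin N) K)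
    (h : ∀ i j, HasSum (fun c => r i c j) (B i j)) :
    HasSum (fun c : Fin N → ℕ => Matrix.det (Matrix.of fun i j => r i (c i) j)) B.det := by
  rw [← Matrix.det_transpose, Matrix.det_apply']
  simp_rw [fun c : Fin N → ℕ => (Matrix.det_transpose (Matrix.of fun i j => r i (c i) j)).symm,
    Matrix.det_apply', Matrix.transpose_apply, Matrix.of_apply]
  refine hasSum_sum fun σ _ => HasSum.mul_left _ ?_
  exact hasSum_pi_prod (fun i c => r i c (σ i)) _ fun i => h i (σ i)

/-- Row `i` of the determinant depends on `c i` only, so summing over all sequences `c`, monotone or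
not, can be done row by row. The strip rules choose `f` so that only interlacing sequences
contribute. -/
theorem hasSum_prod_mul_jt (H : PowerSeries K) (f : Fin N → ℕ → K) (B : Matrix (Fin N) (Fin N) K)
    (h : ∀ i j : Fin N, HasSum (fun c : ℕ => f i c * hcoef H ((c : ℤ) - ((i : ℕ) : ℤ) + (j : ℕ)))
      (B i j)) :
    HasSum (fun c : Fin N → ℕ => (∏ i, f i (c i)) * jt H c) B.det := by
  convert hasSum_det (fun i c j => f i c * hcoef H ((c : ℤ) - ((i : ℕ) : ℤ) + (j : ℕ))) B h with c
  exact (Matrix.det_mul_column (fun i => f i (c i)) _).symm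

/-- Rescaling absorbs `y` into the variables; the coefficients are then those of a Cauchy product of
convergent geometric series. -/
theorem summable_pow_mul_coeff_hgen (s : Finset ℤ) (v : ℤ → K) (y : K)
    (h : ∀ j ∈ s, ‖y * v j‖ < 1) :
    Summable fun n : ℕ => y ^ n * PowerSeries.coeff n (hgen s v) := by
  have key : ∀ w : ℤ → K, (∀ j ∈ s, ‖w j‖ < 1) →
      Summable fun n : ℕ => ‖PowerSeries.coeff n (hgen s w)‖ := by
    intro w hw
    induction s using Finset.induction_on with
    | empty =>
      refine summable_of_ne_finset_zero (s := {0}) fun n hn => ?_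
      simp only [Finset.mem_singleton] at hn
      simp [hgen, PowerSeries.coeff_one, hn]
    | insert a s ha ih =>
      have h1 := ih (fun j hj => h j (Finset.mem_insert_of_mem hj))
        fun j hj => hw j (Finset.mem_insert_of_mem hj)
      have h2 : Summable fun n : ℕ => ‖w a ^ n‖ := by
        simp_rw [norm_pow]
        exact summable_geometric_of_lt_one (norm_nonneg _) (hw a (Finset.mem_insert_self _ _))
      have h3 := summable_norm_sum_mul_antidiagonal_of_summable_norm h2 h1
      refine h3.congr fun n => ?_
      rw [show hgen (insert a s) w = (PowerSeries.mk fun n => w a ^ n) * hgen s w from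
        Finset.prod_insert ha, PowerSeries.coeff_mul]
      simp only [PowerSeries.coeff_mk]
  have h1 := summable_norm_iff.1 (key (fun j => y * v j) h)
  refine h1.congr fun n => ?_
  have := hcoef_hgen_mul s v y n
  rwa [hcoef_natCast, hcoef_natCast] at this

theorem summable_pow_mul_hcoef_hgen (s : Finset ℤ) (v : ℤ → K) (y : K)
    (h : ∀ j ∈ s, ‖y * v j‖ < 1) (k : ℤ) :
    Summable fun n : ℕ => y ^ n * hcoef (hgen s v) (k + n) := by
  rcases eq_or_ne y 0 with rfl | hy
  · refine summable_of_ne_finset_zero (s := {0}) fun n hn => ?_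
    simp only [Finset.mem_singleton] at hn
    simp [hn]
  have h1 := summable_pow_mul_coeff_hgen s v y h
  rcases le_total 0 k with hk | hk
  · obtain ⟨m, rfl⟩ := Int.eq_ofNat_of_zero_le hk
    have h2 := ((summable_nat_add_iff m).2 h1).mul_left ((y ^ m)⁻¹)
    refine h2.congr fun n => ?_
    rw [← Nat.cast_add, hcoef_natCast, add_comm m n, pow_add]
    field_simp
  · obtain ⟨m, hm⟩ := Int.eq_ofNat_of_zero_le (neg_nonneg.2 hk)
    rw [← summable_nat_add_iff m]
    refine (h1.mul_left (y ^ m)).congr fun n => ?_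
    rw [show k + ((n + m : ℕ) : ℤ) = (n : ℕ) by push_cast; omega, hcoef_natCast]
    ring

end Sums

/-! ### Strips and the action of the one-column kernels on Schur functions -/

/-- `la / mu` is a horizontal strip. -/
def HorizontalStrip (la mu : ℕ → ℕ) : Prop := ∀ i, la (i + 1) ≤ mu i ∧ mu i ≤ la i

/-- `mu / la` is a vertical strip. -/
def VerticalStrip (la mu : ℕ → ℕ) : Prop := ∀ i, la i ≤ mu i ∧ mu i ≤ la i + 1

/-- The number of boxes by which two nested partitions differ. -/
def boxDist {N : ℕ} (la mu : Fin N → ℕ) : ℕ := ∑ i, ((la i - mu i) + (mu i - la i))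

section ZeroPad

variable {N : ℕ}

@[simp] theorem zeroPad_coe (mu : Fin N → ℕ) (i : Fin N) : zeroPad mu i = mu i := by
  simp [zeroPad]

theorem zeroPad_of_le (mu : Fin N → ℕ) {i : ℕ} (h : N ≤ i) : zeroPad mu i = 0 := by
  simp [zeroPad, h.not_gt]

theorem antitone_zeroPad {mu : Fin N → ℕ} (h : Antitone mu) : Antitone (zeroPad mu) := by
  intro i j hij
  by_cases hj : j < N
  · have hi : i < N := hij.trans_lt hj
    rw [zeroPad, zeroPad, dif_pos hi, dif_pos hj]
    exact h (Fin.mk_le_mk.2 hij)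
  · rw [zeroPad_of_le mu (not_lt.1 hj)]
    exact Nat.zero_le _

theorem horizontalStrip_zeroPad_iff {la mu : Fin N → ℕ} :
    HorizontalStrip (zeroPad la) (zeroPad mu) ↔
      ∀ i : Fin N, zeroPad la (i + 1) ≤ mu i ∧ mu i ≤ la i := by
  constructor
  · intro h i
    simpa using h i
  · intro h i
    by_cases hi : i < N
    · have := h ⟨i, hi⟩
      rwa [← zeroPad_coe mu, ← zeroPad_coe la] at this
    · rw [zeroPad_of_le la (by omega), zeroPad_of_le la (by omega), zeroPad_of_le mu (by omega)]
      simp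

theorem verticalStrip_zeroPad_iff {la mu : Fin N → ℕ} :
    VerticalStrip (zeroPad la) (zeroPad mu) ↔ ∀ i : Fin N, la i ≤ mu i ∧ mu i ≤ la i + 1 := by
  constructor
  · intro h i
    simpa using h i
  · intro h i
    by_cases hi : i < N
    · have := h ⟨i, hi⟩
      rwa [← zeroPad_coe mu, ← zeroPad_coe la] at this
    · rw [zeroPad_of_le la (by omega), zeroPad_of_le mu (by omega)]
      simp

theorem antitone_of_zeroPad_succ_le {mu : Fin N → ℕ}
    (h : ∀ i : Fin N, zeroPad mu (i + 1) ≤ mu i) : Antitone mu := by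
  have : Antitone (zeroPad mu) := antitone_nat_of_succ_le fun i => by
    by_cases hi : i < N
    · simpa [zeroPad, hi] using h ⟨i, hi⟩
    · rw [zeroPad_of_le mu (by omega)]
      exact Nat.zero_le _
  intro i j hij
  simpa using this (Fin.le_def.1 hij)

end ZeroPad

section Rules

variable {K : Type*} [RCLike K] {N : ℕ}

theorem hasSum_subtype_antitone {F : (Fin N → ℕ) → K} {a : K} (h : HasSum F a)
    (hF : ∀ mu, ¬ Antitone mu → F mu = 0) : HasSum (fun mu : YY N => F mu.1) a :=
  (hasSum_subtype_iff_of_support_subset (s := {mu : Fin N → ℕ | Antitone mu})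
    fun mu hmu => by_contra fun hc => hmu (hF mu hc)).2 h

/-- The one-variable recursion iterated `D` times. The remainder is kept because, for the right `D`,
it is an entry of the next row of a Jacobi-Trudi matrix. -/
theorem hcoef_hgen_insert_eq_sum {s : Finset ℤ} {j : ℤ} (hj : j ∉ s) (v : ℤ → K) (k : ℤ) (D : ℕ) :
    hcoef (hgen (insert j s) v) k = ∑ d ∈ Finset.range D, v j ^ d * hcoef (hgen s v) (k - d) +
      v j ^ D * hcoef (hgen (insert j s) v) (k - D) := by
  induction D with
  | zero => simp
  | succ D ih =>
    rw [ih, Finset.sum_range_succ, hcoef_hgen_insert hj v (k - D)]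
    rw [show k - ((D + 1 : ℕ) : ℤ) = k - D - 1 by push_cast; ring]
    ring

theorem sum_Icc_pow_sub (y : K) (F : ℤ → K) {a b : ℕ} (h : a ≤ b) (e : ℤ) :
    ∑ c ∈ Finset.Icc a b, y ^ (b - c) * F (c + e) =
      ∑ d ∈ Finset.range (b - a + 1), y ^ d * F (b + e - d) := by
  refine Finset.sum_bij' (fun c _ => b - c) (fun d _ => b - d) ?_ ?_ ?_ ?_ ?_
  · intro c hc
    have := Finset.mem_Icc.1 hc
    exact Finset.mem_range.2 (by omega)
  · intro d hd
    have := Finset.mem_range.1 hd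
    exact Finset.mem_Icc.2 (by omega)
  · intro c hc
    have := Finset.mem_Icc.1 hc
    omega
  · intro d hd
    have := Finset.mem_range.1 hd
    omega
  · intro c hc
    have := Finset.mem_Icc.1 hc
    congr 2
    push_cast [this.2]
    ring

theorem sum_Icc_pow_sub' (y : K) (F : ℤ → K) {a b : ℕ} (h : a ≤ b) (e : ℤ) :
    ∑ c ∈ Finset.Icc a b, y ^ (c - a) * F (c + e) =
      ∑ d ∈ Finset.range (b - a + 1), y ^ d * F (a + e + d) := by
  refine Finset.sum_bij' (fun c _ => c - a) (fun d _ => a + d) ?_ ?_ ?_ ?_ ?_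
  · intro c hc
    have := Finset.mem_Icc.1 hc
    exact Finset.mem_range.2 (by omega)
  · intro d hd
    have := Finset.mem_range.1 hd
    exact Finset.mem_Icc.2 (by omega)
  · intro c hc
    have := Finset.mem_Icc.1 hc
    omega
  · intro d hd
    have := Finset.mem_range.1 hd
    omega
  · intro c hc
    have := Finset.mem_Icc.1 hc
    congr 2
    push_cast [this.1]
    ring

open Classical in
/-- Branching rule: removing horizontal strips adds a variable. -/
theorem hasSum_horizontalStrip_mul_jt {s : Finset ℤ} {j : ℤ} (hj : j ∉ s) (v : ℤ → K) (la : YY N) :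
    HasSum (fun mu : YY N =>
        (if HorizontalStrip (zeroPad la.1) (zeroPad mu.1) then v j ^ boxDist la.1 mu.1 else 0) *
          jt (hgen s v) mu.1)
      (jt (hgen (insert j s) v) la.1) := by
  set y := v j with hy
  set H := hgen s v with hH
  set H' := hgen (insert j s) v with hH'
  obtain ⟨la, hla⟩ := la
  have hpad := antitone_zeroPad hla
  -- Each `f i` is supported on the interlacing interval of row `i`, so the product over `i` is the
  -- strip indicator times `y ^ boxDist`.
  let f : Fin N → ℕ → K := fun i c =>
    if zeroPad la (i + 1) ≤ c ∧ c ≤ la i then y ^ (la i - c) else 0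
  let B : Matrix (Fin N) (Fin N) K := Matrix.of fun i k : Fin N =>
    ∑ c ∈ Finset.Icc (zeroPad la (i + 1)) (la i), y ^ (la i - c) * hcoef H (c + (k - i : ℤ))
  have hle : ∀ i : Fin N, zeroPad la (i + 1) ≤ la i := fun i => by
    simpa using hpad (Nat.le_succ i)
  have h1 : HasSum (fun c : Fin N → ℕ => (∏ i, f i (c i)) * jt H c) B.det := by
    refine hasSum_prod_mul_jt H f B fun i k => ?_
    have : B i k = ∑ c ∈ Finset.Icc (zeroPad la (i + 1)) (la i),
        f i c * hcoef H ((c : ℤ) - ((i : ℕ) : ℤ) + (k : ℕ)) := by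
      simp only [B, Matrix.of_apply, f]
      refine Finset.sum_congr rfl fun c hc => ?_
      rw [if_pos (Finset.mem_Icc.1 hc)]
      congr 2
      ring
    rw [this]
    refine hasSum_sum_of_ne_finset_zero fun c hc => ?_
    rw [Finset.mem_Icc] at hc
    simp [f, if_neg hc]
  have h2 : B.det = jt H' la := by
    symm
    -- With `D = la_i - la_{i+1} + 1` the index `la_i - i + k` drops to `la_{i+1} - (i+1) + k`, so
    -- the remainder is a multiple of row `i + 1` of the same matrix.
    refine det_eq_of_eq_add_strictUpper_mul _ _
      (Matrix.of fun i k : Fin N => if (k : ℕ) = i + 1 then y ^ (la i - zeroPad la (i + 1) + 1) else 0)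
      ?_ ?_
    · intro i k hki
      have : (k : ℕ) ≤ i := hki
      simp only [Matrix.of_apply]
      rw [if_neg (by omega)]
    · ext i k
      have hC : ((Matrix.of fun i k : Fin N =>
          if (k : ℕ) = i + 1 then y ^ (la i - zeroPad la (i + 1) + 1) else 0) *
          (Matrix.of fun i j : Fin N => hcoef H' ((la i : ℤ) - ((i : ℕ) : ℤ) + ((j : ℕ) : ℤ)))) i k =
          y ^ (la i - zeroPad la (i + 1) + 1) *
            hcoef H' ((zeroPad la (i + 1) : ℤ) - ((i : ℕ) + 1 : ℤ) + (k : ℕ)) := by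
        rw [Matrix.mul_apply]
        simp only [Matrix.of_apply, ite_mul, zero_mul]
        by_cases hi : (i : ℕ) + 1 < N
        · rw [Finset.sum_eq_single (⟨i + 1, hi⟩ : Fin N)]
          · simp [zeroPad, hi]
          · intro m _ hm
            rw [if_neg]
            intro h
            exact hm (Fin.ext h)
          · simp
        -- In the last row the padded part is 0 and the remainder has negative index, so it vanishes
        -- without a next row.
        · rw [Finset.sum_eq_zero, zeroPad_of_le la (by omega), hcoef_of_neg, mul_zero]
          · have := k.2
            push_cast
            omega
          · intro m _
            rw [if_neg]
            have := m.2
            omega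
      rw [Matrix.add_apply, hC]
      simp only [Matrix.of_apply, B]
      rw [sum_Icc_pow_sub y (hcoef H) (hle i),
        hcoef_hgen_insert_eq_sum hj v _ (la i - zeroPad la (i + 1) + 1)]
      congr 1
      · refine Finset.sum_congr rfl fun d _ => ?_
        congr 2
        ring
      · congr 2
        push_cast [hle i]
        ring
  rw [h2] at h1
  have hf : ∀ c : Fin N → ℕ, ∏ i, f i (c i) =
      if HorizontalStrip (zeroPad la) (zeroPad c) then y ^ boxDist la c else 0 := by
    intro c
    simp only [f]
    rw [Finset.prod_ite_zero, horizontalStrip_zeroPad_iff]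
    simp only [Finset.mem_univ, true_implies]
    split_ifs with h
    · rw [Finset.prod_pow_eq_pow_sum]
      congr 1
      exact Finset.sum_congr rfl fun i _ => by have := (h i).2; omega
    · rfl
  simp_rw [hf] at h1
  refine hasSum_subtype_antitone (F := fun mu =>
    (if HorizontalStrip (zeroPad la) (zeroPad mu) then y ^ boxDist la mu else 0) * jt H mu) h1
    fun mu hmu => ?_
  rw [if_neg, zero_mul]
  intro h
  refine hmu (antitone_of_zeroPad_succ_le fun i => ?_)
  have h' := (h (i + 1)).2
  have h'' := (h i).1
  rw [zeroPad_coe] at h''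
  exact h'.trans h''

open Classical in
/-- Pieri rule for horizontal strips, in generating form. -/
theorem hasSum_horizontalStrip_mul_jt' {s : Finset ℤ} (hs : s.card ≤ N) (v : ℤ → K) (y : K)
    (hyv : ∀ j ∈ s, ‖y * v j‖ < 1) (la : YY N) :
    HasSum (fun mu : YY N =>
        (if HorizontalStrip (zeroPad mu.1) (zeroPad la.1) then y ^ boxDist la.1 mu.1 else 0) *
          jt (hgen s v) mu.1)
      ((∏ j ∈ s, 1 / (1 - y * v j)) * jt (hgen s v) la.1) := by
  set H := hgen s v with hH
  obtain ⟨la, hla⟩ := la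
  have hpad := antitone_zeroPad hla
  -- Coefficients of the row sums without upper bound. They satisfy `q_k - y q_{k+1} = h_k`, which
  -- links them to the determinant in the `h_k`.
  let q : ℤ → K := fun k => ∑' d : ℕ, y ^ d * hcoef H (k + d)
  have hq : ∀ k, HasSum (fun d : ℕ => y ^ d * hcoef H (k + d)) (q k) := fun k =>
    (summable_pow_mul_hcoef_hgen s v y hyv k).hasSum
  have hqD : ∀ (D : ℕ) (k : ℤ), q k =
      ∑ d ∈ Finset.range D, y ^ d * hcoef H (k + d) + y ^ D * q (k + D) := by
    intro D k
    have := (hq k).summable.sum_add_tsum_nat_add D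
    rw [(hq k).tsum_eq] at this
    rw [← this]
    congr 1
    simp only [q]
    rw [← tsum_mul_left]
    refine tsum_congr fun d => ?_
    rw [show k + ((d + D : ℕ) : ℤ) = k + D + d by push_cast; ring]
    ring
  -- The first part of the larger partition is unbounded, so row 0 carries an infinite sum; this is
  -- where the bound on `y * v j` is needed.
  let f : Fin N → ℕ → K := fun i c =>
    if la i ≤ c ∧ ((i : ℕ) = 0 ∨ c ≤ zeroPad la (i - 1)) then y ^ (c - la i) else 0
  let A : Matrix (Fin N) (Fin N) K := Matrix.of fun i k : Fin N => q (la i - (i : ℕ) + (k : ℕ))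
  let B : Matrix (Fin N) (Fin N) K := Matrix.of fun i k : Fin N =>
    if (i : ℕ) = 0 then A i k else
    ∑ c ∈ Finset.Icc (la i) (zeroPad la (i - 1)), y ^ (c - la i) * hcoef H (c + (k - i : ℤ))
  have hle : ∀ i : Fin N, la i ≤ zeroPad la (i - 1) := fun i => by
    simpa using hpad (Nat.sub_le (i : ℕ) 1)
  have h1 : HasSum (fun c : Fin N → ℕ => (∏ i, f i (c i)) * jt H c) B.det := by
    refine hasSum_prod_mul_jt H f B fun i k => ?_
    by_cases hi : (i : ℕ) = 0
    · have hB : B i k = q (la i - (i : ℕ) + (k : ℕ)) := by simp only [B, Matrix.of_apply, if_pos hi, A]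
      rw [hB, ← (add_left_injective (la i)).hasSum_iff]
      · convert! hq (la i - (i : ℕ) + (k : ℕ)) using 2 with d
        · simp only [Function.comp, f, hi]
          rw [if_pos ⟨by omega, by simp⟩, Nat.add_sub_cancel]
          congr 2
          push_cast
          ring
      · intro c hc
        simp only [f]
        rw [if_neg, zero_mul]
        rintro ⟨h, -⟩
        exact hc ⟨c - la i, Nat.sub_add_cancel h⟩
    · have : B i k = ∑ c ∈ Finset.Icc (la i) (zeroPad la (i - 1)),
          f i c * hcoef H ((c : ℤ) - ((i : ℕ) : ℤ) + (k : ℕ)) := by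
        simp only [B, Matrix.of_apply, f, if_neg hi]
        refine Finset.sum_congr rfl fun c hc => ?_
        rw [if_pos ⟨(Finset.mem_Icc.1 hc).1, Or.inr (Finset.mem_Icc.1 hc).2⟩]
        congr 2
        ring
      rw [this]
      refine hasSum_sum_of_ne_finset_zero fun c hc => ?_
      rw [Finset.mem_Icc] at hc
      simp only [f]
      rw [if_neg, zero_mul]
      rintro ⟨h, h' | h'⟩
      · exact hi h'
      · exact hc ⟨h, h'⟩
  have h2 : A.det = B.det := by
    -- Cutting the series in row `i` after the value `la_{i-1}` leaves a tail equal to `y^(la_{i-1}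
    -- - la_i + 1)` times row `i - 1`.
    refine det_eq_of_eq_add_strictLower_mul _ _
      (Matrix.of fun i k : Fin N => if (k : ℕ) + 1 = i then y ^ (la k - la i + 1) else 0) ?_ ?_
    · intro i k hki
      have : (i : ℕ) ≤ k := hki
      simp only [Matrix.of_apply]
      rw [if_neg (by omega)]
    · ext i k
      rw [Matrix.add_apply, Matrix.mul_apply]
      simp only [Matrix.of_apply, ite_mul, zero_mul, B, A]
      by_cases hi : (i : ℕ) = 0
      · rw [if_pos hi, Finset.sum_eq_zero, add_zero]
        intro m _
        rw [if_neg (by omega)]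
      · have hi' : (i : ℕ) - 1 < N := by omega
        have hz : zeroPad la (i - 1) = la ⟨i - 1, hi'⟩ := by simp [zeroPad, hi']
        rw [if_neg hi, Finset.sum_eq_single (⟨i - 1, hi'⟩ : Fin N)]
        · have hle' := hle i
          rw [hz] at hle' ⊢
          rw [if_pos (by simp only; omega), sum_Icc_pow_sub' y (hcoef H) hle',
            hqD (la ⟨i - 1, hi'⟩ - la i + 1)]
          congr 1
          · refine Finset.sum_congr rfl fun d _ => ?_
            congr 2
            ring
          · congr 2
            have : (((i : ℕ) - 1 : ℕ) : ℤ) = (i : ℕ) - 1 := by omega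
            push_cast [hle', this]
            ring
        · intro m _ hm
          rw [if_neg]
          intro h
          exact hm (Fin.ext (by simp only; omega))
        · simp
  -- Column operations turn the matrix of `q` into that of `h`. The `q`-columns obey the recurrence
  -- because they are series of shifted `h`'s, all at positive index since `i < N`.
  have h3 : jt H la = (∏ j ∈ s, (1 - y * v j)) * A.det := by
    have := det_sub_mul_succ (fun (i : Fin N) (k : ℕ) => q (la i - (i : ℕ) + k))
      (epoly s v).coeff (coeff_zero_epoly s v) y ?_
    · rw [← Polynomial.eval_eq_sum_range' (by have := natDegree_epoly_le s v; omega),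
        eval_epoly] at this
      rw [← this, jt]
      congr 2
      ext i k
      rw [hqD 1 (la i - (i : ℕ) + (k : ℕ))]
      simp [add_assoc]
    · intro i
      have hsum := hasSum_sum (s := Finset.range (N + 1)) fun k _ =>
        (hq (la i - (i : ℕ) + ((N - k : ℕ) : ℤ))).mul_left ((epoly s v).coeff k)
      refine hsum.unique ?_
      convert! hasSum_zero (α := K) (β := ℕ) using 1
      funext d
      have h0 := sum_coeff_epoly_mul_hcoef s v hs
        (k := la i - (i : ℕ) + N + d) (by have := i.2; omega)
      rw [← mul_zero (y ^ d), ← h0, Finset.mul_sum]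
      refine Finset.sum_congr rfl fun k hk => ?_
      have := Finset.mem_range.1 hk
      rw [show (la i : ℤ) - (i : ℕ) + ((N - k : ℕ) : ℤ) + d = la i - (i : ℕ) + N + d - k by omega]
      ring
  have h4 : B.det = (∏ j ∈ s, 1 / (1 - y * v j)) * jt H la := by
    rw [h3, ← mul_assoc, ← Finset.prod_mul_distrib, ← h2, Finset.prod_eq_one, one_mul]
    intro j hj
    refine one_div_mul_cancel fun h => ?_
    have := hyv j hj
    rw [← sub_eq_zero.1 h] at this
    simp at this
  rw [h4] at h1
  have hf : ∀ c : Fin N → ℕ, ∏ i, f i (c i) =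
      if HorizontalStrip (zeroPad c) (zeroPad la) then y ^ boxDist la c else 0 := by
    intro c
    simp only [f]
    rw [Finset.prod_ite_zero, horizontalStrip_zeroPad_iff]
    have hiff : (∀ i ∈ (Finset.univ : Finset (Fin N)),
        la i ≤ c i ∧ ((i : ℕ) = 0 ∨ c i ≤ zeroPad la (i - 1))) ↔
        ∀ i : Fin N, zeroPad c (i + 1) ≤ la i ∧ la i ≤ c i := by
      constructor
      · intro h i
        refine ⟨?_, (h i (Finset.mem_univ _)).1⟩
        by_cases hi : (i : ℕ) + 1 < N
        · have := (h ⟨i + 1, hi⟩ (Finset.mem_univ _)).2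
          simpa [zeroPad, hi] using this
        · rw [zeroPad_of_le c (by omega)]
          exact Nat.zero_le _
      · intro h i _
        refine ⟨(h i).2, ?_⟩
        by_cases hi : (i : ℕ) = 0
        · exact Or.inl hi
        · right
          have hi' : (i : ℕ) - 1 < N := by omega
          have := (h ⟨i - 1, hi'⟩).1
          rw [show ((⟨i - 1, hi'⟩ : Fin N) : ℕ) + 1 = i by simp only; omega, zeroPad_coe] at this
          simpa [zeroPad, hi'] using this
    by_cases h : ∀ i : Fin N, zeroPad c (i + 1) ≤ la i ∧ la i ≤ c i
    · rw [if_pos (hiff.2 h), if_pos h, Finset.prod_pow_eq_pow_sum]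
      congr 1
      exact Finset.sum_congr rfl fun i _ => by have := (h i).2; omega
    · rw [if_neg (mt hiff.1 h), if_neg h]
  simp_rw [hf] at h1
  refine hasSum_subtype_antitone (F := fun mu =>
    (if HorizontalStrip (zeroPad mu) (zeroPad la) then y ^ boxDist la mu else 0) * jt H mu) h1
    fun mu hmu => ?_
  rw [if_neg, zero_mul]
  intro h
  refine hmu (antitone_of_zeroPad_succ_le fun i => ?_)
  have h' := (h i).2
  rw [zeroPad_coe mu] at h'
  exact (h i).1.trans h'

/-- Adding at most one box per row to a partition breaks monotonicity only through `mu_{i+1} = mu_i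
+ 1`, and then rows `i` and `i + 1` coincide. So the row-by-row expansion may run over sequences
that are not partitions. -/
theorem jt_eq_zero_of_not_antitone (H : PowerSeries K) {la mu : Fin N → ℕ} (hla : Antitone la)
    (h : ∀ i, la i ≤ mu i ∧ mu i ≤ la i + 1) (hmu : ¬ Antitone mu) : jt H mu = 0 := by
  obtain ⟨i, hi⟩ : ∃ i : Fin N, ¬ zeroPad mu (i + 1) ≤ mu i := by
    by_contra! hc
    exact hmu (antitone_of_zeroPad_succ_le hc)
  have hi1 : (i : ℕ) + 1 < N := by
    by_contra hc
    rw [zeroPad_of_le mu (by omega)] at hi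
    exact hi (Nat.zero_le _)
  have hz : zeroPad mu (i + 1) = mu ⟨i + 1, hi1⟩ := by simp [zeroPad, hi1]
  rw [hz] at hi
  have h1 := h i
  have h2 := h ⟨i + 1, hi1⟩
  have h3 : la ⟨i + 1, hi1⟩ ≤ la i := hla (Fin.le_def.2 (by simp))
  refine Matrix.det_zero_of_row_eq (i := i) (j := ⟨i + 1, hi1⟩)
    (fun hc => by simpa using congrArg Fin.val hc) ?_
  funext k
  simp only [Matrix.of_apply]
  congr 1
  push_cast
  omega

open Classical in
/-- Pieri rule for vertical strips, in generating form. -/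
theorem hasSum_verticalStrip_mul_jt {s : Finset ℤ} (hs : s.card ≤ N) (v : ℤ → K) (y : K)
    (la : YY N) :
    HasSum (fun mu : YY N =>
        (if VerticalStrip (zeroPad la.1) (zeroPad mu.1) then y ^ boxDist la.1 mu.1 else 0) *
          jt (hgen s v) mu.1)
      ((∏ j ∈ s, (1 + y * v j)) * jt (hgen s v) la.1) := by
  set H := hgen s v with hH
  obtain ⟨la, hla⟩ := la
  let f : Fin N → ℕ → K := fun i c =>
    if la i ≤ c ∧ c ≤ la i + 1 then y ^ (c - la i) else 0
  let X : Fin N → ℕ → K := fun i k => hcoef H (la i - (i : ℕ) + k)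
  -- A row with zero or one added box is `X_k + y X_{k+1}`, the column operation of
  -- `det_sub_mul_succ` with parameter `-y`.
  let B : Matrix (Fin N) (Fin N) K := Matrix.of fun i k : Fin N => X i k - (-y) * X i (k + 1)
  have h1 : HasSum (fun c : Fin N → ℕ => (∏ i, f i (c i)) * jt H c) B.det := by
    refine hasSum_prod_mul_jt H f B fun i k => ?_
    have : B i k = ∑ c ∈ Finset.Icc (la i) (la i + 1),
        f i c * hcoef H ((c : ℤ) - ((i : ℕ) : ℤ) + (k : ℕ)) := by
      rw [show Finset.Icc (la i) (la i + 1) = {la i, la i + 1} by ext; simp; omega,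
        Finset.sum_pair (show la i ≠ la i + 1 by omega)]
      simp only [B, X, f, Matrix.of_apply]
      rw [if_pos ⟨le_rfl, Nat.le_add_right _ _⟩, if_pos ⟨Nat.le_add_right _ _, le_rfl⟩,
        Nat.add_sub_cancel_left, Nat.sub_self, pow_zero, pow_one, one_mul]
      rw [show ((la i + 1 : ℕ) : ℤ) - (i : ℕ) + (k : ℕ) = la i - (i : ℕ) + ((k + 1 : ℕ) : ℤ) by
        push_cast; ring]
      ring
    rw [this]
    refine hasSum_sum_of_ne_finset_zero fun c hc => ?_
    rw [Finset.mem_Icc] at hc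
    simp [f, if_neg hc]
  have h2 : B.det = (∏ j ∈ s, (1 + y * v j)) * jt H la := by
    rw [show B.det = _ from det_sub_mul_succ X (epoly s v).coeff (coeff_zero_epoly s v) (-y) ?_]
    · rw [← Polynomial.eval_eq_sum_range' (by have := natDegree_epoly_le s v; omega), eval_epoly]
      congr 1
      exact Finset.prod_congr rfl fun j _ => by ring
    · intro i
      rw [← sum_coeff_epoly_mul_hcoef s v hs (k := la i - (i : ℕ) + N) (by have := i.2; omega)]
      refine Finset.sum_congr rfl fun k hk => ?_
      have := Finset.mem_range.1 hk
      simp only [X]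
      congr 2
      omega
  rw [h2] at h1
  have hf : ∀ c : Fin N → ℕ, ∏ i, f i (c i) =
      if VerticalStrip (zeroPad la) (zeroPad c) then y ^ boxDist la c else 0 := by
    intro c
    simp only [f]
    rw [Finset.prod_ite_zero, verticalStrip_zeroPad_iff]
    simp only [Finset.mem_univ, true_implies]
    split_ifs with h
    · rw [Finset.prod_pow_eq_pow_sum]
      congr 1
      exact Finset.sum_congr rfl fun i _ => by have := (h i).1; omega
    · rfl
  simp_rw [hf] at h1
  refine hasSum_subtype_antitone (F := fun mu =>
    (if VerticalStrip (zeroPad la) (zeroPad mu) then y ^ boxDist la mu else 0) * jt H mu) h1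
    fun mu hmu => ?_
  split_ifs with h
  · rw [jt_eq_zero_of_not_antitone H hla (verticalStrip_zeroPad_iff.1 h) hmu, mul_zero]
  · rw [zero_mul]

end Rules

/-! ### Further properties of Jacobi-Trudi determinants -/

section JT

theorem hgen_empty {K : Type*} [Field K] (v : ℤ → K) : hgen ∅ v = 1 := rfl

/-- A positive first part makes the first row vanish, and the empty partition gives a unitriangular
matrix. In sums over paths this factor encodes the empty right boundary. -/
theorem jt_one {K : Type*} [Field K] {N : ℕ} (mu : YY N) :
    jt (1 : PowerSeries K) mu.1 = if mu.1 = 0 then 1 else 0 := by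
  split_ifs with h
  · rw [jt, h, Matrix.det_of_isUpperTriangular]
    · exact Finset.prod_eq_one fun i _ => by simp [hcoef]
    · intro i k hik
      have hik' : k < i := hik
      have : (k : ℕ) < i := hik'
      simp only [Matrix.of_apply, Pi.zero_apply]
      exact hcoef_of_neg _ (by push_cast; omega)
  · obtain ⟨i, hi⟩ : ∃ i, mu.1 i ≠ 0 := by
      by_contra! hc
      exact h (funext hc)
    have hN : 0 < N := i.pos
    have h0 : mu.1 ⟨0, hN⟩ ≠ 0 := by
      have := mu.2 (show (⟨0, hN⟩ : Fin N) ≤ i from Fin.le_def.2 (Nat.zero_le _))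
      omega
    refine Matrix.det_eq_zero_of_row_eq_zero ⟨0, hN⟩ fun k => ?_
    rw [Matrix.of_apply]
    refine hcoef_one ?_
    simp only
    omega

/-- Adding variables one at a time, the branching rule writes the Schur function as a sum with
monomial coefficients, so bounds on the variables pass to it. Nonnegativity at nonnegative variables
and the majorants of the path sums come from here. -/
theorem norm_jt_hgen_le {K : Type*} [RCLike K] {N : ℕ} {s : Finset ℤ} {v : ℤ → K} {w : ℤ → ℝ}
    (h : ∀ j ∈ s, ‖v j‖ ≤ w j) (mu : YY N) : ‖jt (hgen s v) mu.1‖ ≤ jt (hgen s w) mu.1 := by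
  induction s using Finset.induction_on generalizing mu with
  | empty =>
    rw [hgen_empty, hgen_empty, jt_one, jt_one]
    split_ifs <;> simp
  | insert a s ha ih =>
    refine (hasSum_horizontalStrip_mul_jt ha v mu).norm_le_of_bounded
      (hasSum_horizontalStrip_mul_jt ha w mu) fun nu => ?_
    have h1 := ih (fun j hj => h j (Finset.mem_insert_of_mem hj)) nu
    have h2 := h a (Finset.mem_insert_self _ _)
    rw [norm_mul]
    refine mul_le_mul ?_ h1 (norm_nonneg _) ?_
    · split_ifs
      · rw [norm_pow]
        exact pow_le_pow_left₀ (norm_nonneg _) h2 _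
      · simp
    · split_ifs
      · exact pow_nonneg ((norm_nonneg _).trans h2) _
      · rfl

theorem jt_hgen_nonneg {N : ℕ} {s : Finset ℤ} {v : ℤ → ℝ} (h : ∀ j ∈ s, 0 ≤ v j) (mu : YY N) :
    0 ≤ jt (hgen s v) mu.1 :=
  (norm_nonneg _).trans
    (norm_jt_hgen_le (v := v) (fun j hj => (Real.norm_of_nonneg (h j hj)).le) mu)

theorem jt_hgen_pos {N : ℕ} {s : Finset ℤ} {v : ℤ → ℝ} (h : ∀ j ∈ s, 0 < v j) (mu : YY N)
    (hmu : ∀ i : Fin N, s.card ≤ i → mu.1 i = 0) : 0 < jt (hgen s v) mu.1 := by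
  induction s using Finset.induction_on generalizing mu with
  | empty =>
    rw [hgen_empty, jt_one, if_pos (show mu.1 = 0 from funext fun i => hmu i (by simp))]
    exact one_pos
  | insert a s ha ih =>
    have hpad := antitone_zeroPad mu.2
    -- Dropping the first part is the removal of a horizontal strip and shortens the partition by
    -- one part; this single positive term of the branching sum suffices.
    let nu : YY N := ⟨fun i => zeroPad mu.1 (i + 1), fun i k hik =>
      hpad (Nat.succ_le_succ (Fin.le_def.1 hik))⟩
    have hs : ∀ j ∈ s, 0 < v j := fun j hj => h j (Finset.mem_insert_of_mem hj)
    have ha' := h a (Finset.mem_insert_self _ _)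
    have hnu : 0 < jt (hgen s v) nu.1 := by
      refine ih hs nu fun i hi => ?_
      by_cases hi' : (i : ℕ) + 1 < N
      · have := hmu ⟨i + 1, hi'⟩ (by rw [Finset.card_insert_of_notMem ha]; simpa using hi)
        simpa [nu, zeroPad, hi'] using this
      · exact zeroPad_of_le _ (by omega)
    refine lt_of_lt_of_le ?_ (le_hasSum (hasSum_horizontalStrip_mul_jt ha v mu) nu fun ka _ => ?_)
    · rw [if_pos]
      · exact mul_pos (pow_pos ha' _) hnu
      · rw [horizontalStrip_zeroPad_iff]
        intro i
        refine ⟨le_rfl, ?_⟩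
        rw [← zeroPad_coe mu.1]
        exact hpad (Nat.le_succ _)
    · refine mul_nonneg ?_ (jt_hgen_nonneg (fun j hj => (hs j hj).le) ka)
      split_ifs
      · exact pow_nonneg ha'.le _
      · rfl

/-- Entry `(i, j)` has degree `mu_i - i + j`: powers of `c` factor out of rows and columns, and the
staircase exponents cancel. -/
theorem jt_hgen_mul {K : Type*} [Field K] {N : ℕ} (s : Finset ℤ) (v : ℤ → K) {c : K} (hc : c ≠ 0)
    (mu : Fin N → ℕ) :
    jt (hgen s fun j => c * v j) mu = c ^ (∑ i, mu i) * jt (hgen s v) mu := by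
  have hk : ∀ k : ℤ, hcoef (hgen s fun j => c * v j) k = c ^ k * hcoef (hgen s v) k := by
    intro k
    rcases lt_or_ge k 0 with h | h
    · rw [hcoef_of_neg _ h, hcoef_of_neg _ h, mul_zero]
    · obtain ⟨n, rfl⟩ := Int.eq_ofNat_of_zero_le h
      rw [hcoef_hgen_mul, zpow_natCast]
  have h1 : jt (hgen s fun j => c * v j) mu = Matrix.det (Matrix.of fun i j : Fin N =>
      (c ^ mu i * (c ^ (i : ℕ))⁻¹) * (Matrix.of fun i j : Fin N => c ^ (j : ℕ) *
        (Matrix.of fun i j : Fin N =>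
          hcoef (hgen s v) ((mu i : ℤ) - ((i : ℕ) : ℤ) + ((j : ℕ) : ℤ))) i j) i j) := by
    rw [jt]
    congr 1
    ext i j
    simp only [Matrix.of_apply]
    rw [hk, zpow_add₀ hc, zpow_sub₀ hc]
    simp only [zpow_natCast]
    ring
  rw [h1, Matrix.det_mul_column, Matrix.det_mul_row, jt, Finset.prod_mul_distrib,
    Finset.prod_inv_distrib, Finset.prod_pow_eq_pow_sum, ← mul_assoc]
  congr 1
  rw [mul_assoc, inv_mul_cancel₀, mul_one]
  exact Finset.prod_ne_zero_iff.2 fun i _ => pow_ne_zero _ hc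

/-- A zero last part makes the last row `(0, ..., 0, 1)`, its earlier entries having negative index.
The value therefore does not depend on the length at which a partition is written. -/
theorem jt_zeroPad {K : Type*} [Field K] (H : PowerSeries K) (hH : PowerSeries.coeff 0 H = 1)
    {n N : ℕ} (hn : n ≤ N) (mu : Fin n → ℕ) : jt H (fun i : Fin N => zeroPad mu i) = jt H mu := by
  induction N, hn using Nat.le_induction with
  | base => simp
  | succ N hN ih =>
    rw [← ih, jt, Matrix.det_succ_row _ (Fin.last N), Finset.sum_eq_single (Fin.last N)]
    · simp only [Matrix.of_apply, Fin.val_last]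
      rw [zeroPad_of_le mu hN]
      have : hcoef H (((0 : ℕ) : ℤ) - (N : ℤ) + N) = 1 := by simp [hcoef, hH]
      rw [this, Even.neg_one_pow ⟨N, rfl⟩, one_mul, one_mul, jt]
      congr 1
      ext i j
      simp
    · intro j _ hj
      rw [Matrix.of_apply, Fin.val_last, zeroPad_of_le mu hN, hcoef_of_neg, mul_zero, zero_mul]
      have : (j : ℕ) < N := Fin.val_lt_last hj
      push_cast
      omega
    · simp

theorem coeff_zero_hgen {K : Type*} [Field K] (s : Finset ℤ) (v : ℤ → K) :
    PowerSeries.coeff 0 (hgen s v) = 1 := by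
  simp [hgen, PowerSeries.coeff_zero_eq_constantCoeff, map_prod]

theorem jt_hgen_ofReal {N : ℕ} (s : Finset ℤ) (v : ℤ → ℝ) (mu : Fin N → ℕ) :
    jt (hgen s fun j => (v j : ℂ)) mu = ((jt (hgen s v) mu : ℝ) : ℂ) := by
  have hH : (hgen s fun j => (v j : ℂ)) = PowerSeries.map Complex.ofRealHom (hgen s v) := by
    rw [hgen, hgen, map_prod]
    refine Finset.prod_congr rfl fun j _ => ?_
    ext n
    simp
  change _ = Complex.ofRealHom (jt (hgen s v) mu)
  rw [jt, jt, RingHom.map_det, hH]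
  congr 1
  ext i j
  simp only [Matrix.of_apply, RingHom.mapMatrix_apply, Matrix.map_apply, hcoef]
  split_ifs <;> simp

end JT

/-! ### Sums over paths -/

section Paths

variable {Y : Type*}

/-- The product of the kernels `k i` along the path `la, p 0, p 1, ...`. -/
def pathProd {K : Type*} [CommMonoid K] : {n : ℕ} → (ℕ → Y → Y → K) → Y → (Fin n → Y) → K
  | 0, _, _, _ => 1
  | _ + 1, k, la, p => k 0 la (p 0) * pathProd (fun i => k (i + 1)) (p 0) (fun i => p i.succ)

/-- The last point of the path `la, p 0, p 1, ...`. -/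
def pathLast : {n : ℕ} → Y → (Fin n → Y) → Y
  | 0, la, _ => la
  | n + 1, _, p => p (Fin.last n)

theorem pathLast_succ {n : ℕ} (la : Y) (p : Fin (n + 1) → Y) :
    pathLast la p = pathLast (p 0) (fun i : Fin n => p i.succ) := by
  cases n <;> rfl

/-- The functions `f i` solve a backward recursion, so `f 0` is formally the sum over paths. The
nonnegative `F i` satisfy the recursion with absolute values as an inequality, which bounds the sum
of norms and justifies iterating the sums. -/
theorem hasSum_pathProd {n : ℕ} (k : ℕ → Y → Y → ℂ) (f : ℕ → Y → ℂ) (F : ℕ → Y → ℝ)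
    (hF : ∀ i la, 0 ≤ F i la) (hfF : ∀ la, ‖f n la‖ ≤ F n la)
    (hk : ∀ i < n, ∀ la, HasSum (fun mu => k i la mu * f (i + 1) mu) (f i la))
    (hK : ∀ i < n, ∀ la, ∃ S ≤ F i la, HasSum (fun mu => ‖k i la mu‖ * F (i + 1) mu) S) (la : Y) :
    HasSum (fun p : Fin n → Y => pathProd k la p * f n (pathLast la p)) (f 0 la) ∧
      ∃ S ≤ F 0 la, HasSum (fun p : Fin n → Y => ‖pathProd k la p * f n (pathLast la p)‖) S := by
  induction n generalizing k f F la with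
  | zero =>
    refine ⟨?_, ‖f 0 la‖, hfF la, ?_⟩
    · simp [pathProd, pathLast]
    · simp [pathProd, pathLast]
  | succ n ih =>
    have ih' := ih (fun i => k (i + 1)) (fun i => f (i + 1)) (fun i => F (i + 1))
      (fun i => hF (i + 1)) hfF (fun i hi => hk (i + 1) (by omega))
      (fun i hi => hK (i + 1) (by omega))
    let e : (Σ _ : Y, Fin n → Y) ≃ (Fin (n + 1) → Y) :=
      (Equiv.sigmaEquivProd Y (Fin n → Y)).trans (Fin.consEquiv fun _ => Y)
    have he : ∀ x, pathProd k la (e x) * f (n + 1) (pathLast la (e x)) =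
        k 0 la x.1 * (pathProd (fun i => k (i + 1)) x.1 x.2 * f (n + 1) (pathLast x.1 x.2)) := by
      rintro ⟨mu, p⟩
      rw [pathLast_succ, pathProd]
      simp [e, Fin.consEquiv, mul_assoc]
    obtain ⟨S, hS, hSsum⟩ := hK 0 (Nat.succ_pos n) la
    choose T hT hTsum using fun mu => (ih' mu).2
    have hT0 : ∀ mu, 0 ≤ T mu := fun mu => (hTsum mu).nonneg fun _ => norm_nonneg _
    have hTs : Summable fun mu => ‖k 0 la mu‖ * T mu :=
      Summable.of_nonneg_of_le (fun mu => mul_nonneg (norm_nonneg _) (hT0 mu))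
        (fun mu => mul_le_mul_of_nonneg_left (hT mu) (norm_nonneg _)) hSsum.summable
    have hsum : HasSum (fun x => ‖pathProd k la (e x) * f (n + 1) (pathLast la (e x))‖)
        (∑' mu, ‖k 0 la mu‖ * T mu) := by
      simp_rw [he, norm_mul (k 0 la _)]
      have hfib : ∀ mu, HasSum (fun p : Fin n → Y => ‖k 0 la mu‖ *
          ‖pathProd (fun i => k (i + 1)) mu p * f (n + 1) (pathLast mu p)‖) (‖k 0 la mu‖ * T mu) :=
        fun mu => (hTsum mu).mul_left _
      refine HasSum.sigma_of_hasSum hTs.hasSum (fun mu => hfib mu) ?_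
      refine (summable_sigma_of_nonneg fun x => by positivity).2
        ⟨fun mu => (hfib mu).summable, ?_⟩
      simp_rw [fun mu => (hfib mu).tsum_eq]
      exact hTs
    refine ⟨?_, _, ?_, e.hasSum_iff.1 hsum⟩
    · rw [← e.hasSum_iff]
      refine HasSum.sigma_of_hasSum (hk 0 (Nat.succ_pos n) la) (fun mu => ?_) hsum.summable.of_norm
      simp only [Function.comp_apply, he]
      exact (ih' mu).1.mul_left _
    · refine le_trans ?_ hS
      exact hasSum_le (fun mu => mul_le_mul_of_nonneg_left (hT mu) (norm_nonneg _)) hTs.hasSum hSsum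

end Paths

/-! ### Maya diagrams -/

open Classical in
/-- The number of elements of `P` in `[a, b)`. -/
noncomputable def countIn (P : Set ℤ) (a b : ℤ) : ℕ := ((Finset.Ico a b).filter (· ∈ P)).card

/-- The position of the `i`th highest particle of a partition of charge `0`. -/
def mayaPos (nu : ℕ → ℕ) (i : ℕ) : ℤ := (nu i : ℤ) - i - 1

/-- The particles of a partition of charge `0`. -/
def maya (nu : ℕ → ℕ) : Set ℤ := Set.range (mayaPos nu)

/-- Non-increasing and eventually zero sequences. -/
def IsPart (nu : ℕ → ℕ) : Prop := Antitone nu ∧ ∃ K, ∀ i, K ≤ i → nu i = 0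

/-- All sites below `-K` are occupied and all sites from `K` on are empty. -/
def FrozenOutside (P : Set ℤ) (K : ℕ) : Prop :=
  (∀ k : ℤ, k < -K → k ∈ P) ∧ ∀ k : ℤ, (K : ℤ) ≤ k → k ∉ P

/-- The set of particles `P` has the partition `nu`. -/
def SetHasPartition (P : Set ℤ) (nu : ℕ → ℕ) : Prop :=
  ∀ i : ℕ, ∃ k : ℤ, k ∈ P ∧ {k' : ℤ | k < k' ∧ k' ∈ P}.encard = (i : ℕ∞) ∧
    {k' : ℤ | k' < k ∧ k' ∉ P}.encard = (nu i : ℕ∞)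

/-- The charge of a set of particles. -/
noncomputable def setCharge (P : Set ℤ) : ℤ :=
  ({k : ℤ | 0 ≤ k ∧ k ∈ P}.ncard : ℤ) - ({k : ℤ | k < 0 ∧ k ∉ P}.ncard : ℤ)

/-- `B` is obtained from `A` by moving the elements of `D` by `d`. -/
structure ShiftBy (d : ℤ) (A B D : Set ℤ) : Prop where
  sub : ∀ k ∈ D, k ∈ A
  mem_iff : ∀ k, k ∈ B ↔ (k ∈ A ∧ k ∉ D) ∨ k - d ∈ D
  disj : ∀ k, k ∈ A → k ∉ D → k - d ∉ D

/-- `B` is obtained from `A` by moving the elements of `D` up by one. -/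
abbrev ShiftUp (A B D : Set ℤ) : Prop := ShiftBy 1 A B D

section Maya

open Classical in
theorem countIn_add_one (P : Set ℤ) (a : ℤ) (n : ℕ) :
    countIn P a (a + (n + 1 : ℕ)) = countIn P a (a + n) + if a + n ∈ P then 1 else 0 := by
  have : Finset.Ico a (a + (n + 1 : ℕ)) = insert (a + n : ℤ) (Finset.Ico a (a + n)) := by
    ext k
    simp only [Finset.mem_insert, Finset.mem_Ico]
    push_cast
    omega
  rw [countIn, countIn, this, Finset.filter_insert]
  split_ifs
  · rw [Finset.card_insert_of_notMem (by simp)]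
  · rfl

theorem countIn_compl (P : Set ℤ) {a b : ℤ} (h : a ≤ b) :
    (countIn Pᶜ a b : ℤ) = b - a - countIn P a b := by
  classical
  have := Finset.card_filter_add_card_filter_not (s := Finset.Ico a b) (· ∈ P)
  rw [Int.card_Ico] at this
  simp only [countIn, Set.mem_compl_iff]
  omega

theorem countIn_append (P : Set ℤ) {a b c : ℤ} (h : a ≤ b) (h' : b ≤ c) :
    countIn P a c = countIn P a b + countIn P b c := by
  classical
  rw [countIn, ← Finset.Ico_union_Ico_eq_Ico h h', Finset.filter_union,
    Finset.card_union_of_disjoint]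
  · rfl
  · exact Finset.disjoint_filter_filter (Finset.Ico_disjoint_Ico_consecutive a b c)

-- A flux balance: moving up by one can change the count in `[a, b)` only by an exit from `b - 1`
-- and an entry from `a - 1`.
open Classical in
theorem ShiftUp.countIn_eq {A B D : Set ℤ} (h : ShiftUp A B D) {a b : ℤ} (hab : a ≤ b) :
    countIn B a b + (if b - 1 ∈ D then 1 else 0) = countIn A a b + if a - 1 ∈ D then 1 else 0 := by
  obtain ⟨n, hn⟩ := Int.eq_ofNat_of_zero_le (sub_nonneg.2 hab)
  obtain rfl : b = a + n := by omega
  clear hn hab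
  induction n with
  | zero => simp [countIn]
  | succ n ih =>
    rw [countIn_add_one, countIn_add_one]
    have hk := h.mem_iff (a + n)
    have hs := h.sub (a + n)
    have hd := h.disj (a + n)
    rw [show a + ((n + 1 : ℕ) : ℤ) - 1 = a + n by push_cast; ring]
    by_cases h1 : a + n ∈ A <;> by_cases h2 : a + n ∈ D <;> by_cases h3 : a + n - 1 ∈ D <;>
      simp only [h1, h2, h3, hk, if_true, if_false, not_true, not_false_eq_true, and_true,
        and_false, or_true, or_false, true_implies, false_implies] at hs hd ih ⊢ <;>
      omega

/-- Above both finite sets nothing moves, so the flux through the cut just above `k`, hence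
membership of `k`, is determined by the counts of `A` and `B`. -/
theorem ShiftUp.unique {A B D D' : Set ℤ} (h : ShiftUp A B D) (h' : ShiftUp A B D')
    (hD : D.Finite) (hD' : D'.Finite) : D = D' := by
  classical
  obtain ⟨u, hu⟩ := hD.bddAbove
  obtain ⟨u', hu'⟩ := hD'.bddAbove
  ext k
  have hb : k + 1 ≤ max (k + 1) (max u u' + 2) := le_max_left _ _
  have h1 : max (k + 1) (max u u' + 2) - 1 ∉ D := fun hc => by
    have := hu hc
    omega
  have h2 : max (k + 1) (max u u' + 2) - 1 ∉ D' := fun hc => by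
    have := hu' hc
    omega
  have e1 := h.countIn_eq hb
  have e2 := h'.countIn_eq hb
  rw [if_neg h1, add_sub_cancel_right] at e1
  rw [if_neg h2, add_sub_cancel_right] at e2
  by_cases hk : k ∈ D <;> by_cases hk' : k ∈ D' <;> simp only [hk, hk', if_true, if_false] at e1 e2 ⊢ <;>
    omega

theorem ShiftUp.exists_countIn_eq {A B D : Set ℤ} (h : ShiftUp A B D) (hD : D.Finite) :
    ∃ K₀ : ℕ, ∀ K : ℕ, K₀ ≤ K → countIn A (-K) K = countIn B (-K) K ∧
      ∀ k : ℤ, k < -K ∨ (K : ℤ) ≤ k → (k ∈ A ↔ k ∈ B) := by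
  classical
  obtain ⟨u, hu⟩ := hD.bddAbove
  obtain ⟨l, hl⟩ := hD.bddBelow
  refine ⟨u.natAbs + l.natAbs + 2, fun K hK => ?_⟩
  have hout : ∀ k : ℤ, k < -K ∨ (K : ℤ) - 2 < k → k ∉ D := fun k hk hc => by
    have := hu hc
    have := hl hc
    omega
  constructor
  · have := h.countIn_eq (a := -K) (b := K) (by omega)
    rw [if_neg (hout _ (by omega)), if_neg (hout _ (by omega))] at this
    simpa using this.symm
  · intro k hk
    rw [h.mem_iff]
    have h1 : k ∉ D := hout _ (by omega)
    have h2 : k - 1 ∉ D := hout _ (by omega)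
    simp [h1, h2]

theorem setCharge_eq {P : Set ℤ} {K : ℕ} (h : FrozenOutside P K) :
    setCharge P = countIn P (-K) K - K := by
  have h1 : {k : ℤ | 0 ≤ k ∧ k ∈ P}.ncard = countIn P 0 K := by
    rw [countIn, ← Set.ncard_coe_finset]
    congr 1
    ext k
    simp only [Set.mem_ofPred_eq, Finset.coe_filter, Finset.mem_Ico]
    constructor
    · rintro ⟨h0, hk⟩
      exact ⟨⟨h0, not_le.1 fun hc => h.2 k hc hk⟩, hk⟩
    · rintro ⟨⟨h0, _⟩, hk⟩
      exact ⟨h0, hk⟩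
  have h2 : {k : ℤ | k < 0 ∧ k ∉ P}.ncard = countIn Pᶜ (-K) 0 := by
    rw [countIn, ← Set.ncard_coe_finset]
    congr 1
    ext k
    simp only [Set.mem_ofPred_eq, Finset.coe_filter, Finset.mem_Ico, Set.mem_compl_iff]
    constructor
    · rintro ⟨h0, hk⟩
      exact ⟨⟨not_lt.1 fun hc => hk (h.1 k hc), h0⟩, hk⟩
    · rintro ⟨⟨_, h0⟩, hk⟩
      exact ⟨h0, hk⟩
  rw [setCharge, h1, h2]
  have h3 := countIn_compl P (a := -K) (b := 0) (by omega)
  have h4 := countIn_append P (a := -K) (b := 0) (c := K) (by omega) (by omega)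
  omega

theorem strictAnti_mayaPos {nu : ℕ → ℕ} (h : Antitone nu) : StrictAnti (mayaPos nu) := by
  intro i j hij
  have := h hij.le
  simp only [mayaPos]
  omega

theorem IsPart.frozenOutside {nu : ℕ → ℕ} (h : IsPart nu) : ∃ K₀ : ℕ, ∀ K : ℕ, K₀ ≤ K →
    (∀ i, K ≤ i → nu i = 0) ∧ nu 0 ≤ K ∧ FrozenOutside (maya nu) K := by
  obtain ⟨K₁, hK₁⟩ := h.2
  refine ⟨max K₁ (nu 0), fun K hK => ⟨fun i hi => hK₁ i (by omega), by omega, ?_, ?_⟩⟩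
  · intro k hk
    refine ⟨(-k - 1).toNat, ?_⟩
    rw [mayaPos, hK₁ _ (by omega)]
    omega
  · rintro k hk ⟨i, rfl⟩
    have := h.1 (Nat.zero_le i)
    simp only [mayaPos] at hk
    omega

/-- Beyond index `K` the particles sit below `-K`, so the ones counted are exactly those of index in
`[i, K)`. -/
theorem countIn_maya {nu : ℕ → ℕ} (h : Antitone nu) {K : ℕ} (hK : ∀ i, K ≤ i → nu i = 0) {b : ℤ}
    {i : ℕ} (hb : mayaPos nu i < b) (hb' : ∀ j < i, b ≤ mayaPos nu j) :
    countIn (maya nu) (-K) b = K - i := by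
  classical
  have hanti := strictAnti_mayaPos h
  have : (Finset.Ico (-K : ℤ) b).filter (· ∈ maya nu) = (Finset.Ico i K).image (mayaPos nu) := by
    ext k
    simp only [Finset.mem_filter, Finset.mem_Ico, Finset.mem_image]
    constructor
    · rintro ⟨⟨h1, h2⟩, j, rfl⟩
      refine ⟨j, ⟨not_lt.1 fun hc => (hb' j hc).not_gt h2, not_le.1 fun hc => ?_⟩, rfl⟩
      rw [mayaPos, hK j hc] at h1
      omega
    · rintro ⟨j, ⟨h1, h2⟩, rfl⟩
      refine ⟨⟨?_, (hanti.antitone h1).trans_lt hb⟩, j, rfl⟩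
      simp only [mayaPos]
      omega
  rw [countIn, this, Finset.card_image_of_injective _ hanti.injective, Nat.card_Ico]

theorem IsPart.setCharge_maya {nu : ℕ → ℕ} (h : IsPart nu) : setCharge (maya nu) = 0 := by
  obtain ⟨K, hK⟩ := h.frozenOutside
  obtain ⟨h1, h2, h3⟩ := hK K le_rfl
  rw [setCharge_eq h3, countIn_maya h.1 h1 (i := 0)]
  · simp
  · simp only [mayaPos]
    omega
  · intro j hj
    omega

theorem IsPart.setHasPartition_maya {nu : ℕ → ℕ} (h : IsPart nu) :
    SetHasPartition (maya nu) nu := by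
  classical
  have hanti := strictAnti_mayaPos h.1
  intro i
  refine ⟨mayaPos nu i, ⟨i, rfl⟩, ?_, ?_⟩
  · have : {k' : ℤ | mayaPos nu i < k' ∧ k' ∈ maya nu} =
        ((Finset.range i).image (mayaPos nu) : Finset ℤ) := by
      ext k
      simp only [Set.mem_ofPred_eq, Finset.coe_image, Set.mem_image, Finset.coe_range, Set.mem_Iio]
      constructor
      · rintro ⟨h1, j, rfl⟩
        exact ⟨j, hanti.lt_iff_gt.1 h1, rfl⟩
      · rintro ⟨j, h1, rfl⟩
        exact ⟨hanti h1, j, rfl⟩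
    rw [this, Set.encard_coe_eq_coe_finsetCard, Finset.card_image_of_injective _ hanti.injective,
      Finset.card_range]
  · obtain ⟨K₀, hK₀⟩ := h.frozenOutside
    obtain ⟨h1, h2, h3⟩ := hK₀ (max K₀ (i + 1)) (le_max_left _ _)
    set K := max K₀ (i + 1) with hK
    have hiK : i + 1 ≤ K := le_max_right _ _
    have : {k' : ℤ | k' < mayaPos nu i ∧ k' ∉ maya nu}.encard =
        countIn (maya nu)ᶜ (-K) (mayaPos nu i) := by
      rw [countIn, ← Set.encard_coe_eq_coe_finsetCard]
      congr 1
      ext k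
      simp only [Set.mem_ofPred_eq, Finset.coe_filter, Finset.mem_Ico, Set.mem_compl_iff]
      constructor
      · rintro ⟨h0, hk⟩
        exact ⟨⟨not_lt.1 fun hc => hk (h3.1 k hc), h0⟩, hk⟩
      · rintro ⟨⟨_, h0⟩, hk⟩
        exact ⟨h0, hk⟩
    rw [this]
    have hle : (-K : ℤ) ≤ mayaPos nu i := by simp only [mayaPos]; omega
    have hc := countIn_compl (maya nu) hle
    rw [countIn_maya h.1 h1 (hanti (Nat.lt_succ_self i))
      (fun j hj => hanti.antitone (Nat.lt_succ_iff.1 hj))] at hc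
    congr 1
    generalize countIn (maya nu)ᶜ (-K) (mayaPos nu i) = c at hc ⊢
    simp only [mayaPos] at hc
    omega

theorem ShiftBy.shiftUp_of_neg_one {A B D : Set ℤ} (h : ShiftBy (-1) A B D) :
    ShiftUp B A {k | k + 1 ∈ D} := by
  have h1 : ∀ k, k ∈ B ↔ (k ∈ A ∧ k ∉ D) ∨ k + 1 ∈ D := fun k => by
    simpa using h.mem_iff k
  have h2 : ∀ k, k ∈ A → k ∉ D → k + 1 ∉ D := fun k => by simpa using h.disj k
  refine ⟨fun k hk => (h1 k).2 (Or.inr hk), fun k => ?_, fun k hk hkD => ?_⟩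
  · have := h.sub k
    have := h1 k
    have := h2 k
    simp only [Set.mem_ofPred_eq, sub_add_cancel]
    tauto
  · have := h1 k
    simp only [Set.mem_ofPred_eq, sub_add_cancel] at hkD ⊢
    tauto

theorem ShiftBy.of_shiftUp {A B D : Set ℤ} (h : ShiftUp B A D) :
    ShiftBy (-1) A B {k | k - 1 ∈ D} := by
  refine ⟨fun k hk => (h.mem_iff k).2 (Or.inr hk), fun k => ?_, fun k hk hkD => ?_⟩
  · have := h.sub k
    have := h.mem_iff k
    have := h.disj k
    simp only [Set.mem_ofPred_eq, sub_neg_eq_add, add_sub_cancel_right]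
    tauto
  · have := h.mem_iff k
    simp only [Set.mem_ofPred_eq, sub_neg_eq_add, add_sub_cancel_right] at hkD ⊢
    tauto

theorem SetHasPartition.unique {P : Set ℤ} {nu nu' : ℕ → ℕ} (h : SetHasPartition P nu)
    (h' : SetHasPartition P nu') : nu = nu' := by
  funext i
  obtain ⟨k, hk, hk1, hk2⟩ := h i
  obtain ⟨k', hk', hk1', hk2'⟩ := h' i
  have key : ∀ a b : ℤ, b ∈ P → {k' : ℤ | a < k' ∧ k' ∈ P}.encard = (i : ℕ∞) →
      {k' : ℤ | b < k' ∧ k' ∈ P}.encard = (i : ℕ∞) → ¬ a < b := by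
    intro a b hb ha1 hb1 hab
    have hfin : {k' : ℤ | b < k' ∧ k' ∈ P}.Finite := Set.finite_of_encard_eq_coe hb1
    have hss : {k' : ℤ | b < k' ∧ k' ∈ P} ⊂ {k' : ℤ | a < k' ∧ k' ∈ P} := by
      refine ⟨fun x hx => ⟨hab.trans hx.1, hx.2⟩, fun hc => ?_⟩
      exact lt_irrefl b (hc (show b ∈ {k' : ℤ | a < k' ∧ k' ∈ P} from ⟨hab, hb⟩)).1
    have := hfin.encard_lt_encard hss
    rw [ha1, hb1] at this
    exact lt_irrefl _ this
  obtain rfl : k = k' := le_antisymm (not_lt.1 (key k' k hk hk1' hk1)) (not_lt.1 (key k k' hk' hk1 hk1'))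
  rw [hk2] at hk2'
  exact_mod_cast hk2'

/-- A frozen configuration with `K` particles in `[-K, K)` has charge 0; listing these particles
downwards gives the parts. -/
theorem exists_maya_eq {P : Set ℤ} {K : ℕ} (h : FrozenOutside P K)
    (hc : countIn P (-K) K = K) : ∃ nu, IsPart nu ∧ P = maya nu := by
  classical
  set S := (Finset.Ico (-K : ℤ) K).filter (· ∈ P) with hS
  have hmem : ∀ k, k ∈ S ↔ (-K ≤ k ∧ k < K) ∧ k ∈ P := fun k => by simp [hS]
  let e := S.orderEmbOfFin hc
  -- The particles are distinct integers from `-K` on, so the parts computed below are nonnegative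
  -- and `toNat` truncates nothing.
  have he : ∀ (n : ℕ) (hn : n < K), (-K : ℤ) + n ≤ e ⟨n, hn⟩ := by
    intro n
    induction n with
    | zero =>
      intro hn
      have := ((hmem _).1 (S.orderEmbOfFin_mem hc ⟨0, hn⟩)).1.1
      simpa using this
    | succ n ih =>
      intro hn
      have h1 := ih (by omega)
      have h2 : e ⟨n, by omega⟩ < e ⟨n + 1, hn⟩ := e.strictMono (Fin.mk_lt_mk.2 (Nat.lt_succ_self n))
      push_cast
      omega
  let nu : ℕ → ℕ := fun i => if hi : i < K then (e ⟨K - 1 - i, by omega⟩ + i + 1).toNat else 0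
  have hpos : ∀ i (_ : i < K), mayaPos nu i = e ⟨K - 1 - i, by omega⟩ := by
    intro i hi
    have := he (K - 1 - i) (by omega)
    simp only [mayaPos, nu, dif_pos hi]
    omega
  have hpos' : ∀ i, K ≤ i → mayaPos nu i = -i - 1 := by
    intro i hi
    simp only [mayaPos, nu, dif_neg (not_lt.2 hi)]
    simp
  refine ⟨nu, ⟨antitone_nat_of_succ_le fun i => ?_, K, fun i hi => dif_neg (not_lt.2 hi)⟩, ?_⟩
  · by_cases hi : i + 1 < K
    · have h1 := hpos i (by omega)
      have h2 := hpos (i + 1) hi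
      have h3 : e ⟨K - 1 - (i + 1), by omega⟩ < e ⟨K - 1 - i, by omega⟩ :=
        e.strictMono (Fin.mk_lt_mk.2 (by omega))
      simp only [mayaPos] at h1 h2
      push_cast at h2
      omega
    · simp only [nu, dif_neg hi]
      exact Nat.zero_le _
  · ext k
    constructor
    · intro hk
      by_cases hlt : k < -K
      · refine ⟨(-k - 1).toNat, ?_⟩
        rw [hpos' _ (by omega)]
        omega
      · have hkS : k ∈ S := (hmem k).2 ⟨⟨not_lt.1 hlt, not_le.1 fun hc => h.2 k hc hk⟩, hk⟩
        have : k ∈ Set.range e := by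
          exact (Finset.range_orderEmbOfFin S hc).symm ▸ hkS
        obtain ⟨j, rfl⟩ := this
        refine ⟨K - 1 - j, ?_⟩
        rw [hpos _ (by omega)]
        congr 1
        ext
        simp only
        omega
    · rintro ⟨i, rfl⟩
      by_cases hi : i < K
      · rw [hpos i hi]
        exact ((hmem _).1 (S.orderEmbOfFin_mem hc _)).2
      · rw [hpos' i (by omega)]
        exact h.1 _ (by omega)

/-- The clause for the top particle leaves nothing above it and finitely many holes below, so the
configuration is frozen outside a window; charge 0 then fixes its height. -/
theorem SetHasPartition.eq_maya {P : Set ℤ} {nu : ℕ → ℕ} (h : SetHasPartition P nu)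
    (hc : setCharge P = 0) : IsPart nu ∧ P = maya nu := by
  obtain ⟨k, hk, hk1, hk2⟩ := h 0
  have hfin : {k' : ℤ | k' < k ∧ k' ∉ P}.Finite := Set.finite_of_encard_eq_coe hk2
  obtain ⟨l, hl⟩ := hfin.bddBelow
  have hempty : {k' : ℤ | k < k' ∧ k' ∈ P} = ∅ := by simpa using hk1
  have hfro : FrozenOutside P (k.natAbs + l.natAbs + 1) := by
    constructor
    · intro k' hk'
      by_contra hcon
      have := hl (show k' ∈ {k' : ℤ | k' < k ∧ k' ∉ P} from ⟨by omega, hcon⟩)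
      omega
    · intro k' hk' hcon
      have : k' ∈ {k' : ℤ | k < k' ∧ k' ∈ P} := ⟨by omega, hcon⟩
      rw [hempty] at this
      exact this
  have := setCharge_eq hfro
  obtain ⟨nu', hnu', rfl⟩ := exists_maya_eq hfro (by omega)
  rw [h.unique hnu'.setHasPartition_maya]
  exact ⟨hnu', rfl⟩

theorem maya_injective {nu nu' : ℕ → ℕ} (h : IsPart nu) (h' : IsPart nu') (he : maya nu = maya nu') :
    nu = nu' :=
  h.setHasPartition_maya.unique (he ▸ h'.setHasPartition_maya)

/-- A configuration that agrees with a neutral one far away and has the same number of particles in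
large windows is again frozen and neutral. -/
theorem exists_maya_eq_of_countIn {P : Set ℤ} {nu : ℕ → ℕ} (h : IsPart nu) {K₁ : ℕ}
    (hP : ∀ K : ℕ, K₁ ≤ K → countIn (maya nu) (-K) K = countIn P (-K) K ∧
      ∀ k : ℤ, k < -K ∨ (K : ℤ) ≤ k → (k ∈ maya nu ↔ k ∈ P)) : ∃ nu', IsPart nu' ∧ P = maya nu' := by
  obtain ⟨K₀, hK₀⟩ := h.frozenOutside
  obtain ⟨h1, h2, h3⟩ := hK₀ (max K₀ K₁) (le_max_left _ _)
  obtain ⟨h4, h5⟩ := hP (max K₀ K₁) (le_max_right _ _)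
  refine exists_maya_eq (K := max K₀ K₁) ⟨fun k hk => (h5 k (Or.inl hk)).1 (h3.1 k hk),
    fun k hk hc => h3.2 k hk ((h5 k (Or.inr hk)).2 hc)⟩ ?_
  rw [← h4, countIn_maya h.1 h1 (i := 0)]
  · simp
  · simp only [mayaPos]
    omega
  · intro j hj
    omega

theorem ShiftUp.exists_maya {P D : Set ℤ} {nu : ℕ → ℕ} (hnu : IsPart nu)
    (h : ShiftUp (maya nu) P D) (hD : D.Finite) : ∃ nu', IsPart nu' ∧ P = maya nu' := by
  obtain ⟨K₁, hK₁⟩ := h.exists_countIn_eq hD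
  exact exists_maya_eq_of_countIn hnu hK₁

theorem ShiftUp.exists_maya_of_compl {P D : Set ℤ} {nu : ℕ → ℕ} (hnu : IsPart nu)
    (h : ShiftUp (maya nu)ᶜ Pᶜ D) (hD : D.Finite) : ∃ nu', IsPart nu' ∧ P = maya nu' := by
  obtain ⟨K₁, hK₁⟩ := h.exists_countIn_eq hD
  refine exists_maya_eq_of_countIn (K₁ := K₁) hnu fun K hK => ?_
  obtain ⟨h1, h2⟩ := hK₁ K hK
  have e1 := countIn_compl (maya nu) (a := -K) (b := K) (by omega)
  have e2 := countIn_compl P (a := -K) (b := K) (by omega)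
  exact ⟨by omega, fun k hk => not_iff_not.1 (h2 k hk)⟩

theorem ShiftUp.exists_maya_of_compl' {P D : Set ℤ} {nu : ℕ → ℕ} (hnu : IsPart nu)
    (h : ShiftUp Pᶜ (maya nu)ᶜ D) (hD : D.Finite) : ∃ nu', IsPart nu' ∧ P = maya nu' := by
  obtain ⟨K₁, hK₁⟩ := h.exists_countIn_eq hD
  refine exists_maya_eq_of_countIn (K₁ := K₁) hnu fun K hK => ?_
  obtain ⟨h1, h2⟩ := hK₁ K hK
  have e1 := countIn_compl (maya nu) (a := -K) (b := K) (by omega)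
  have e2 := countIn_compl P (a := -K) (b := K) (by omega)
  exact ⟨by omega, fun k hk => (not_iff_not.1 (h2 k hk)).symm⟩

theorem lt_countIn_maya {nu : ℕ → ℕ} (h : Antitone nu) {i : ℕ} {a b : ℤ} (ha : a ≤ mayaPos nu i)
    (hb : mayaPos nu 0 < b) : i < countIn (maya nu) a b := by
  classical
  have hanti := strictAnti_mayaPos h
  have : (Finset.range (i + 1)).image (mayaPos nu) ⊆ (Finset.Ico a b).filter (· ∈ maya nu) := by
    intro k hk
    obtain ⟨j, hj, rfl⟩ := Finset.mem_image.1 hk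
    have hj' : j ≤ i := Nat.lt_succ_iff.1 (Finset.mem_range.1 hj)
    exact Finset.mem_filter.2 ⟨Finset.mem_Ico.2 ⟨ha.trans (hanti.antitone hj'),
      (hanti.antitone (Nat.zero_le j)).trans_lt hb⟩, j, rfl⟩
  have := Finset.card_le_card this
  rw [Finset.card_image_of_injective _ hanti.injective, Finset.card_range] at this
  exact this

theorem countIn_maya_le {nu : ℕ → ℕ} (h : Antitone nu) {i : ℕ} {a b : ℤ} (ha : mayaPos nu i < a) :
    countIn (maya nu) a b ≤ i := by
  classical
  have hanti := strictAnti_mayaPos h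
  have : (Finset.Ico a b).filter (· ∈ maya nu) ⊆ (Finset.range i).image (mayaPos nu) := by
    intro k hk
    obtain ⟨hk, j, rfl⟩ := Finset.mem_filter.1 hk
    exact Finset.mem_image.2 ⟨j, Finset.mem_range.2
      (hanti.lt_iff_gt.1 (ha.trans_le (Finset.mem_Ico.1 hk).1)), rfl⟩
  refine (Finset.card_le_card this).trans ?_
  rw [Finset.card_image_of_injective _ hanti.injective, Finset.card_range]

theorem ShiftUp.horizontalStrip {la mu : ℕ → ℕ} (hla : IsPart la) (hmu : IsPart mu) {D : Set ℤ}
    (h : ShiftUp (maya la)ᶜ (maya mu)ᶜ D) (hD : D.Finite) : HorizontalStrip la mu := by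
  classical
  obtain ⟨u, hu⟩ := hD.bddAbove
  -- With `b` above every particle and every move, the counts are those of all particles from `k`
  -- on. Since holes move up, particles pass downwards through the cut.
  have key : ∀ k : ℤ, ∃ b : ℤ, mayaPos la 0 < b ∧ mayaPos mu 0 < b ∧
      countIn (maya la) k b = countIn (maya mu) k b + if k - 1 ∈ D then 1 else 0 := by
    intro k
    set b := max (max k (u + 2)) (max (mayaPos la 0) (mayaPos mu 0) + 1) with hb
    have hkb : k ≤ b := by omega
    refine ⟨b, by omega, by omega, ?_⟩
    have hbD : b - 1 ∉ D := fun hc => by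
      have := hu hc
      omega
    have e := h.countIn_eq hkb
    rw [if_neg hbD] at e
    have e1 := countIn_compl (maya la) hkb
    have e2 := countIn_compl (maya mu) hkb
    omega
  intro i
  constructor
  · by_contra! hc
    -- The cut lies just above a particle of `la`. The site below it is not a hole, so nothing
    -- crosses the cut.
    obtain ⟨b, hb1, hb2, hb⟩ := key (mayaPos la (i + 1) + 1)
    have h1 : mayaPos mu i < mayaPos la (i + 1) + 1 := by
      simp only [mayaPos]
      push_cast
      omega
    have h2 := countIn_maya_le hmu.1 (b := b) h1
    have h3 := lt_countIn_maya hla.1 (i := i) (a := mayaPos la (i + 1) + 1)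
      (strictAnti_mayaPos hla.1 (Nat.lt_succ_self i)) hb1
    rw [if_neg] at hb
    · omega
    · rw [add_sub_cancel_right]
      exact fun hc => h.sub _ hc ⟨i + 1, rfl⟩
  · by_contra! hc
    obtain ⟨b, hb1, hb2, hb⟩ := key (mayaPos mu i)
    have h1 : mayaPos la i < mayaPos mu i := by
      simp only [mayaPos]
      omega
    have h2 := countIn_maya_le hla.1 (b := b) h1
    have h3 := lt_countIn_maya hmu.1 (le_refl (mayaPos mu i)) hb2
    omega

theorem ShiftUp.verticalStrip {la mu : ℕ → ℕ} (hla : IsPart la) (hmu : IsPart mu) {D : Set ℤ}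
    (h : ShiftUp (maya la) (maya mu) D) (hD : D.Finite) : VerticalStrip la mu := by
  classical
  obtain ⟨u, hu⟩ := hD.bddAbove
  have key : ∀ k : ℤ, ∃ b : ℤ, mayaPos la 0 < b ∧ mayaPos mu 0 < b ∧
      countIn (maya mu) k b = countIn (maya la) k b + if k - 1 ∈ D then 1 else 0 := by
    intro k
    set b := max (max k (u + 2)) (max (mayaPos la 0) (mayaPos mu 0) + 1) with hb
    have hkb : k ≤ b := by omega
    refine ⟨b, by omega, by omega, ?_⟩
    have hbD : b - 1 ∉ D := fun hc => by
      have := hu hc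
      omega
    have e := h.countIn_eq hkb
    rw [if_neg hbD] at e
    omega
  intro i
  constructor
  · by_contra! hc
    obtain ⟨b, hb1, hb2, hb⟩ := key (mayaPos la i)
    have h1 : mayaPos mu i < mayaPos la i := by
      simp only [mayaPos]
      omega
    have h2 := countIn_maya_le hmu.1 (b := b) h1
    have h3 := lt_countIn_maya hla.1 (le_refl (mayaPos la i)) hb1
    omega
  · by_contra! hc
    obtain ⟨b, hb1, hb2, hb⟩ := key (mayaPos la i + 2)
    have h1 : mayaPos la i + 2 ≤ mayaPos mu i := by
      -- If part `i` grew by two or more, some particle would have to cross the cut from the site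
      -- `mayaPos la i + 1`. That site would then hold a particle of `la` of index below `i`,
      -- leaving too few particles above the cut.
      simp only [mayaPos]
      omega
    have h3 := lt_countIn_maya hmu.1 h1 hb2
    have h2 := countIn_maya_le hla.1 (b := b) (show mayaPos la i < mayaPos la i + 2 by omega)
    have h4 : mayaPos la i + 1 ∈ D := by
      by_contra hD
      rw [if_neg (by rwa [show mayaPos la i + 2 - 1 = mayaPos la i + 1 by ring])] at hb
      omega
    obtain ⟨j, hj⟩ := h.sub _ h4
    have hji : j < i := (strictAnti_mayaPos hla.1).lt_iff_gt.1 (by omega)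
    have h5 := countIn_maya_le hla.1 (b := b) (show mayaPos la j < mayaPos la i + 2 by omega)
    split_ifs at hb <;> omega

/-- Particle `i` descends from its position in `la` to that in `mu`, and each hole it passes climbs
one step. Interlacing keeps these intervals clear of other particles. -/
theorem HorizontalStrip.shiftUp {la mu : ℕ → ℕ} (hla : Antitone la) (hmu : Antitone mu)
    (h : HorizontalStrip la mu) :
    ShiftUp (maya la)ᶜ (maya mu)ᶜ {k | ∃ i, mayaPos mu i ≤ k ∧ k < mayaPos la i} := by
  have hA := strictAnti_mayaPos hla
  have hB := strictAnti_mayaPos hmu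
  have h1 : ∀ i, mayaPos mu i ≤ mayaPos la i := fun i => by
    have := (h i).2
    simp only [mayaPos]
    omega
  have h2 : ∀ i, mayaPos la (i + 1) < mayaPos mu i := fun i => by
    have := (h i).1
    simp only [mayaPos]
    push_cast
    omega
  have h3 : ∀ i k, mayaPos mu i ≤ k → k < mayaPos la i → k ∉ maya la := by
    rintro i k hk hk' ⟨j, rfl⟩
    have hij : i < j := hA.lt_iff_gt.1 hk'
    exact ((hA.antitone hij).trans_lt (h2 i)).not_ge hk
  have h4 : ∀ i k, mayaPos mu i < k → k ≤ mayaPos la i → k ∉ maya mu := by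
    rintro i k hk hk' ⟨j, rfl⟩
    have hij : j < i := hB.lt_iff_gt.1 hk
    exact ((hA.antitone hij).trans_lt (h2 j)).not_ge hk'
  refine ⟨?_, ?_, ?_⟩
  · rintro k ⟨i, hi, hi'⟩
    exact h3 i k hi hi'
  · intro k
    constructor
    · intro hk
      by_cases hD : k - 1 ∈ {k | ∃ i, mayaPos mu i ≤ k ∧ k < mayaPos la i}
      · exact Or.inr hD
      refine Or.inl ⟨?_, ?_⟩
      · rintro ⟨i, rfl⟩
        refine hD ⟨i, ?_, by omega⟩
        have := h1 i
        have : mayaPos mu i ≠ mayaPos la i := fun he => hk ⟨i, he⟩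
        omega
      · rintro ⟨i, hi, hi'⟩
        refine hD ⟨i, ?_, by omega⟩
        have : mayaPos mu i ≠ k := fun he => hk ⟨i, he⟩
        omega
    · rintro (⟨hk, hkD⟩ | ⟨i, hi, hi'⟩)
      · rintro ⟨i, rfl⟩
        have := h1 i
        have : mayaPos mu i ≠ mayaPos la i := fun he => hk ⟨i, he.symm⟩
        exact hkD ⟨i, le_rfl, by omega⟩
      · exact h4 i k (by omega) (by omega)
  · rintro k hk hkD ⟨i, hi, hi'⟩
    have : k ≠ mayaPos la i := fun he => hk ⟨i, he.symm⟩
    exact hkD ⟨i, by omega, by omega⟩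

theorem VerticalStrip.shiftUp {la mu : ℕ → ℕ} (hla : Antitone la) (hmu : Antitone mu)
    (h : VerticalStrip la mu) :
    ShiftUp (maya la) (maya mu) {k | ∃ i, mayaPos la i = k ∧ mayaPos mu i = k + 1} := by
  have hA := strictAnti_mayaPos hla
  have hB := strictAnti_mayaPos hmu
  have h1 : ∀ i, mayaPos mu i = mayaPos la i ∨ mayaPos mu i = mayaPos la i + 1 := fun i => by
    have := h i
    simp only [mayaPos]
    omega
  refine ⟨?_, ?_, ?_⟩
  · rintro k ⟨i, rfl, -⟩
    exact ⟨i, rfl⟩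
  · intro k
    constructor
    · rintro ⟨i, rfl⟩
      rcases h1 i with hi | hi
      · refine Or.inl ⟨⟨i, hi.symm⟩, ?_⟩
        rintro ⟨j, hj, hj'⟩
        obtain rfl : j = i := hA.injective (by omega)
        omega
      · exact Or.inr ⟨i, by omega, by omega⟩
    · rintro (⟨⟨i, rfl⟩, hk⟩ | ⟨i, hi, hi'⟩)
      · rcases h1 i with hi | hi
        · exact ⟨i, hi⟩
        · exact absurd ⟨i, rfl, hi⟩ hk
      · exact ⟨i, by omega⟩
  · rintro k ⟨j, rfl⟩ hkD ⟨i, hi, hi'⟩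
    rcases h1 j with hj | hj
    · obtain rfl : i = j := hB.injective (by omega)
      omega
    · exact hkD ⟨j, rfl, hj⟩

/-- By interlacing the intervals are disjoint, and the one of index `i` has length `la_i - mu_i`;
padded indices contribute nothing. -/
theorem HorizontalStrip.ncard_eq {N : ℕ} {la mu : Fin N → ℕ} (hla : Antitone la)
    (h : HorizontalStrip (zeroPad la) (zeroPad mu)) :
    {k | ∃ i, mayaPos (zeroPad mu) i ≤ k ∧ k < mayaPos (zeroPad la) i}.Finite ∧
      {k | ∃ i, mayaPos (zeroPad mu) i ≤ k ∧ k < mayaPos (zeroPad la) i}.ncard = boxDist la mu := by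
  classical
  have hA := strictAnti_mayaPos (antitone_zeroPad hla)
  have hS : {k | ∃ i, mayaPos (zeroPad mu) i ≤ k ∧ k < mayaPos (zeroPad la) i} =
      ((Finset.univ : Finset (Fin N)).biUnion fun i =>
        Finset.Ico (mayaPos (zeroPad mu) i) (mayaPos (zeroPad la) i) : Finset ℤ) := by
    ext k
    simp only [Set.mem_ofPred_eq, Finset.coe_biUnion, Finset.coe_univ, Set.mem_univ, Set.iUnion_true,
      Set.mem_iUnion, Finset.coe_Ico, Set.mem_Ico]
    constructor
    · rintro ⟨i, hi⟩
      by_cases hiN : i < N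
      · exact ⟨⟨i, hiN⟩, hi⟩
      · simp only [mayaPos] at hi
        rw [zeroPad_of_le la (by omega), zeroPad_of_le mu (by omega)] at hi
        omega
    · rintro ⟨i, hi⟩
      exact ⟨i, hi⟩
  rw [hS]
  refine ⟨Finset.finite_toSet _, ?_⟩
  rw [Set.ncard_coe_finset, Finset.card_biUnion, boxDist]
  · refine Finset.sum_congr rfl fun i _ => ?_
    have := (h i).2
    rw [zeroPad_coe, zeroPad_coe] at this
    simp only [Int.card_Ico, mayaPos, zeroPad_coe]
    omega
  · have h2 : ∀ i, mayaPos (zeroPad la) (i + 1) < mayaPos (zeroPad mu) i := fun i => by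
      have := (h i).1
      simp only [mayaPos]
      push_cast
      omega
    have hlt : ∀ i j : Fin N, i < j → Disjoint
        (Finset.Ico (mayaPos (zeroPad mu) i) (mayaPos (zeroPad la) i))
        (Finset.Ico (mayaPos (zeroPad mu) j) (mayaPos (zeroPad la) j)) := by
      intro i j hij
      rw [Finset.disjoint_left]
      intro k hk hk'
      have hij' : (i : ℕ) + 1 ≤ j := hij
      have e1 := hA.antitone hij'
      have e2 := h2 i
      rw [Finset.mem_Ico] at hk hk'
      omega
    intro i _ j _ hij
    rcases lt_or_gt_of_ne hij with h' | h'
    · exact hlt i j h'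
    · exact (hlt j i h').symm

theorem VerticalStrip.ncard_eq {N : ℕ} {la mu : Fin N → ℕ} (hla : Antitone la)
    (h : VerticalStrip (zeroPad la) (zeroPad mu)) :
    {k | ∃ i, mayaPos (zeroPad la) i = k ∧ mayaPos (zeroPad mu) i = k + 1}.Finite ∧
      {k | ∃ i, mayaPos (zeroPad la) i = k ∧ mayaPos (zeroPad mu) i = k + 1}.ncard =
        boxDist la mu := by
  classical
  have hA := strictAnti_mayaPos (antitone_zeroPad hla)
  have hS : {k | ∃ i, mayaPos (zeroPad la) i = k ∧ mayaPos (zeroPad mu) i = k + 1} =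
      (((Finset.univ : Finset (Fin N)).filter fun i => mu i = la i + 1).image
        fun i : Fin N => mayaPos (zeroPad la) i : Finset ℤ) := by
    ext k
    simp only [Set.mem_ofPred_eq, Finset.coe_image, Finset.coe_filter, Finset.mem_univ, true_and,
      Set.mem_image]
    constructor
    · rintro ⟨i, hi, hi'⟩
      by_cases hiN : i < N
      · refine ⟨⟨i, hiN⟩, ?_, hi⟩
        rw [← zeroPad_coe mu, ← zeroPad_coe la]
        simp only [mayaPos] at hi hi'
        simp only
        omega
      · simp only [mayaPos] at hi hi'
        rw [zeroPad_of_le la (by omega)] at hi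
        rw [zeroPad_of_le mu (by omega)] at hi'
        omega
    · rintro ⟨i, hi, rfl⟩
      refine ⟨i, rfl, ?_⟩
      simp only [mayaPos, zeroPad_coe, hi]
      push_cast
      ring
  rw [hS]
  refine ⟨Finset.finite_toSet _, ?_⟩
  rw [Set.ncard_coe_finset, Finset.card_image_of_injective _ fun i j hij => Fin.ext (hA.injective hij),
    boxDist, Finset.card_filter]
  refine Finset.sum_congr rfl fun i _ => ?_
  have := h i
  rw [zeroPad_coe, zeroPad_coe] at this
  split_ifs <;> omega

end Maya

/-! ### Dimer coverings column by column -/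

/-- The sign `±1` of a letter. -/
def PM.sign : PM → ℤ
  | PM.plus => 1
  | PM.minus => -1

/-- The side and the height of the odd endpoint of an edge at height `k`. -/
def oddSide (a : LR) (b : PM) (k : ℤ) : EdgeKind → LR × ℤ
  | EdgeKind.left => (LR.L, k)
  | EdgeKind.right => (LR.R, k)
  | EdgeKind.diag => (a, k + b.sign)

/-- The edges `E` of one even column form a covering that joins the particle sets `P` and `P'`. -/
structure ColumnPattern (a : LR) (b : PM) (P P' : Set ℤ) (E : ℤ → EdgeKind → Prop) : Prop where
  even : ∀ k, ∃! c, E k c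
  inj : ∀ k c k' c', E k c → E k' c' → oddSide a b k c = oddSide a b k' c' → k = k' ∧ c = c'
  left : ∀ k, k ∉ P ↔ ∃ k' c, E k' c ∧ oddSide a b k' c = (LR.L, k)
  right : ∀ k, k ∈ P' ↔ ∃ k' c, E k' c ∧ oddSide a b k' c = (LR.R, k)

/-- The relation between the particle sets `P`, `P'` on the two sides of an even column and the set
`D` of heights of its diagonal edges. -/
def ColumnShift (a : LR) (b : PM) (P P' D : Set ℤ) : Prop :=
  match a with
  | LR.L => ShiftBy b.sign P'ᶜ Pᶜ D
  | LR.R => ShiftBy b.sign P P' D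

/-- The edges of an even column, in terms of the particle sets and the diagonal edges. -/
def columnEdge (a : LR) (P P' D : Set ℤ) (k : ℤ) (c : EdgeKind) : Prop :=
  match a, c with
  | LR.L, EdgeKind.left => k ∉ P' ∧ k ∉ D
  | LR.L, EdgeKind.right => k ∈ P'
  | LR.R, EdgeKind.left => k ∉ P
  | LR.R, EdgeKind.right => k ∈ P ∧ k ∉ D
  | _, EdgeKind.diag => k ∈ D

theorem exists_oddSide_left_iff (a : LR) (b : PM) (E : ℤ → EdgeKind → Prop) (k : ℤ) :
    (∃ k' c, E k' c ∧ oddSide a b k' c = (LR.L, k)) ↔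
      E k EdgeKind.left ∨ (a = LR.L ∧ E (k - b.sign) EdgeKind.diag) := by
  constructor
  · rintro ⟨k', c, hE, h⟩
    cases c <;> simp only [oddSide, Prod.mk.injEq, reduceCtorEq, false_and, true_and] at h
    · exact Or.inl (h ▸ hE)
    · refine Or.inr ⟨h.1, ?_⟩
      rwa [← h.2, add_sub_cancel_right]
  · rintro (h | ⟨rfl, h⟩)
    · exact ⟨k, _, h, rfl⟩
    · exact ⟨_, _, h, by simp [oddSide]⟩

theorem exists_oddSide_right_iff (a : LR) (b : PM) (E : ℤ → EdgeKind → Prop) (k : ℤ) :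
    (∃ k' c, E k' c ∧ oddSide a b k' c = (LR.R, k)) ↔
      E k EdgeKind.right ∨ (a = LR.R ∧ E (k - b.sign) EdgeKind.diag) := by
  constructor
  · rintro ⟨k', c, hE, h⟩
    cases c <;> simp only [oddSide, Prod.mk.injEq, reduceCtorEq, false_and, true_and] at h
    · exact Or.inl (h ▸ hE)
    · refine Or.inr ⟨h.1, ?_⟩
      rwa [← h.2, add_sub_cancel_right]
  · rintro (h | ⟨rfl, h⟩)
    · exact ⟨k, _, h, rfl⟩
    · exact ⟨_, _, h, by simp [oddSide]⟩

theorem ColumnPattern.kind_iff {a : LR} {b : PM} {P P' : Set ℤ} {E : ℤ → EdgeKind → Prop}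
    (h : ColumnPattern a b P P' E) (k : ℤ) :
    (E k EdgeKind.left ∨ E k EdgeKind.right ∨ E k EdgeKind.diag) ∧
      ¬ (E k EdgeKind.left ∧ E k EdgeKind.right) ∧ ¬ (E k EdgeKind.left ∧ E k EdgeKind.diag) ∧
      ¬ (E k EdgeKind.right ∧ E k EdgeKind.diag) := by
  obtain ⟨c, hc, hu⟩ := h.even k
  refine ⟨?_, ?_, ?_, ?_⟩
  · cases c
    · exact Or.inl hc
    · exact Or.inr (Or.inl hc)
    · exact Or.inr (Or.inr hc)
  all_goals
    rintro ⟨h1, h2⟩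
    have := (hu _ h1).trans (hu _ h2).symm
    cases this

/-- Each even vertex uses exactly one of its three edges. For `L`, a vertex not joined to the right
carries a hole of the right column to the left column, straight or diagonally; for `R`, particles
are carried to the right in the same way. Injectivity on odd endpoints prevents collisions. -/
theorem ColumnPattern.columnShift {a : LR} {b : PM} {P P' : Set ℤ} {E : ℤ → EdgeKind → Prop}
    (h : ColumnPattern a b P P' E) :
    ColumnShift a b P P' {k | E k EdgeKind.diag} ∧
      ∀ k c, E k c ↔ columnEdge a P P' {k | E k EdgeKind.diag} k c := by
  have hk := h.kind_iff
  have hl := fun k => (h.left k).trans (exists_oddSide_left_iff a b E k)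
  have hr := fun k => (h.right k).trans (exists_oddSide_right_iff a b E k)
  cases a with
  | L =>
    simp only [true_and, reduceCtorEq, false_and, or_false] at hl hr
    refine ⟨⟨fun k hkD => ?_, fun k => ?_, fun k h1 h2 h3 => ?_⟩, fun k c => ?_⟩
    · have := hk k
      have := hr k
      simp only [Set.mem_ofPred_eq, Set.mem_compl_iff] at hkD ⊢
      tauto
    · have := hk k
      have := hr k
      have := hl k
      simp only [Set.mem_ofPred_eq, Set.mem_compl_iff]
      tauto
    · have := hk k
      have := hr k
      simp only [Set.mem_ofPred_eq, Set.mem_compl_iff] at h1 h2 h3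
      have h4 : E k EdgeKind.left := by tauto
      have := (h.inj _ _ _ _ h3 h4 (by simp [oddSide])).2
      cases this
    · have := hk k
      have := hr k
      cases c <;> simp only [columnEdge, Set.mem_ofPred_eq] <;> tauto
  | R =>
    simp only [true_and, reduceCtorEq, false_and, or_false] at hl hr
    refine ⟨⟨fun k hkD => ?_, fun k => ?_, fun k h1 h2 h3 => ?_⟩, fun k c => ?_⟩
    · have := hk k
      have := hl k
      simp only [Set.mem_ofPred_eq] at hkD ⊢
      tauto
    · have := hk k
      have := hr k
      have := hl k
      simp only [Set.mem_ofPred_eq]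
      tauto
    · have := hk k
      have := hl k
      simp only [Set.mem_ofPred_eq] at h1 h2 h3
      have h4 : E k EdgeKind.right := by tauto
      have := (h.inj _ _ _ _ h3 h4 (by simp [oddSide])).2
      cases this
    · have := hk k
      have := hl k
      cases c <;> simp only [columnEdge, Set.mem_ofPred_eq] <;> tauto

theorem ColumnShift.columnPattern {a : LR} {b : PM} {P P' D : Set ℤ}
    (h : ColumnShift a b P P' D) : ColumnPattern a b P P' (columnEdge a P P' D) := by
  cases a with
  | L =>
    have h : ShiftBy b.sign P'ᶜ Pᶜ D := h
    refine ⟨fun k => ?_, ?_, fun k => ?_, fun k => ?_⟩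
    · have := h.sub k
      rw [Set.mem_compl_iff] at this
      by_cases h1 : k ∈ D
      · refine ⟨EdgeKind.diag, h1, fun c hc => ?_⟩
        cases c <;> simp only [columnEdge] at hc <;> tauto
      · by_cases h2 : k ∈ P'
        · refine ⟨EdgeKind.right, h2, fun c hc => ?_⟩
          cases c <;> simp only [columnEdge] at hc <;> tauto
        · refine ⟨EdgeKind.left, ⟨h2, h1⟩, fun c hc => ?_⟩
          cases c <;> simp only [columnEdge] at hc <;> tauto
    · intro k c k' c' h1 h2 he
      have hd := h.disj k
      have hd' := h.disj k'
      cases c <;> cases c' <;>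
        simp only [columnEdge, oddSide, Prod.mk.injEq, reduceCtorEq, false_and, true_and] at h1 h2 he
      · exact ⟨he, rfl⟩
      · rw [show k' = k - b.sign by omega] at h2
        exact absurd h2 (hd h1.1 h1.2)
      · exact ⟨he, rfl⟩
      · rw [show k = k' - b.sign by omega] at h1
        exact absurd h1 (hd' h2.1 h2.2)
      · exact ⟨by omega, rfl⟩
    · rw [exists_oddSide_left_iff]
      have := h.mem_iff k
      simp only [columnEdge, true_and]
      exact this
    · rw [exists_oddSide_right_iff]
      simp [columnEdge]
  | R =>
    have h : ShiftBy b.sign P P' D := h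
    refine ⟨fun k => ?_, ?_, fun k => ?_, fun k => ?_⟩
    · have := h.sub k
      by_cases h1 : k ∈ D
      · refine ⟨EdgeKind.diag, h1, fun c hc => ?_⟩
        cases c <;> simp only [columnEdge] at hc <;> tauto
      · by_cases h2 : k ∈ P
        · refine ⟨EdgeKind.right, ⟨h2, h1⟩, fun c hc => ?_⟩
          cases c <;> simp only [columnEdge] at hc <;> tauto
        · refine ⟨EdgeKind.left, h2, fun c hc => ?_⟩
          cases c <;> simp only [columnEdge] at hc <;> tauto
    · intro k c k' c' h1 h2 he
      have hd := h.disj k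
      have hd' := h.disj k'
      cases c <;> cases c' <;>
        simp only [columnEdge, oddSide, Prod.mk.injEq, reduceCtorEq, false_and, true_and] at h1 h2 he
      · exact ⟨he, rfl⟩
      · exact ⟨he, rfl⟩
      · rw [show k' = k - b.sign by omega] at h2
        exact absurd h2 (hd h1.1 h1.2)
      · rw [show k = k' - b.sign by omega] at h1
        exact absurd h1 (hd' h2.1 h2.2)
      · exact ⟨by omega, rfl⟩
    · rw [exists_oddSide_left_iff]
      simp [columnEdge]
    · rw [exists_oddSide_right_iff]
      have := h.mem_iff k
      simp only [columnEdge, true_and]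
      exact this

namespace RailYard

variable {G : RailYard}

/-- The set of particles of a column. -/
def particles (G : RailYard) (M : Set RailEdge) (m : ℤ) : Set ℤ := {k | G.IsParticle M m k}

/-- The heights of the diagonal edges of an even column. -/
def diagSet (M : Set RailEdge) (m : ℤ) : Set ℤ := {k | (⟨m, k, EdgeKind.diag⟩ : RailEdge) ∈ M}

theorem oddEnd_eq_iff (e : RailEdge) (m k : ℤ) :
    G.oddEnd e = (2 * m - 1, k) ↔
      (e.col = m ∧ oddSide (G.a e.col) (G.b e.col) e.height e.kind = (LR.L, k)) ∨
        (e.col = m - 1 ∧ oddSide (G.a e.col) (G.b e.col) e.height e.kind = (LR.R, k)) := by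
  obtain ⟨c, h, kd⟩ := e
  cases kd
  · simp only [oddEnd, oddSide, Prod.mk.injEq, reduceCtorEq, false_and, and_false, or_false, true_and]
    constructor <;> rintro ⟨h1, h2⟩ <;> exact ⟨by omega, h2⟩
  · simp only [oddEnd, oddSide, Prod.mk.injEq, reduceCtorEq, false_and, and_false, false_or, true_and]
    constructor <;> rintro ⟨h1, h2⟩ <;> exact ⟨by omega, h2⟩
  · simp only [oddEnd, oddSide, diagEnd]
    cases G.a c <;> cases G.b c <;>
      simp only [PM.sign, Prod.mk.injEq, reduceCtorEq, false_and, and_false, or_false, false_or,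
        true_and] <;>
      constructor <;> rintro ⟨h1, h2⟩ <;> exact ⟨by omega, by omega⟩

theorem exists_oddEnd_eq (e : RailEdge) : ∃ m k, G.oddEnd e = (2 * m - 1, k) := by
  rcases h : oddSide (G.a e.col) (G.b e.col) e.height e.kind with ⟨_ | _, k⟩
  · exact ⟨e.col, k, (oddEnd_eq_iff e _ _).2 (Or.inl ⟨rfl, h⟩)⟩
  · exact ⟨e.col + 1, k, (oddEnd_eq_iff e _ _).2 (Or.inr ⟨by omega, h⟩)⟩

theorem incident_even_iff (e : RailEdge) (m k : ℤ) :
    G.Incident e (2 * m, k) ↔ e.col = m ∧ e.height = k := by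
  obtain ⟨m', k', h⟩ := exists_oddEnd_eq (G := G) e
  rw [Incident, h, RailEdge.evenEnd, Prod.mk.injEq, Prod.mk.injEq]
  constructor
  · rintro (⟨h1, h2⟩ | ⟨h1, h2⟩)
    · exact ⟨by omega, h2⟩
    · omega
  · rintro ⟨rfl, rfl⟩
    exact Or.inl ⟨rfl, rfl⟩

theorem incident_odd_iff (e : RailEdge) (m k : ℤ) :
    G.Incident e (2 * m - 1, k) ↔ G.oddEnd e = (2 * m - 1, k) := by
  refine ⟨fun h => h.resolve_left fun h' => ?_, Or.inr⟩
  rw [RailEdge.evenEnd, Prod.mk.injEq] at h'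
  omega

theorem IsDimerCovering.eq_of_oddEnd_eq {M : Set RailEdge} (h : G.IsDimerCovering M)
    {e e' : RailEdge} (he : e ∈ M) (he' : e' ∈ M) (heq : G.oddEnd e = G.oddEnd e') : e = e' := by
  obtain ⟨m, k, hmk⟩ := exists_oddEnd_eq (G := G) e
  have hcol := h.isEdge e he
  have hm : e.col = m ∨ e.col = m - 1 := by
    rcases (oddEnd_eq_iff e m k).1 hmk with h1 | h1
    · exact Or.inl h1.1
    · exact Or.inr h1.1
  have hi : G.Incident e (2 * m - 1, k) := Or.inr hmk
  have hi' : G.Incident e' (2 * m - 1, k) := Or.inr (heq ▸ hmk)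
  by_cases hb : 2 * m - 1 = 2 * G.l - 1 ∨ 2 * m - 1 = 2 * G.r + 1
  · exact h.boundary (2 * m - 1, k) hb ⟨he, hi⟩ ⟨he', hi'⟩
  · exact (h.inner (2 * m - 1, k) (by simp only; omega) (by simp only; omega)).unique
      ⟨he, hi⟩ ⟨he', hi'⟩

theorem IsDimerCovering.columnPattern {M : Set RailEdge} (h : G.IsDimerCovering M) {m : ℤ}
    (hl : G.l ≤ m) (hr : m ≤ G.r) :
    ColumnPattern (G.a m) (G.b m) (G.particles M m) (G.particles M (m + 1))
      (fun k c => (⟨m, k, c⟩ : RailEdge) ∈ M) := by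
  refine ⟨fun k => ?_, ?_, fun k => ?_, fun k => ?_⟩
  · obtain ⟨⟨m', k', c⟩, ⟨he, hi⟩, hu⟩ := h.inner (2 * m, k) (by simp only; omega) (by simp only; omega)
    obtain ⟨rfl, rfl⟩ := (incident_even_iff _ _ _).1 hi
    refine ⟨c, he, fun c' hc' => ?_⟩
    have := hu ⟨m', k', c'⟩ ⟨hc', (incident_even_iff _ _ _).2 ⟨rfl, rfl⟩⟩
    rw [RailEdge.mk.injEq] at this
    exact this.2.2
  · intro k c k' c' h1 h2 he
    have : G.oddEnd ⟨m, k, c⟩ = G.oddEnd ⟨m, k', c'⟩ := by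
      obtain ⟨m₁, k₁, hk⟩ := exists_oddEnd_eq (G := G) ⟨m, k, c⟩
      rw [hk]
      symm
      rw [oddEnd_eq_iff] at hk ⊢
      simp only at hk ⊢
      rwa [← he]
    have := h.eq_of_oddEnd_eq h1 h2 this
    rw [RailEdge.mk.injEq] at this
    exact this.2
  · have hex : (∃ k' c, (⟨m, k', c⟩ : RailEdge) ∈ M ∧ oddSide (G.a m) (G.b m) k' c = (LR.L, k)) ↔
        ∃ e ∈ M, e.col = m ∧ G.oddEnd e = (2 * m - 1, k) := by
      constructor
      · rintro ⟨k', c, he, hs⟩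
        exact ⟨_, he, rfl, (oddEnd_eq_iff _ _ _).2 (Or.inl ⟨rfl, hs⟩)⟩
      · rintro ⟨⟨m', k', c⟩, he, rfl, ho⟩
        rcases (oddEnd_eq_iff _ _ _).1 ho with h1 | h1
        · exact ⟨k', c, he, h1.2⟩
        · have := h1.1
          simp only at this
          omega
    rw [hex]
    change ¬ G.IsParticle M m k ↔ _
    rw [IsParticle]
    -- On the left boundary no edge arrives from the left, and a hole is by definition a covered
    -- vertex; elsewhere the unique covering edge decides.
    rcases eq_or_lt_of_le hl with rfl | hlt
    · constructor
      · intro hn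
        push Not at hn
        obtain ⟨e, he, ho⟩ := hn.2 rfl
        refine ⟨e, he, ?_, ho⟩
        rcases (oddEnd_eq_iff _ _ _).1 ho with h1 | h1
        · exact h1.1
        · have := (h.isEdge e he).1
          omega
      · rintro ⟨e, he, hc, ho⟩ (⟨e', he', ho', hc'⟩ | ⟨-, hall⟩)
        · have := (h.isEdge e' he').1
          omega
        · exact hall e he ho
    · have hne : m ≠ G.l := hlt.ne'
      simp only [hne, false_and, or_false]
      obtain ⟨e, ⟨he, hi⟩, hu⟩ := h.inner (2 * m - 1, k) (by simp only; omega) (by simp only; omega)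
      rw [incident_odd_iff] at hi
      constructor
      · intro hn
        refine ⟨e, he, ?_, hi⟩
        rcases (oddEnd_eq_iff _ _ _).1 hi with h1 | h1
        · exact h1.1
        · exact absurd ⟨e, he, hi, h1.1⟩ hn
      · rintro ⟨e₁, he₁, hc₁, ho₁⟩ ⟨e₂, he₂, ho₂, hc₂⟩
        have := h.eq_of_oddEnd_eq he₁ he₂ (ho₁.trans ho₂.symm)
        rw [← this] at hc₂
        omega
  · change G.IsParticle M (m + 1) k ↔ _
    rw [IsParticle]
    have hne : m + 1 ≠ G.l := by omega
    simp only [hne, false_and, or_false]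
    constructor
    · rintro ⟨⟨m', k', c⟩, he, ho, hc⟩
      obtain rfl : m' = m := by simpa using hc
      rcases (oddEnd_eq_iff _ _ _).1 ho with h1 | h1
      · have := h1.1
        simp only at this
        omega
      · exact ⟨k', c, he, h1.2⟩
    · rintro ⟨k', c, he, hs⟩
      exact ⟨_, he, (oddEnd_eq_iff _ _ _).2 (Or.inr ⟨by simp, hs⟩), by simp⟩

/-- The edge set with prescribed particle sets and diagonal edges. -/
def edgesOf (G : RailYard) (P D : ℤ → Set ℤ) : Set RailEdge :=
  {e | (G.l ≤ e.col ∧ e.col ≤ G.r) ∧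
    columnEdge (G.a e.col) (P e.col) (P (e.col + 1)) (D e.col) e.height e.kind}

/-- Occupied odd vertices are met only by edges from the left and empty ones only by edges from the
right, so neighbouring columns never conflict; within one column the pattern is injective.
Finiteness of the sets `D m` gives finitely many diagonal edges. -/
theorem isDimerCovering_edgesOf {P D : ℤ → Set ℤ}
    (h : ∀ m, G.l ≤ m → m ≤ G.r → ColumnShift (G.a m) (G.b m) (P m) (P (m + 1)) (D m))
    (hD : ∀ m, G.l ≤ m → m ≤ G.r → (D m).Finite) :
    G.IsDimerCovering (G.edgesOf P D) ∧
      ∀ m, G.l ≤ m → m ≤ G.r + 1 → G.particles (G.edgesOf P D) m = P m := by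
  have hp := fun m hl hr => (h m hl hr).columnPattern
  have hleft : ∀ e ∈ G.edgesOf P D, ∀ m k, e.col = m → G.oddEnd e = (2 * m - 1, k) → k ∉ P m := by
    rintro ⟨m', k', c⟩ ⟨⟨hl, hr⟩, he⟩ m k rfl ho
    rcases (oddEnd_eq_iff _ _ _).1 ho with h1 | h1
    · exact ((hp m' hl hr).left k).2 ⟨k', c, he, h1.2⟩
    · have := h1.1
      omega
  have hright : ∀ e ∈ G.edgesOf P D, ∀ m k, e.col = m - 1 → G.oddEnd e = (2 * m - 1, k) → k ∈ P m := by
    rintro ⟨m', k', c⟩ ⟨⟨hl, hr⟩, he⟩ m k hm ho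
    simp only at hl hr he hm
    obtain rfl : m = m' + 1 := by omega
    rcases (oddEnd_eq_iff _ _ _).1 ho with h1 | h1
    · have := h1.1
      simp only at this
      omega
    · exact ((hp m' hl hr).right k).2 ⟨k', c, he, h1.2⟩
  have hexl : ∀ m k, G.l ≤ m → m ≤ G.r → k ∉ P m →
      ∃ e ∈ G.edgesOf P D, e.col = m ∧ G.oddEnd e = (2 * m - 1, k) := by
    intro m k hl hr hk
    obtain ⟨k', c, he, hs⟩ := ((hp m hl hr).left k).1 hk
    exact ⟨⟨m, k', c⟩, ⟨⟨hl, hr⟩, he⟩, rfl, (oddEnd_eq_iff _ _ _).2 (Or.inl ⟨rfl, hs⟩)⟩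
  have hexr : ∀ m k, G.l ≤ m → m ≤ G.r → k ∈ P (m + 1) →
      ∃ e ∈ G.edgesOf P D, e.col = m ∧ G.oddEnd e = (2 * (m + 1) - 1, k) := by
    intro m k hl hr hk
    obtain ⟨k', c, he, hs⟩ := ((hp m hl hr).right k).1 hk
    exact ⟨⟨m, k', c⟩, ⟨⟨hl, hr⟩, he⟩, rfl, (oddEnd_eq_iff _ _ _).2 (Or.inr ⟨by simp, hs⟩)⟩
  have hinj : ∀ e ∈ G.edgesOf P D, ∀ e' ∈ G.edgesOf P D, ∀ m k, G.oddEnd e = (2 * m - 1, k) →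
      G.oddEnd e' = (2 * m - 1, k) → e = e' := by
    intro e he e' he' m k ho ho'
    have h1 := (oddEnd_eq_iff _ _ _).1 ho
    have h1' := (oddEnd_eq_iff _ _ _).1 ho'
    have key : e.col = e'.col → oddSide (G.a e.col) (G.b e.col) e.height e.kind =
        oddSide (G.a e'.col) (G.b e'.col) e'.height e'.kind → e = e' := by
      obtain ⟨m₁, k₁, c₁⟩ := e
      obtain ⟨m₂, k₂, c₂⟩ := e'
      rintro hc hs
      simp only at hc hs
      subst hc
      obtain ⟨rfl, rfl⟩ := (hp m₁ he.1.1 he.1.2).inj _ _ _ _ he.2 he'.2 hs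
      rfl
    rcases h1 with h1 | h1 <;> rcases h1' with h1' | h1'
    · exact key (h1.1.trans h1'.1.symm) (h1.2.trans h1'.2.symm)
    · exact absurd (hright e' he' m k h1'.1 ho') (hleft e he m k h1.1 ho)
    · exact absurd (hright e he m k h1.1 ho) (hleft e' he' m k h1'.1 ho')
    · exact key (h1.1.trans h1'.1.symm) (h1.2.trans h1'.2.symm)
  refine ⟨⟨fun e he => he.1, ?_, ?_, ?_⟩, ?_⟩
  · rintro ⟨p, k⟩ hl hr
    simp only at hl hr
    rcases Int.even_or_odd' p with ⟨m, rfl | rfl⟩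
    · obtain ⟨c, hc, hu⟩ := (hp m (by omega) (by omega)).even k
      refine ⟨⟨m, k, c⟩, ⟨⟨⟨by simp only; omega, by simp only; omega⟩, hc⟩,
        (incident_even_iff _ _ _).2 ⟨rfl, rfl⟩⟩, ?_⟩
      rintro ⟨m', k', c'⟩ ⟨he, hi⟩
      obtain ⟨rfl, rfl⟩ := (incident_even_iff _ _ _).1 hi
      rw [hu c' he.2]
    · rw [show 2 * m + 1 = 2 * (m + 1) - 1 by ring]
      have hex : ∃ e ∈ G.edgesOf P D, G.oddEnd e = (2 * (m + 1) - 1, k) := by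
        by_cases hk : k ∈ P (m + 1)
        · obtain ⟨e, he, -, ho⟩ := hexr m k (by omega) (by omega) hk
          exact ⟨e, he, ho⟩
        · obtain ⟨e, he, -, ho⟩ := hexl (m + 1) k (by omega) (by omega) hk
          exact ⟨e, he, ho⟩
      obtain ⟨e, he, ho⟩ := hex
      refine ⟨e, ⟨he, Or.inr ho⟩, ?_⟩
      rintro e' ⟨he', hi'⟩
      exact hinj e' he' e he _ _ ((incident_odd_iff _ _ _).1 hi') ho
  · rintro ⟨p, k⟩ hp'
    simp only at hp'
    obtain ⟨m, rfl⟩ : ∃ m, p = 2 * m - 1 := by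
      rcases hp' with rfl | rfl
      · exact ⟨_, rfl⟩
      · exact ⟨G.r + 1, by ring⟩
    rintro e ⟨he, hi⟩ e' ⟨he', hi'⟩
    exact hinj e he e' he' m k ((incident_odd_iff _ _ _).1 hi) ((incident_odd_iff _ _ _).1 hi')
  · have : {e | e ∈ G.edgesOf P D ∧ e.kind = EdgeKind.diag} ⊆
        ⋃ m ∈ Finset.Icc G.l G.r, (fun k => (⟨m, k, EdgeKind.diag⟩ : RailEdge)) '' D m := by
      rintro ⟨m, k, c⟩ ⟨⟨hm, he⟩, hc⟩
      simp only at hc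
      subst hc
      simp only [Set.mem_iUnion]
      refine ⟨m, Finset.mem_Icc.2 hm, k, ?_, rfl⟩
      simp only at he
      cases h' : G.a m <;> rw [h'] at he <;> exact he
    refine Set.Finite.subset ?_ this
    refine Set.Finite.biUnion (Finset.finite_toSet _) fun m hm => ?_
    have := Finset.mem_Icc.1 hm
    exact (hD m this.1 this.2).image _
  · intro m hl hr
    ext k
    change G.IsParticle _ m k ↔ _
    rw [IsParticle]
    constructor
    · rintro (⟨e, he, ho, hc⟩ | ⟨rfl, hall⟩)
      · exact hright e he m k hc ho
      · by_contra hk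
        obtain ⟨e, he, -, ho⟩ := hexl G.l k le_rfl G.hlr hk
        exact hall e he ho
    · intro hk
      rcases eq_or_lt_of_le hl with rfl | hlt
      · refine Or.inr ⟨rfl, fun e he ho => ?_⟩
        rcases (oddEnd_eq_iff _ _ _).1 ho with h1 | h1
        · exact hleft e he _ k h1.1 ho hk
        · have := he.1.1
          omega
      · obtain ⟨e, he, hc, ho⟩ := hexr (m - 1) k (by omega) (by omega)
          (by rwa [sub_add_cancel])
        rw [sub_add_cancel] at ho
        exact Or.inl ⟨e, he, ho, hc⟩

end RailYard

/-! ### Coverings as paths of partitions -/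

/-- The relation between the partitions on the two sides of an even column. -/
def ColumnStrip (a : LR) (b : PM) (la mu : ℕ → ℕ) : Prop :=
  match a, b with
  | LR.L, PM.minus => HorizontalStrip la mu
  | LR.L, PM.plus => HorizontalStrip mu la
  | LR.R, PM.plus => VerticalStrip la mu
  | LR.R, PM.minus => VerticalStrip mu la

theorem isPart_zeroPad {N : ℕ} (la : YY N) : IsPart (zeroPad la.1) :=
  ⟨antitone_zeroPad la.2, N, fun _ hi => zeroPad_of_le _ hi⟩

theorem zeroPad_injective {N : ℕ} : Function.Injective fun la : YY N => zeroPad la.1 := by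
  intro la mu h
  refine Subtype.ext (funext fun i => ?_)
  have : zeroPad la.1 i = zeroPad mu.1 i := congrFun h i
  rwa [zeroPad_coe, zeroPad_coe] at this

theorem boxDist_comm {N : ℕ} (la mu : Fin N → ℕ) : boxDist la mu = boxDist mu la :=
  Finset.sum_congr rfl fun _ _ => add_comm _ _

/-- The partition with `N` parts given by the first `N` values. -/
def truncate {nu : ℕ → ℕ} (N : ℕ) (h : Antitone nu) : YY N := ⟨fun i => nu i, fun _ _ hij => h hij⟩

theorem zeroPad_truncate {nu : ℕ → ℕ} {N : ℕ} (h : Antitone nu) (hN : ∀ i, N ≤ i → nu i = 0) :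
    zeroPad (truncate N h).1 = nu := by
  funext i
  by_cases hi : i < N
  · simp [zeroPad, hi, truncate]
  · rw [zeroPad_of_le _ (not_lt.1 hi), hN i (not_lt.1 hi)]

section ColumnStrip

variable {a : LR} {b : PM}

theorem finite_setOf_add_one_mem {D : Set ℤ} (hD : D.Finite) : {k | k + 1 ∈ D}.Finite :=
  hD.preimage (add_left_injective (1 : ℤ)).injOn

theorem ColumnShift.columnStrip (hab : ¬ (a = LR.R ∧ b = PM.minus)) {la mu : ℕ → ℕ}
    (hla : IsPart la) (hmu : IsPart mu) {D : Set ℤ} (h : ColumnShift a b (maya la) (maya mu) D)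
    (hD : D.Finite) : ColumnStrip a b la mu := by
  cases a <;> cases b
  · exact ShiftUp.horizontalStrip hmu hla h hD
  · exact ShiftUp.horizontalStrip hla hmu (ShiftBy.shiftUp_of_neg_one h) (finite_setOf_add_one_mem hD)
  · exact ShiftUp.verticalStrip hla hmu h hD
  · simp at hab

theorem ColumnShift.exists_maya (hab : ¬ (a = LR.R ∧ b = PM.minus)) {la : ℕ → ℕ} (hla : IsPart la)
    {P D : Set ℤ} (h : ColumnShift a b (maya la) P D) (hD : D.Finite) :
    ∃ mu, IsPart mu ∧ P = maya mu := by
  cases a <;> cases b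
  · exact ShiftUp.exists_maya_of_compl' hla h hD
  · exact ShiftUp.exists_maya_of_compl hla (ShiftBy.shiftUp_of_neg_one h)
      (finite_setOf_add_one_mem hD)
  · exact ShiftUp.exists_maya hla h hD
  · simp at hab

theorem ColumnShift.unique (hab : ¬ (a = LR.R ∧ b = PM.minus)) {P P' D D' : Set ℤ}
    (h : ColumnShift a b P P' D) (h' : ColumnShift a b P P' D') (hD : D.Finite) (hD' : D'.Finite) :
    D = D' := by
  cases a <;> cases b
  · exact ShiftUp.unique h h' hD hD'
  · have := ShiftUp.unique (ShiftBy.shiftUp_of_neg_one h) (ShiftBy.shiftUp_of_neg_one h')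
      (finite_setOf_add_one_mem hD) (finite_setOf_add_one_mem hD')
    ext k
    have := Set.ext_iff.1 this (k - 1)
    simpa using this
  · exact ShiftUp.unique h h' hD hD'
  · simp at hab

theorem ColumnStrip.exists_columnShift (hab : ¬ (a = LR.R ∧ b = PM.minus)) {N : ℕ} {la mu : YY N}
    (h : ColumnStrip a b (zeroPad la.1) (zeroPad mu.1)) :
    ∃ D : Set ℤ, ColumnShift a b (maya (zeroPad la.1)) (maya (zeroPad mu.1)) D ∧ D.Finite ∧
      D.ncard = boxDist la.1 mu.1 := by
  cases a <;> cases b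
  · have h : HorizontalStrip (zeroPad mu.1) (zeroPad la.1) := h
    obtain ⟨h1, h2⟩ := h.ncard_eq mu.2
    exact ⟨_, h.shiftUp (antitone_zeroPad mu.2) (antitone_zeroPad la.2), h1,
      h2.trans (boxDist_comm _ _)⟩
  · have h : HorizontalStrip (zeroPad la.1) (zeroPad mu.1) := h
    obtain ⟨h1, h2⟩ := h.ncard_eq la.2
    refine ⟨_, ShiftBy.of_shiftUp (h.shiftUp (antitone_zeroPad la.2) (antitone_zeroPad mu.2)),
      h1.preimage (sub_left_injective (b := (1 : ℤ))).injOn, ?_⟩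
    rw [← h2]
    refine Set.ncard_preimage_of_injective_subset_range (sub_left_injective (b := (1 : ℤ))) ?_
    intro k _
    exact ⟨k + 1, by simp⟩
  · have h : VerticalStrip (zeroPad la.1) (zeroPad mu.1) := h
    obtain ⟨h1, h2⟩ := h.ncard_eq la.2
    exact ⟨_, h.shiftUp (antitone_zeroPad la.2) (antitone_zeroPad mu.2), h1, h2⟩
  · simp at hab

end ColumnStrip

/-! ### Path products along sequences -/

theorem pathProd_eq_prod_range {Y K : Type*} [CommMonoid K] (n : ℕ) (k : ℕ → Y → Y → K) (q : ℕ → Y) :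
    pathProd k (q 0) (fun i : Fin n => q (i + 1)) = ∏ i ∈ Finset.range n, k i (q i) (q (i + 1)) := by
  induction n generalizing k q with
  | zero => rfl
  | succ n ih =>
    rw [Finset.prod_range_succ', mul_comm, pathProd]
    congr 1
    exact ih (fun i => k (i + 1)) fun i => q (i + 1)

theorem pathLast_eq {Y : Type*} (n : ℕ) (q : ℕ → Y) :
    pathLast (q 0) (fun i : Fin n => q (i + 1)) = q n := by
  cases n <;> rfl

/-- The path `la, p 0, p 1, ...` as a sequence, continued by its starting point. -/
def pathSeq {Y : Type*} {n : ℕ} (la : Y) (p : Fin n → Y) : ℕ → Y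
  | 0 => la
  | i + 1 => if h : i < n then p ⟨i, h⟩ else la

theorem pathSeq_succ {Y : Type*} {n : ℕ} (la : Y) (p : Fin n → Y) :
    (fun i : Fin n => pathSeq la p (i + 1)) = p := by
  funext i
  simp [pathSeq]

/-! ### Column partitions of a covering and the paths that they form -/

namespace RailYard

variable {G : RailYard}

/-- The number of even columns. -/
def numCols (G : RailYard) : ℕ := (G.r + 1 - G.l).toNat

theorem prod_range_numCols {K : Type*} [CommMonoid K] (F : ℤ → K) :
    ∏ i ∈ Finset.range G.numCols, F (G.l + i) = ∏ m ∈ Finset.Icc G.l G.r, F m := by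
  have := G.hlr
  refine Finset.prod_bij' (fun i _ => G.l + i) (fun m _ => (m - G.l).toNat) ?_ ?_ ?_ ?_ ?_
  · intro i hi
    have := Finset.mem_range.1 hi
    simp only [numCols] at this
    exact Finset.mem_Icc.2 (by omega)
  · intro m hm
    have := Finset.mem_Icc.1 hm
    exact Finset.mem_range.2 (by simp only [numCols]; omega)
  · intro i hi
    omega
  · intro m hm
    have := Finset.mem_Icc.1 hm
    omega
  · intro i hi
    rfl

/-- The `(L, -)` columns from `m` on. -/
noncomputable def LMfrom (G : RailYard) (m : ℤ) : Finset ℤ := G.LM.filter fun j => m ≤ j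

theorem LMfrom_succ_of_mem {m : ℤ} (h : m ∈ G.LM) :
    G.LMfrom m = insert m (G.LMfrom (m + 1)) ∧ m ∉ G.LMfrom (m + 1) := by
  constructor
  · ext j
    simp only [LMfrom, Finset.mem_filter, Finset.mem_insert]
    constructor
    · rintro ⟨h1, h2⟩
      by_cases hj : j = m
      · exact Or.inl hj
      · exact Or.inr ⟨h1, by omega⟩
    · rintro (rfl | ⟨h1, h2⟩)
      · exact ⟨h, le_rfl⟩
      · exact ⟨h1, by omega⟩
  · simp [LMfrom]

theorem LMfrom_succ_of_notMem {m : ℤ} (h : m ∉ G.LM) : G.LMfrom m = G.LMfrom (m + 1) := by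
  ext j
  simp only [LMfrom, Finset.mem_filter]
  refine and_congr_right fun hj => ?_
  have : j ≠ m := fun he => h (he ▸ hj)
  omega

theorem mem_LM {m : ℤ} : m ∈ G.LM ↔ (G.l ≤ m ∧ m ≤ G.r) ∧ G.a m = LR.L ∧ G.b m = PM.minus := by
  rw [LM, Finset.mem_filter, Finset.mem_Icc]

theorem LMfrom_last : G.LMfrom (G.r + 1) = ∅ := by
  refine Finset.filter_eq_empty_iff.2 fun j hj => ?_
  have := (mem_LM.1 hj).1.2
  omega

theorem LMfrom_first : G.LMfrom G.l = G.LM :=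
  Finset.filter_true_of_mem fun _ hj => (mem_LM.1 hj).1.1

theorem card_LMfrom_le (m : ℤ) : (G.LMfrom m).card ≤ G.LM.card :=
  Finset.card_le_card (Finset.filter_subset _ _)

theorem finite_diagSet {M : Set RailEdge} (hM : G.IsDimerCovering M) (m : ℤ) :
    (diagSet M m).Finite := by
  have hinj : Set.InjOn (fun k : ℤ => (⟨m, k, EdgeKind.diag⟩ : RailEdge))
      ((fun k : ℤ => (⟨m, k, EdgeKind.diag⟩ : RailEdge)) ⁻¹' {e | e ∈ M ∧ e.kind = EdgeKind.diag}) :=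
    fun k _ k' _ h => (RailEdge.mk.injEq _ _ _ _ _ _ ▸ h).2.1
  exact (hM.finite_diag.preimage hinj).subset fun k hk => ⟨hk, rfl⟩

theorem ncard_diag_eq (M : Set RailEdge) (m : ℤ) :
    {e | e ∈ M ∧ e.kind = EdgeKind.diag ∧ e.col = m}.ncard = (diagSet M m).ncard := by
  have : {e | e ∈ M ∧ e.kind = EdgeKind.diag ∧ e.col = m} =
      (fun k : ℤ => (⟨m, k, EdgeKind.diag⟩ : RailEdge)) '' diagSet M m := by
    ext ⟨c, k, d⟩
    constructor
    · rintro ⟨h, rfl, rfl⟩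
      exact ⟨k, h, rfl⟩
    · rintro ⟨k', h, he⟩
      rw [RailEdge.mk.injEq] at he
      obtain ⟨rfl, rfl, rfl⟩ := he
      exact ⟨h, rfl, rfl⟩
  rw [this, Set.ncard_image_of_injective]
  intro k k' h
  exact (RailEdge.mk.injEq _ _ _ _ _ _ ▸ h).2.1

theorem columnShift_of_mem {M : Set RailEdge} (hM : G.IsDimerCovering M) {m : ℤ} (hl : G.l ≤ m)
    (hr : m ≤ G.r) :
    ColumnShift (G.a m) (G.b m) (G.particles M m) (G.particles M (m + 1)) (diagSet M m) :=
  (hM.columnPattern hl hr).columnShift.1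

/-- Only finitely many particles or holes move at each column, so being frozen far away and neutral
propagates from the left boundary. -/
theorem exists_maya_particles
    (hab : ∀ j ∈ Finset.Icc G.l G.r, ¬ (G.a j = LR.R ∧ G.b j = PM.minus)) {al be : ℕ → ℕ}
    {M : Set RailEdge} (hM : M ∈ G.coverings al be) {m : ℤ}
    (hl : G.l ≤ m) (hr : m ≤ G.r + 1) : ∃ nu, IsPart nu ∧ G.particles M m = maya nu := by
  induction m, hl using Int.leInduction with
  | base =>
    obtain ⟨h1, h2⟩ := SetHasPartition.eq_maya (P := G.particles M G.l) hM.2.1 hM.2.2.1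
    exact ⟨al, h1, h2⟩
  | succ m hl ih =>
    obtain ⟨nu, hnu, he⟩ := ih (by omega)
    have h := columnShift_of_mem hM.1 hl (by omega)
    rw [he] at h
    exact h.exists_maya (hab m (Finset.mem_Icc.2 ⟨hl, by omega⟩)) hnu (finite_diagSet hM.1 m)

end RailYard

namespace RailYard

variable {G : RailYard}

/-- The length bound propagates from the empty right boundary: towards the left, an `(L,-)` column
adds a horizontal strip, hence at most one part, and the `+` columns remove boxes. An `(R,-)` column
would spoil the bound. -/
theorem exists_parts_particles
    (hab : ∀ j ∈ Finset.Icc G.l G.r, ¬ (G.a j = LR.R ∧ G.b j = PM.minus)) {al : ℕ → ℕ}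
    {M : Set RailEdge} (hM : M ∈ G.coverings al fun _ => 0) {m : ℤ} (hl : G.l ≤ m)
    (hr : m ≤ G.r + 1) : ∃ nu, IsPart nu ∧ G.particles M m = maya nu ∧
      ∀ i, (G.LMfrom m).card ≤ i → nu i = 0 := by
  obtain ⟨d, hd⟩ := Int.eq_ofNat_of_zero_le (sub_nonneg.2 hr)
  obtain rfl : m = G.r + 1 - d := by omega
  clear hd
  induction d with
  | zero =>
    obtain ⟨h1, h2⟩ := SetHasPartition.eq_maya (P := G.particles M (G.r + 1)) hM.2.2.2.1 hM.2.2.2.2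
    exact ⟨fun _ => 0, h1, by simpa using h2, fun _ _ => rfl⟩
  | succ d ih =>
    push_cast at hl hr ⊢
    set m := G.r + 1 - (d + 1 : ℤ) with hm
    have hm' : G.r + 1 - (d : ℤ) = m + 1 := by omega
    rw [hm'] at ih
    obtain ⟨mu, hmu, he, hz⟩ := ih (by omega) (by omega)
    obtain ⟨nu, hnu, he'⟩ := exists_maya_particles hab hM hl hr
    refine ⟨nu, hnu, he', ?_⟩
    have hsh := columnShift_of_mem hM.1 hl (by omega)
    rw [he, he'] at hsh
    have hmem : m ∈ Finset.Icc G.l G.r := Finset.mem_Icc.2 ⟨hl, by omega⟩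
    have hst := hsh.columnStrip (hab m hmem) hnu hmu (finite_diagSet hM.1 m)
    intro i hi
    rcases ha : G.a m with _ | _ <;> rcases hb : G.b m with _ | _ <;> rw [ha, hb] at hst
    · rw [LMfrom_succ_of_notMem (by simp [mem_LM, hb])] at hi
      have := (hst i).2
      rw [hz i hi] at this
      omega
    · obtain ⟨h1, h2⟩ := LMfrom_succ_of_mem (G := G) (m := m) (mem_LM.2 ⟨⟨hl, by omega⟩, ha, hb⟩)
      rw [h1, Finset.card_insert_of_notMem h2] at hi
      have := (hst (i - 1)).1
      rw [hz (i - 1) (by omega), show i - 1 + 1 = i by omega] at this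
      omega
    · rw [LMfrom_succ_of_notMem (by simp [mem_LM, hb])] at hi
      have := (hst i).1
      rw [hz i hi] at this
      omega
    · exact absurd ⟨ha, hb⟩ (hab m hmem)

open Classical in
/-- The partition of a column, as a partition with `N` parts. -/
noncomputable def colPart (G : RailYard) (N : ℕ) (M : Set RailEdge) (m : ℤ) : YY N :=
  if h : ∃ nu : YY N, G.particles M m = maya (zeroPad nu.1) then h.choose
  else ⟨fun _ => 0, antitone_const⟩

theorem colPart_spec
    (hab : ∀ j ∈ Finset.Icc G.l G.r, ¬ (G.a j = LR.R ∧ G.b j = PM.minus)) {al : ℕ → ℕ}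
    {M : Set RailEdge} (hM : M ∈ G.coverings al fun _ => 0) {m : ℤ} (hl : G.l ≤ m)
    (hr : m ≤ G.r + 1) {N : ℕ} (hN : (G.LMfrom m).card ≤ N) :
    G.particles M m = maya (zeroPad (G.colPart N M m).1) := by
  obtain ⟨nu, h1, h2, h3⟩ := exists_parts_particles hab hM hl hr
  have h : ∃ nu : YY N, G.particles M m = maya (zeroPad nu.1) :=
    ⟨truncate N h1.1, by rw [zeroPad_truncate h1.1 fun i hi => h3 i (hN.trans hi)]; exact h2⟩
  have he : G.colPart N M m = h.choose := dif_pos h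
  exact he ▸ h.choose_spec

theorem colPart_eq {M : Set RailEdge} {m : ℤ} {N : ℕ} {nu : YY N}
    (h : G.particles M m = maya (zeroPad nu.1)) : G.colPart N M m = nu := by
  have hex : ∃ nu : YY N, G.particles M m = maya (zeroPad nu.1) := ⟨nu, h⟩
  have h1 : G.particles M m = maya (zeroPad (G.colPart N M m).1) := by
    have he : G.colPart N M m = hex.choose := dif_pos hex
    exact he ▸ hex.choose_spec
  exact zeroPad_injective (maya_injective (isPart_zeroPad _) (isPart_zeroPad _) (h1.symm.trans h))

/-- The partitions of the columns `l + 1, ..., r + 1`. -/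
noncomputable def pathOf (G : RailYard) (N : ℕ) (M : Set RailEdge) : Fin G.numCols → YY N :=
  fun i => G.colPart N M (G.l + ((i : ℕ) + 1 : ℕ))

open Classical in
/-- The weight of the transition between two partitions through an even column. -/
noncomputable def stepWeight (G : RailYard) (y : ℤ → ℝ) (m : ℤ) {N : ℕ} (la mu : YY N) : ℝ :=
  if ColumnStrip (G.a m) (G.b m) (zeroPad la.1) (zeroPad mu.1) then y m ^ boxDist la.1 mu.1 else 0

theorem mem_coverings_iff {al : ℕ → ℕ} {be : ℕ → ℕ} {M : Set RailEdge} (hal : IsPart al)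
    (hbe : IsPart be) : M ∈ G.coverings al be ↔
      G.IsDimerCovering M ∧ G.particles M G.l = maya al ∧ G.particles M (G.r + 1) = maya be := by
  constructor
  · rintro ⟨h1, h2, h3, h4, h5⟩
    exact ⟨h1, (SetHasPartition.eq_maya (P := G.particles M G.l) h2 h3).2,
      (SetHasPartition.eq_maya (P := G.particles M (G.r + 1)) h4 h5).2⟩
  · rintro ⟨h1, h2, h3⟩
    have e1 : SetHasPartition (G.particles M G.l) al := h2 ▸ hal.setHasPartition_maya
    have e2 : setCharge (G.particles M G.l) = 0 := h2 ▸ hal.setCharge_maya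
    have e3 : SetHasPartition (G.particles M (G.r + 1)) be := h3 ▸ hbe.setHasPartition_maya
    have e4 : setCharge (G.particles M (G.r + 1)) = 0 := h3 ▸ hbe.setCharge_maya
    exact ⟨h1, e1, e2, e3, e4⟩

theorem columnStrip_colPart
    (hab : ∀ j ∈ Finset.Icc G.l G.r, ¬ (G.a j = LR.R ∧ G.b j = PM.minus)) {al : ℕ → ℕ}
    {M : Set RailEdge} (hM : M ∈ G.coverings al fun _ => 0) {N : ℕ} (hN : G.LM.card ≤ N) {m : ℤ}
    (hl : G.l ≤ m) (hr : m ≤ G.r) :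
    ColumnStrip (G.a m) (G.b m) (zeroPad (G.colPart N M m).1) (zeroPad (G.colPart N M (m + 1)).1) ∧
      (diagSet M m).ncard = boxDist (G.colPart N M m).1 (G.colPart N M (m + 1)).1 := by
  have hsh := columnShift_of_mem hM.1 hl hr
  rw [colPart_spec hab hM hl (by omega) ((card_LMfrom_le m).trans hN),
    colPart_spec hab hM (by omega : G.l ≤ m + 1) (by omega) ((card_LMfrom_le (m + 1)).trans hN)] at hsh
  have hm := hab m (Finset.mem_Icc.2 ⟨hl, hr⟩)
  have hst := hsh.columnStrip hm (isPart_zeroPad _) (isPart_zeroPad _) (finite_diagSet hM.1 m)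
  refine ⟨hst, ?_⟩
  obtain ⟨D, hD1, hD2, hD3⟩ := hst.exists_columnShift hm
  rw [hsh.unique hm hD1 (finite_diagSet hM.1 m) hD2, hD3]

/-- The particle sets on both sides of a column determine its finite set of diagonal edges, and the
three sets together determine all its edges. -/
theorem pathOf_injective
    (hab : ∀ j ∈ Finset.Icc G.l G.r, ¬ (G.a j = LR.R ∧ G.b j = PM.minus)) {al : ℕ → ℕ}
    (hal : IsPart al) {N : ℕ} (hN : G.LM.card ≤ N) :
    Function.Injective fun M : G.coverings al fun _ => 0 => G.pathOf N M.1 := by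
  rintro ⟨M, hM⟩ ⟨M', hM'⟩ h
  simp only at h
  have h0 : IsPart fun _ => 0 := ⟨antitone_const, 0, fun _ _ => rfl⟩
  have hP : ∀ m, G.l ≤ m → m ≤ G.r + 1 → G.particles M m = G.particles M' m := by
    intro m hl hr
    rcases eq_or_lt_of_le hl with rfl | hlt
    · rw [((mem_coverings_iff hal h0).1 hM).2.1, ((mem_coverings_iff hal h0).1 hM').2.1]
    · have := congrFun h ⟨(m - G.l - 1).toNat, by simp only [numCols]; omega⟩
      simp only [pathOf] at this
      rw [show G.l + (((m - G.l - 1).toNat + 1 : ℕ) : ℤ) = m by omega] at this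
      rw [colPart_spec hab hM hl hr ((card_LMfrom_le m).trans hN),
        colPart_spec hab hM' hl hr ((card_LMfrom_le m).trans hN), this]
  have key : ∀ m k c, G.l ≤ m → m ≤ G.r →
      ((⟨m, k, c⟩ : RailEdge) ∈ M ↔ (⟨m, k, c⟩ : RailEdge) ∈ M') := by
    intro m k c hl hr
    have h1 := (hM.1.columnPattern hl hr).columnShift
    have h2 := (hM'.1.columnPattern hl hr).columnShift
    have hD : diagSet M m = diagSet M' m := by
      refine ColumnShift.unique (hab m (Finset.mem_Icc.2 ⟨hl, hr⟩)) h1.1 ?_ (finite_diagSet hM.1 m)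
        (finite_diagSet hM'.1 m)
      rw [hP m hl (by omega), hP (m + 1) (by omega) (by omega)]
      exact h2.1
    have e1 := h1.2 k c
    have e2 := h2.2 k c
    change _ ↔ columnEdge _ _ _ (diagSet M m) k c at e1
    change _ ↔ columnEdge _ _ _ (diagSet M' m) k c at e2
    rw [hD, hP m hl (by omega), hP (m + 1) (by omega) (by omega)] at e1
    exact e1.trans e2.symm
  refine Subtype.ext (Set.ext ?_)
  rintro ⟨m, k, c⟩
  constructor
  · intro he
    have := hM.1.isEdge _ he
    exact (key m k c this.1 this.2).1 he
  · intro he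
    have := hM'.1.isEdge _ he
    exact (key m k c this.1 this.2).2 he

theorem exists_pathOf_eq
    (hab : ∀ j ∈ Finset.Icc G.l G.r, ¬ (G.a j = LR.R ∧ G.b j = PM.minus)) {N : ℕ} (q : ℕ → YY N)
    (hq : ∀ i < G.numCols, ColumnStrip (G.a (G.l + i)) (G.b (G.l + i)) (zeroPad (q i).1)
      (zeroPad (q (i + 1)).1)) (hlast : (q G.numCols).1 = 0) :
    ∃ M ∈ G.coverings (zeroPad (q 0).1) fun _ => 0, G.pathOf N M = fun i : Fin G.numCols => q (i + 1) := by
  have hlr := G.hlr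
  have h0 : IsPart fun _ => 0 := ⟨antitone_const, 0, fun _ _ => rfl⟩
  have hex : ∀ m, ∃ D : Set ℤ, G.l ≤ m → m ≤ G.r → ColumnShift (G.a m) (G.b m)
      (maya (zeroPad (q (m - G.l).toNat).1)) (maya (zeroPad (q (m + 1 - G.l).toNat).1)) D ∧
      D.Finite := by
    intro m
    by_cases hm : G.l ≤ m ∧ m ≤ G.r
    · have hst := hq (m - G.l).toNat (by simp only [numCols]; omega)
      rw [show G.l + ((m - G.l).toNat : ℤ) = m by omega,
        show (m - G.l).toNat + 1 = (m + 1 - G.l).toNat by omega] at hst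
      obtain ⟨D, h1, h2, -⟩ := hst.exists_columnShift (hab m (Finset.mem_Icc.2 hm))
      exact ⟨D, fun _ _ => ⟨h1, h2⟩⟩
    · exact ⟨∅, fun hl hr => absurd ⟨hl, hr⟩ hm⟩
  choose D hD using hex
  obtain ⟨h1, h2⟩ := isDimerCovering_edgesOf (G := G)
    (P := fun m => maya (zeroPad (q (m - G.l).toNat).1)) (D := D)
    (fun m hl hr => (hD m hl hr).1) (fun m hl hr => (hD m hl hr).2)
  refine ⟨_, (mem_coverings_iff (isPart_zeroPad _) h0).2 ⟨h1, ?_, ?_⟩, ?_⟩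
  · rw [h2 G.l le_rfl (by omega)]
    simp
  · rw [h2 (G.r + 1) (by omega) le_rfl]
    change maya (zeroPad (q G.numCols).1) = _
    rw [hlast]
    congr 1
    funext i
    simp [zeroPad]
  · funext i
    have hi : (i : ℕ) < (G.r + 1 - G.l).toNat := i.2
    refine colPart_eq ?_
    rw [h2 _ (by omega) (by omega)]
    congr 5
    omega

theorem weight_eq_prod
    (hab : ∀ j ∈ Finset.Icc G.l G.r, ¬ (G.a j = LR.R ∧ G.b j = PM.minus)) {al : ℕ → ℕ}
    {M : Set RailEdge} (hM : M ∈ G.coverings al fun _ => 0) {N : ℕ} (hN : G.LM.card ≤ N)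
    (y : ℤ → ℝ) : G.weight y M =
      ∏ m ∈ Finset.Icc G.l G.r, G.stepWeight y m (G.colPart N M m) (G.colPart N M (m + 1)) := by
  refine Finset.prod_congr rfl fun m hm => ?_
  have hm' := Finset.mem_Icc.1 hm
  obtain ⟨h1, h2⟩ := columnStrip_colPart hab hM hN hm'.1 hm'.2
  rw [stepWeight, if_pos h1, ncard_diag_eq, h2]

/-- The transition kernel of the even column `l + i`, with a test function inserted at the odd
column `t + 1`. -/
noncomputable def stepKernel (G : RailYard) (y : ℤ → ℝ) (t : ℤ) {N : ℕ} (g : YY N → ℂ) (i : ℕ)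
    (la mu : YY N) : ℂ :=
  (G.stepWeight y (G.l + i) la mu : ℂ) * if G.l + i = t then g mu else 1

/-- Coverings embed into paths with matching weights. A path outside the image has a transition that
is not a strip or a nonempty last partition, so its term is zero. -/
theorem hasSum_coverings_of_hasSum_path
    (hab : ∀ j ∈ Finset.Icc G.l G.r, ¬ (G.a j = LR.R ∧ G.b j = PM.minus)) {N : ℕ}
    (hN : G.LM.card ≤ N) (al : YY N) (y : ℤ → ℝ) {t : ℤ} (ht : t ∈ Finset.Icc G.l G.r)
    (g : YY N → ℂ) {S : ℂ}
    (h : HasSum (fun p : Fin G.numCols → YY N => pathProd (G.stepKernel y t g) al p *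
      jt (1 : PowerSeries ℂ) (pathLast al p).1) S) :
    HasSum (fun M : G.coverings (zeroPad al.1) fun _ => 0 =>
      (G.weight y M.1 : ℂ) * g (G.colPart N M.1 (t + 1))) S := by
  have hlr := G.hlr
  have h0 : IsPart fun _ => 0 := ⟨antitone_const, 0, fun _ _ => rfl⟩
  have hinj := pathOf_injective hab (isPart_zeroPad al) hN
  rw [← hinj.hasSum_iff] at h
  · refine h.congr_fun fun M => ?_
    obtain ⟨M, hM⟩ := M
    have hMl := (mem_coverings_iff (isPart_zeroPad al) h0).1 hM
    have hal : G.colPart N M G.l = al := colPart_eq hMl.2.1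
    let q : ℕ → YY N := fun i => G.colPart N M (G.l + (i : ℕ))
    have hq0 : q 0 = al := by simpa [q] using hal
    have hlast : (q G.numCols).1 = 0 := by
      have hz : q G.numCols = ⟨0, antitone_const⟩ := by
        refine colPart_eq ?_
        rw [show G.l + (G.numCols : ℤ) = G.r + 1 by simp only [numCols]; omega, hMl.2.2]
        congr 1
        funext i
        simp [zeroPad]
      rw [hz]
    have e1 : pathProd (G.stepKernel y t g) al (G.pathOf N M) =
        ∏ i ∈ Finset.range G.numCols, G.stepKernel y t g i (q i) (q (i + 1)) := by
      rw [← hq0]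
      exact pathProd_eq_prod_range _ _ q
    have e2 : pathLast al (G.pathOf N M) = q G.numCols := by
      rw [← hq0]
      exact pathLast_eq _ q
    simp only [Function.comp_apply]
    rw [e1, e2, jt_one, if_pos hlast, mul_one]
    have e3 := prod_range_numCols (G := G) fun m =>
      (G.stepWeight y m (G.colPart N M m) (G.colPart N M (m + 1)) : ℂ) *
        if m = t then g (G.colPart N M (m + 1)) else 1
    rw [Finset.prod_mul_distrib (s := Finset.Icc G.l G.r), Finset.prod_ite_eq' , if_pos ht,
      ← Complex.ofReal_prod, ← weight_eq_prod hab hM hN] at e3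
    rw [← e3]
    refine Finset.prod_congr rfl fun i _ => ?_
    simp only [stepKernel, q]
    push_cast
    rw [add_assoc]
  · intro p hp
    by_contra hne
    obtain ⟨hne1, hne2⟩ := mul_ne_zero_iff.1 hne
    obtain ⟨q, rfl, rfl⟩ : ∃ q : ℕ → YY N, q 0 = al ∧ (fun i : Fin G.numCols => q (i + 1)) = p :=
      ⟨pathSeq al p, rfl, pathSeq_succ al p⟩
    rw [pathLast_eq, jt_one] at hne2
    rw [pathProd_eq_prod_range, Finset.prod_ne_zero_iff] at hne1
    obtain ⟨M, hM, hMp⟩ := exists_pathOf_eq hab q (fun i hi => by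
      have := left_ne_zero_of_mul (hne1 i (Finset.mem_range.2 hi))
      by_contra hc
      rw [stepWeight, if_neg hc] at this
      simp at this) (by
      by_contra hc
      rw [if_neg hc] at hne2
      exact hne2 rfl)
    exact hp ⟨⟨M, hM⟩, hMp⟩

end RailYard

/-- Coverings are grouped by the label `mu`, on which the test function depends alone; the inner
sums then have real weights only. -/
theorem hasSum_tsum_fiber {α κ : Type*} {A : Set α} {R : α → κ → Prop}
    (hR : ∀ M ∈ A, ∃! mu, R M mu) {w : α → ℝ} (hw : Summable fun M : A => w M.1) {h : A → ℂ}
    {g : κ → ℂ} (hgh : ∀ (M : A) mu, R M.1 mu → h M = g mu) {S : ℂ}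
    (hS : HasSum (fun M : A => (w M.1 : ℂ) * h M) S) :
    HasSum (fun mu => ((∑' M : {M // M ∈ A ∧ R M mu}, w M.1 : ℝ) : ℂ) * g mu) S := by
  let e : (Σ mu, {M // M ∈ A ∧ R M mu}) ≃ A :=
    Equiv.ofBijective (fun p => ⟨p.2.1, p.2.2.1⟩) <| by
      constructor
      · rintro ⟨mu, M, hM, hp⟩ ⟨mu', M', hM', hp'⟩ heq
        obtain rfl : M = M' := congrArg Subtype.val heq
        obtain rfl : mu = mu' := (hR M hM).unique hp hp'
        rfl
      · rintro ⟨M, hM⟩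
        obtain ⟨mu, hmu, -⟩ := hR M hM
        exact ⟨⟨mu, M, hM, hmu⟩, rfl⟩
  have h1 : HasSum (fun p : Σ mu, {M // M ∈ A ∧ R M mu} => (w p.2.1 : ℂ) * h (e p)) S :=
    e.hasSum_iff.2 hS
  have h2 : Summable fun p : Σ mu, {M // M ∈ A ∧ R M mu} => w p.2.1 := e.summable_iff.2 hw
  refine h1.sigma fun mu => ?_
  have h3 := (Complex.hasSum_ofReal.2 (h2.sigma_factor mu).hasSum).mul_right (g mu)
  refine h3.congr_fun fun M => ?_
  rw [hgh (e ⟨mu, M⟩) mu M.2.2]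

/-! ### One-column identities and path sums with an inserted test function -/

namespace RailYard

variable {G : RailYard}

/-- The factor contributed by the even column `m`, namely the product of the pair factors of `m`
with all later `(L, -)` columns if `b m = +`. -/
noncomputable def colFactor {K : Type*} [Field K] (G : RailYard) (v : ℤ → K) (m : ℤ) : K :=
  if G.b m = PM.plus then
    ∏ j ∈ G.LMfrom (m + 1), if G.a m = LR.L then 1 / (1 - v m * v j) else 1 + v m * v j
  else 1

/-- The branching rule and the two Pieri rules in one form. Only `v m` is tied to the weight of the
column; the later variables are free apart from convergence, which allows them to be replaced by
`u`. -/
theorem hasSum_stepWeight_mul_jt {K : Type*} [RCLike K]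
    (hab : ∀ j ∈ Finset.Icc G.l G.r, ¬ (G.a j = LR.R ∧ G.b j = PM.minus)) {N : ℕ}
    (hN : G.LM.card ≤ N) {m : ℤ} (hm : m ∈ Finset.Icc G.l G.r) (v : ℤ → K) (y : ℤ → ℝ)
    (hv : v m = (y m : K))
    (hconv : G.a m = LR.L → G.b m = PM.plus → ∀ j ∈ G.LMfrom (m + 1), ‖v m * v j‖ < 1)
    (la : YY N) :
    HasSum
      (fun mu : YY N => ((G.stepWeight y m la mu : ℝ) : K) * jt (hgen (G.LMfrom (m + 1)) v) mu.1)
      (G.colFactor v m * jt (hgen (G.LMfrom m) v) la.1) := by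
  classical
  have hm' := Finset.mem_Icc.1 hm
  have hcast : ∀ mu : YY N, ((G.stepWeight y m la mu : ℝ) : K) =
      if ColumnStrip (G.a m) (G.b m) (zeroPad la.1) (zeroPad mu.1) then v m ^ boxDist la.1 mu.1
      else 0 := by
    intro mu
    rw [stepWeight, hv]
    by_cases h : ColumnStrip (G.a m) (G.b m) (zeroPad la.1) (zeroPad mu.1)
    · rw [if_pos h, if_pos h, RCLike.ofReal_pow]
    · rw [if_neg h, if_neg h, RCLike.ofReal_zero]
  simp_rw [hcast]
  have hcard := (card_LMfrom_le (G := G) (m + 1)).trans hN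
  rcases ha : G.a m with _ | _ <;> rcases hb : G.b m with _ | _
  · have hLM : m ∉ G.LM := by simp [mem_LM, hb]
    rw [LMfrom_succ_of_notMem hLM, colFactor, if_pos hb]
    simp only [ha, if_true]
    refine (hasSum_horizontalStrip_mul_jt' hcard v (v m) (hconv ha hb) la).congr_fun fun mu => ?_
    by_cases hs : HorizontalStrip (zeroPad mu.1) (zeroPad la.1)
    · rw [if_pos hs]
      exact congrArg (· * _) (if_pos hs)
    · rw [if_neg hs]
      exact congrArg (· * _) (if_neg hs)
  · obtain ⟨h1, h2⟩ := LMfrom_succ_of_mem (mem_LM.2 ⟨hm', ha, hb⟩)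
    rw [h1, colFactor, if_neg (by simp [hb]), one_mul]
    convert! hasSum_horizontalStrip_mul_jt h2 v la
  · have hLM : m ∉ G.LM := by simp [mem_LM, hb]
    rw [LMfrom_succ_of_notMem hLM, colFactor, if_pos hb]
    simp only [ha, reduceCtorEq, if_false]
    convert! hasSum_verticalStrip_mul_jt hcard v (v m) la
  · exact absurd ⟨ha, hb⟩ (hab m hm)

theorem colFactor_pos {v : ℤ → ℝ} {m : ℤ} (hm : 0 ≤ v m) (hv : ∀ j ∈ G.LMfrom (m + 1), 0 ≤ v j)
    (hconv : G.a m = LR.L → G.b m = PM.plus → ∀ j ∈ G.LMfrom (m + 1), v m * v j < 1) :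
    0 < G.colFactor v m := by
  unfold colFactor
  by_cases hb : G.b m = PM.plus
  · rw [if_pos hb]
    refine Finset.prod_pos fun j hj => ?_
    have := mul_nonneg hm (hv j hj)
    by_cases ha : G.a m = LR.L
    · rw [if_pos ha]
      have := hconv ha hb j hj
      exact one_div_pos.2 (by linarith)
    · rw [if_neg ha]
      positivity
  · rw [if_neg hb]
    exact one_pos

/-- Hypothesis `hg` says that multiplying by `g` exchanges the variables `y` for `W` at column `t +
1`. The recursion uses `y` on the right of that column and `W` on its left. -/
theorem hasSum_path_stepKernel
    (hab : ∀ j ∈ Finset.Icc G.l G.r, ¬ (G.a j = LR.R ∧ G.b j = PM.minus)) {N : ℕ}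
    (hN : G.LM.card ≤ N) (al : YY N) {y : ℤ → ℝ} (hy : ∀ j ∈ Finset.Icc G.l G.r, 0 ≤ y j)
    {t : ℤ} (ht : t ∈ Finset.Icc G.l G.r) (W : ℤ → ℂ) (hW : ∀ j ≤ t, W j = y j)
    (hconv : ∀ i ∈ Finset.Icc G.l G.r, G.a i = LR.L → G.b i = PM.plus → ∀ j ∈ G.LMfrom (i + 1),
      y i * y j < 1)
    (hconv' : ∀ i ∈ Finset.Icc G.l t, G.a i = LR.L → G.b i = PM.plus → ∀ j ∈ G.LMfrom (t + 1),
      ‖(y i : ℂ) * W j‖ < 1)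
    (g : YY N → ℂ)
    (hg : ∀ mu : YY N, g mu * jt (hgen (G.LMfrom (t + 1)) fun j => (y j : ℂ)) mu.1 =
      jt (hgen (G.LMfrom (t + 1)) W) mu.1) :
    HasSum (fun p : Fin G.numCols → YY N => pathProd (G.stepKernel y t g) al p *
        jt (1 : PowerSeries ℂ) (pathLast al p).1)
      ((∏ m ∈ Finset.Icc G.l G.r,
        G.colFactor (if t < m then fun j => (y j : ℂ) else W) m) * jt (hgen G.LM W) al.1) := by
  have hlr := G.hlr
  have ht' := Finset.mem_Icc.1 ht
  let V : ℤ → ℤ → ℂ := fun m => if t < m then fun j => (y j : ℂ) else W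
  have hVm : ∀ m, V m m = y m := by
    intro m
    by_cases hm : t < m
    · simp [V, hm]
    · simp only [V, hm, if_false]
      exact hW m (not_lt.1 hm)
  have hVconv : ∀ m ∈ Finset.Icc G.l G.r, G.a m = LR.L → G.b m = PM.plus →
      ∀ j ∈ G.LMfrom (m + 1), ‖V m m * V m j‖ < 1 := by
    intro m hm ha hb j hj
    have hjm := (Finset.mem_filter.1 hj)
    have hreal : ‖(y m : ℂ) * (y j : ℂ)‖ < 1 := by
      rw [← Complex.ofReal_mul, Complex.norm_real, Real.norm_of_nonneg]
      · exact hconv m hm ha hb j hj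
      · exact mul_nonneg (hy m hm) (hy j (Finset.mem_Icc.2 (mem_LM.1 hjm.1).1))
    rw [hVm]
    by_cases htm : t < m
    · simpa only [V, htm, if_true] using hreal
    · simp only [V, htm, if_false]
      by_cases htj : t < j
      · exact hconv' m (Finset.mem_Icc.2 ⟨(Finset.mem_Icc.1 hm).1, not_lt.1 htm⟩) ha hb j
          (Finset.mem_filter.2 ⟨hjm.1, by omega⟩)
      · rwa [hW j (not_lt.1 htj)]
  let f : ℕ → YY N → ℂ := fun i la => (∏ m ∈ Finset.Icc (G.l + i) G.r, G.colFactor (V m) m) *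
    jt (hgen (G.LMfrom (G.l + i)) (V (G.l + i))) la.1
  let C : ℕ → ℝ := fun i => ∏ m ∈ Finset.Icc (G.l + i) G.r, G.colFactor (fun j => ‖V m j‖) m
  -- Majorant for absolute convergence: the same expression at the absolute values of the variables.
  let F : ℕ → YY N → ℝ := fun i la => C i *
    jt (hgen (G.LMfrom (G.l + i)) fun j => ‖V (G.l + i) j‖) la.1
  have hC : ∀ i, 0 ≤ C i := fun i => Finset.prod_nonneg fun m hm => by
    have hm' := Finset.mem_Icc.1 hm
    refine (colFactor_pos (G := G) (v := fun j => ‖V m j‖) (m := m) (norm_nonneg _)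
      (fun _ _ => norm_nonneg _) fun ha hb j hj => ?_).le
    rw [← norm_mul]
    exact hVconv m (Finset.mem_Icc.2 ⟨by omega, hm'.2⟩) ha hb j hj
  have hIcc : ∀ i < G.numCols, Finset.Icc (G.l + (i : ℤ)) G.r =
      insert (G.l + i : ℤ) (Finset.Icc (G.l + ((i + 1 : ℕ) : ℤ)) G.r) := by
    intro i hi
    simp only [numCols] at hi
    ext k
    simp only [Finset.mem_insert, Finset.mem_Icc]
    push_cast
    omega
  have hnotMem : ∀ i : ℕ, (G.l + i : ℤ) ∉ Finset.Icc (G.l + ((i + 1 : ℕ) : ℤ)) G.r := by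
    intro i h
    have := (Finset.mem_Icc.1 h).1
    push_cast at this
    omega
  have hmem : ∀ i < G.numCols, (G.l + i : ℤ) ∈ Finset.Icc G.l G.r := by
    intro i hi
    simp only [numCols] at hi
    exact Finset.mem_Icc.2 (by omega)
  have hsucc : ∀ i : ℕ, G.l + ((i + 1 : ℕ) : ℤ) = G.l + i + 1 := fun i => by push_cast; ring
  have hVsucc : ∀ m, m ≠ t → V (m + 1) = V m := by
    intro m hm
    have : t < m + 1 ↔ t < m := by omega
    simp only [V, this]
  have hVt : V t = W := by simp [V]
  have hVt' : V (t + 1) = fun j => (y j : ℂ) := by simp [V]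
  have hmain := hasSum_pathProd (n := G.numCols) (G.stepKernel y t g) f F ?_ ?_ ?_ ?_ al
  · have h1 := hmain.1
    have hn : G.l + (G.numCols : ℤ) = G.r + 1 := by simp only [numCols]; omega
    have hfn : ∀ la, f G.numCols la = jt (1 : PowerSeries ℂ) la.1 := by
      intro la
      simp only [f, hn]
      rw [Finset.Icc_eq_empty (by omega), Finset.prod_empty, one_mul, LMfrom_last, hgen_empty]
    simp_rw [hfn] at h1
    have hf0 : f 0 al = (∏ m ∈ Finset.Icc G.l G.r, G.colFactor (V m) m) * jt (hgen G.LM W) al.1 := by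
      have : V G.l = W := by simp [V, not_lt.2 ht'.1]
      simp only [f, Nat.cast_zero, add_zero, LMfrom_first, this]
    rw [hf0] at h1
    exact h1
  · intro i la
    exact mul_nonneg (hC i) (jt_hgen_nonneg (fun _ _ => norm_nonneg _) la)
  · intro la
    have hn : G.l + (G.numCols : ℤ) = G.r + 1 := by simp only [numCols]; omega
    simp only [f, F, C, hn]
    rw [Finset.Icc_eq_empty (by omega), Finset.prod_empty, Finset.prod_empty, one_mul, one_mul]
    exact norm_jt_hgen_le (fun _ _ => le_rfl) la
  · intro i hi la
    have hstep := hasSum_stepWeight_mul_jt hab hN (hmem i hi) (V (G.l + i)) y (hVm _)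
      (hVconv _ (hmem i hi)) la
    have hsum := hstep.mul_left
      (∏ m ∈ Finset.Icc (G.l + ((i + 1 : ℕ) : ℤ)) G.r, G.colFactor (V m) m)
    have hval : f i la = (∏ m ∈ Finset.Icc (G.l + ((i + 1 : ℕ) : ℤ)) G.r, G.colFactor (V m) m) *
        (G.colFactor (V (G.l + i)) (G.l + i) *
          jt (hgen (G.LMfrom (G.l + i)) (V (G.l + i))) la.1) := by
      simp only [f]
      rw [hIcc i hi, Finset.prod_insert (hnotMem i)]
      ring
    rw [hval]
    refine hsum.congr_fun fun mu => ?_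
    -- The variables switch exactly at the column carrying the test function; elsewhere both sides
    -- agree.
    have hphi : (if G.l + (i : ℤ) = t then g mu else 1) *
        jt (hgen (G.LMfrom (G.l + i + 1)) (V (G.l + i + 1))) mu.1 =
        jt (hgen (G.LMfrom (G.l + i + 1)) (V (G.l + i))) mu.1 := by
      split_ifs with hit
      · rw [hit, hVt, hVt']
        exact hg mu
      · rw [one_mul, hVsucc _ hit]
    simp only [stepKernel, f]
    rw [← hphi, hsucc]
    simp only [Complex.coe_algebraMap]
    ring
  · intro i hi la
    have hstep := hasSum_stepWeight_mul_jt hab hN (hmem i hi) (fun j => ‖V (G.l + i) j‖) y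
      (by
        rw [hVm, Complex.norm_real, Real.norm_of_nonneg (hy _ (hmem i hi))]
        rfl)
      (fun ha hb j hj => by
        rw [← norm_mul, norm_norm]
        exact hVconv _ (hmem i hi) ha hb j hj) la
    have hsum := hstep.mul_left (C (i + 1))
    have hval : F i la = C (i + 1) * (G.colFactor (fun j => ‖V (G.l + i) j‖) (G.l + i) *
          jt (hgen (G.LMfrom (G.l + i)) fun j => ‖V (G.l + i) j‖) la.1) := by
      simp only [F, C]
      rw [hIcc i hi, Finset.prod_insert (hnotMem i)]
      ring
    have hw : ∀ mu : YY N, 0 ≤ G.stepWeight y (G.l + i) la mu := fun mu => by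
      unfold stepWeight
      split_ifs
      · exact pow_nonneg (hy _ (hmem i hi)) _
      · rfl
    have hle : ∀ mu : YY N, ‖G.stepKernel y t g i la mu‖ * F (i + 1) mu ≤
        C (i + 1) * (G.stepWeight y (G.l + i) la mu *
          jt (hgen (G.LMfrom (G.l + i + 1)) fun j => ‖V (G.l + i) j‖) mu.1) := by
      intro mu
      -- At the switch the norm of `g` times the Schur function at `y` equals the norm of the one at
      -- `W`, hence is at most the one at the norms of `W`.
      have hphi : ‖(if G.l + (i : ℤ) = t then g mu else 1)‖ *
          jt (hgen (G.LMfrom (G.l + i + 1)) fun j => ‖V (G.l + i + 1) j‖) mu.1 ≤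
          jt (hgen (G.LMfrom (G.l + i + 1)) fun j => ‖V (G.l + i) j‖) mu.1 := by
        split_ifs with hit
        · rw [hit, hVt, hVt']
          have hnn : ∀ j ∈ G.LMfrom (t + 1), 0 ≤ y j := fun j hj =>
            hy j (Finset.mem_Icc.2 (mem_LM.1 (Finset.mem_filter.1 hj).1).1)
          have heq : (hgen (G.LMfrom (t + 1)) fun j => ‖(y j : ℂ)‖) = hgen (G.LMfrom (t + 1)) y :=
            Finset.prod_congr rfl fun j hj => by
              simp only [Complex.norm_real, Real.norm_of_nonneg (hnn j hj)]
          have h1 := congrArg norm (hg mu)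
          rw [norm_mul, jt_hgen_ofReal, Complex.norm_real,
            Real.norm_of_nonneg (jt_hgen_nonneg hnn mu)] at h1
          rw [heq, h1]
          exact norm_jt_hgen_le (fun _ _ => le_rfl) mu
        · rw [norm_one, one_mul, hVsucc _ hit]
      simp only [stepKernel, F]
      rw [norm_mul, Complex.norm_real, Real.norm_of_nonneg (hw mu), hsucc]
      calc G.stepWeight y (G.l + i) la mu * ‖(if G.l + (i : ℤ) = t then g mu else 1)‖ *
            (C (i + 1) * jt (hgen (G.LMfrom (G.l + i + 1)) fun j => ‖V (G.l + i + 1) j‖) mu.1)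
          = C (i + 1) * (G.stepWeight y (G.l + i) la mu *
            (‖(if G.l + (i : ℤ) = t then g mu else 1)‖ *
              jt (hgen (G.LMfrom (G.l + i + 1)) fun j => ‖V (G.l + i + 1) j‖) mu.1)) := by ring
        _ ≤ _ := mul_le_mul_of_nonneg_left (mul_le_mul_of_nonneg_left hphi (hw mu)) (hC _)
    have hnn : ∀ mu : YY N, 0 ≤ ‖G.stepKernel y t g i la mu‖ * F (i + 1) mu := fun mu =>
      mul_nonneg (norm_nonneg _)
        (mul_nonneg (hC _) (jt_hgen_nonneg (fun _ _ => norm_nonneg _) mu))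
    have hs := Summable.of_nonneg_of_le hnn hle hsum.summable
    refine ⟨_, ?_, hs.hasSum⟩
    rw [hval]
    exact hasSum_le hle hs.hasSum hsum

theorem hasSum_columnLaw {al be : ℕ → ℕ} {y : ℤ → ℝ} {t : ℤ} {N : ℕ} {Z : ℝ}
    (hZ : HasSum (fun M : G.coverings al be => G.weight y M.1) Z)
    (hpart : ∀ M ∈ G.coverings al be, ∃ mu : YY N, G.HasPartition M (t + 1) (zeroPad mu.1))
    (g : YY N → ℂ) (h : G.coverings al be → ℂ)
    (hgh : ∀ (M : G.coverings al be) (mu : YY N), G.HasPartition M.1 (t + 1) (zeroPad mu.1) →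
      h M = g mu) {S : ℂ} (hS : HasSum (fun M => (G.weight y M.1 : ℂ) * h M) S) :
    HasSum (fun mu : YY N => (G.columnLaw y al be (t + 1) (zeroPad mu.1) : ℂ) * g mu) (S / Z) := by
  have hZ' : G.partitionFunction y al be = Z := hZ.tsum_eq
  have key := hasSum_tsum_fiber (R := fun M (mu : YY N) => G.HasPartition M (t + 1) (zeroPad mu.1))
    (fun M hM => ?_) (w := fun M => G.weight y M / Z) (hZ.summable.div_const Z) hgh (S := S / Z) ?_
  · refine key.congr_fun fun mu => ?_
    rw [columnLaw, hZ']
  · obtain ⟨mu, hmu⟩ := hpart M hM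
    exact ⟨mu, hmu, fun mu' hmu' => zeroPad_injective
      (SetHasPartition.unique (P := {k | G.IsParticle M (t + 1) k}) hmu' hmu)⟩
  · refine (hS.div_const (Z : ℂ)).congr_fun fun M => ?_
    push_cast
    ring

end RailYard

/-! ### Change of length and the effect of the normalized Schur function -/

theorem zeroPad_extend {n N : ℕ} (hn : n ≤ N) (mu : Fin n → ℕ) :
    zeroPad (fun i : Fin N => zeroPad mu i) = zeroPad mu := by
  funext i
  by_cases hi : i < N
  · simp [zeroPad, hi]
  · rw [zeroPad_of_le _ (not_lt.1 hi), zeroPad_of_le _ (hn.trans (not_lt.1 hi))]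

/-- A partition with `n` parts as a partition with `N` parts. -/
def YY.extend {n : ℕ} (N : ℕ) (mu : YY n) : YY N :=
  ⟨fun i => zeroPad mu.1 i, fun _ _ h => antitone_zeroPad mu.2 h⟩

theorem zeroPad_yyExtend {n N : ℕ} (hn : n ≤ N) (mu : YY n) :
    zeroPad (mu.extend N).1 = zeroPad mu.1 := zeroPad_extend hn mu.1

theorem jt_yyExtend {K : Type*} [Field K] {n N : ℕ} (hn : n ≤ N) (mu : YY n) (s : Finset ℤ)
    (v : ℤ → K) : jt (hgen s v) (mu.extend N).1 = jt (hgen s v) mu.1 :=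
  jt_zeroPad _ (coeff_zero_hgen s v) hn mu.1

/-- The family equal to `v` on `S` and to `0` elsewhere. -/
def extendZero {K : Type*} [Zero K] (S : Finset ℤ) (v : ℤ → K) (j : ℤ) : K :=
  if j ∈ S then v j else 0

/-- Any variables supported on `S` are dominated by a multiple of the indicator of `S`, so
homogeneity transfers the vanishing. Hence reading a ratio with zero denominator as 0 loses nothing.
-/
theorem jt_extendZero_eq_zero {N : ℕ} (T S : Finset ℤ) (v : ℤ → ℂ) (mu : YY N)
    (h : jt (hgen T (extendZero S fun _ => (1 : ℂ))) mu.1 = 0) :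
    jt (hgen T (extendZero S v)) mu.1 = 0 := by
  set M : ℝ := 1 + ∑ j ∈ T, ‖v j‖ with hM
  have hM0 : M ≠ 0 := (add_pos_of_pos_of_nonneg one_pos
    (Finset.sum_nonneg fun _ _ => norm_nonneg _)).ne'
  have hE : jt (hgen T (extendZero S fun _ => (1 : ℝ))) mu.1 = 0 := by
    have h1 := jt_hgen_ofReal T (extendZero S fun _ => (1 : ℝ)) mu.1
    have h2 : (fun j => ((extendZero S (fun _ => (1 : ℝ)) j : ℝ) : ℂ)) =
        extendZero S fun _ => (1 : ℂ) := by
      funext j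
      by_cases hj : j ∈ S <;> simp [extendZero, hj]
    rw [h2, h] at h1
    exact_mod_cast h1.symm
  have h3 : ‖jt (hgen T (extendZero S v)) mu.1‖ ≤
      jt (hgen T fun j => M * extendZero S (fun _ => (1 : ℝ)) j) mu.1 := by
    refine norm_jt_hgen_le (fun j hj => ?_) mu
    by_cases hjS : j ∈ S
    · simp only [extendZero, if_pos hjS, mul_one]
      have := Finset.single_le_sum (f := fun j => ‖v j‖) (fun _ _ => norm_nonneg _) hj
      linarith
    · simp [extendZero, hjS]
  rw [jt_hgen_mul T _ hM0, hE, mul_zero] at h3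
  exact norm_le_zero_iff.1 h3

/-- Both Schur functions scale by the same power of `X`, so the denominator cancels against the
weights; when it vanishes, the target vanishes too. -/
theorem jt_extendZero_div_mul {N : ℕ} (T S : Finset ℤ) (v : ℤ → ℂ) {X : ℂ} (hX : X ≠ 0) (mu : YY N)
    {y W : ℤ → ℂ} (hy : ∀ j ∈ T, y j = X * extendZero S (fun _ => 1) j)
    (hW : ∀ j ∈ T, W j = X * extendZero S v j) :
    jt (hgen T (extendZero S v)) mu.1 / jt (hgen T (extendZero S fun _ => (1 : ℂ))) mu.1 *
      jt (hgen T y) mu.1 = jt (hgen T W) mu.1 := by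
  rw [hgen_eq_of_zero (subset_refl T) (fun j hj hj' => absurd hj hj') hy,
    hgen_eq_of_zero (subset_refl T) (fun j hj hj' => absurd hj hj') hW, jt_hgen_mul T _ hX,
    jt_hgen_mul T _ hX]
  by_cases h : jt (hgen T (extendZero S fun _ => (1 : ℂ))) mu.1 = 0
  · rw [h, jt_extendZero_eq_zero T S v mu h]
    simp
  · field_simp

/-! ### Measures whose nonzero `(L,-)` weights are all equal -/

namespace RailYard

variable {G : RailYard}

theorem colFactor_ofReal (v : ℤ → ℝ) (m : ℤ) :
    G.colFactor (fun j => (v j : ℂ)) m = ((G.colFactor v m : ℝ) : ℂ) := by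
  unfold colFactor
  split_ifs <;> push_cast <;> rfl

theorem colPart_eq_extend
    (hab : ∀ j ∈ Finset.Icc G.l G.r, ¬ (G.a j = LR.R ∧ G.b j = PM.minus)) {al : ℕ → ℕ}
    {M : Set RailEdge} (hM : M ∈ G.coverings al fun _ => 0) {m : ℤ} (hl : G.l ≤ m)
    (hr : m ≤ G.r + 1) {n N : ℕ} (hn : n ≤ N) {mu : YY n} (h : G.HasPartition M m (zeroPad mu.1)) :
    G.colPart N M m = mu.extend N := by
  obtain ⟨nu, h1, h2, -⟩ := exists_parts_particles hab hM hl hr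
  have h3 : SetHasPartition (G.particles M m) nu := h2 ▸ h1.setHasPartition_maya
  have h4 : nu = zeroPad mu.1 := SetHasPartition.unique h3 h
  refine colPart_eq ?_
  rw [zeroPad_yyExtend hn, h2, h4]

theorem exists_hasPartition
    (hab : ∀ j ∈ Finset.Icc G.l G.r, ¬ (G.a j = LR.R ∧ G.b j = PM.minus)) {al : ℕ → ℕ}
    {M : Set RailEdge} (hM : M ∈ G.coverings al fun _ => 0) {m : ℤ} (hl : G.l ≤ m)
    (hr : m ≤ G.r + 1) {n : ℕ} (hn : (G.LMfrom m).card ≤ n) :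
    ∃ mu : YY n, G.HasPartition M m (zeroPad mu.1) := by
  obtain ⟨nu, h1, h2, h3⟩ := exists_parts_particles hab hM hl hr
  refine ⟨truncate n h1.1, ?_⟩
  rw [zeroPad_truncate h1.1 fun i hi => h3 i (hn.trans hi)]
  have h4 : SetHasPartition (G.particles M m) nu := h2 ▸ h1.setHasPartition_maya
  exact h4

/-- Weights which are positive, and constant, exactly on the subset `S` of the `(L, -)` columns, and
small enough for the partition function to converge. -/
structure IsClassWeight (G : RailYard) (S : Finset ℤ) (X : ℝ) (y : ℤ → ℝ) : Prop where
  no_rm : ∀ j ∈ Finset.Icc G.l G.r, ¬ (G.a j = LR.R ∧ G.b j = PM.minus)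
  subset : S ⊆ G.LM
  pos : 0 < X
  nonneg : ∀ j ∈ Finset.Icc G.l G.r, 0 ≤ y j
  eq_of_mem : ∀ j ∈ S, y j = X
  eq_zero : ∀ j ∈ G.LM, j ∉ S → y j = 0
  conv : ∀ i ∈ Finset.Icc G.l G.r, G.a i = LR.L → G.b i = PM.plus → ∀ j ∈ G.LMfrom (i + 1),
    y i * y j < 1

/-- The weights `y` with the weights of the `(L, -)` columns on the right of `t` replaced by `u`
on `S` and by `0` elsewhere. -/
noncomputable def classMixed (S : Finset ℤ) (t : ℤ) (y : ℤ → ℝ) (u : ℤ → ℂ) (j : ℤ) : ℂ :=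
  if t < j then extendZero S u j else y j

theorem classMixed_of_le {S : Finset ℤ} {t : ℤ} {y : ℤ → ℝ} {u : ℤ → ℂ} {j : ℤ} (h : j ≤ t) :
    classMixed S t y u j = y j := if_neg (not_lt.2 h)

theorem classMixed_of_notMem {S : Finset ℤ} {t : ℤ} {y : ℤ → ℝ} {u : ℤ → ℂ} {j : ℤ} (hj : j ∉ S)
    (hy : y j = 0) : classMixed S t y u j = 0 := by
  simp [classMixed, extendZero, hj, hy]

namespace IsClassWeight

variable {S : Finset ℤ} {X : ℝ} {y : ℤ → ℝ}

theorem LM_nonneg (hy : G.IsClassWeight S X y) {j : ℤ} (hj : j ∈ G.LM) : 0 ≤ y j :=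
  hy.nonneg j (Finset.mem_Icc.2 (mem_LM.1 hj).1)

theorem colFactor_pos (hy : G.IsClassWeight S X y) {m : ℤ} (hm : m ∈ Finset.Icc G.l G.r) :
    0 < G.colFactor y m :=
  RailYard.colFactor_pos (hy.nonneg m hm) (fun _ hj => hy.LM_nonneg (Finset.mem_filter.1 hj).1)
    (hy.conv m hm)

theorem hasSum_coverings (hy : G.IsClassWeight S X y) {t : ℤ} (ht : t ∈ Finset.Icc G.l G.r)
    (al : YY S.card) (u : ℤ → ℂ)
    (hconv : ∀ i ∈ Finset.Icc G.l t, G.a i = LR.L → G.b i = PM.plus → ∀ j ∈ G.LMgt t, j ∈ S →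
      ‖(y i : ℂ) * u j‖ < 1)
    (g : YY G.LM.card → ℂ)
    (hg : ∀ mu : YY G.LM.card, g mu * jt (hgen (G.LMgt t) fun j => (y j : ℂ)) mu.1 =
      jt (hgen (G.LMgt t) (classMixed S t y u)) mu.1) :
    HasSum (fun M : G.coverings (zeroPad al.1) fun _ => 0 =>
      (G.weight y M.1 : ℂ) * g (G.colPart G.LM.card M.1 (t + 1)))
      ((∏ m ∈ Finset.Icc G.l G.r,
        G.colFactor (if t < m then fun j => (y j : ℂ) else classMixed S t y u) m) *
          jt (hgen S (classMixed S t y u)) al.1) := by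
  have hc : S.card ≤ G.LM.card := Finset.card_le_card hy.subset
  have h1 := hasSum_path_stepKernel hy.no_rm le_rfl (al.extend G.LM.card) hy.nonneg ht
    (classMixed S t y u) (fun j hj => classMixed_of_le hj) hy.conv (fun i hi ha hb j hj => by
      by_cases hjS : j ∈ S
      · have := hconv i hi ha hb j hj hjS
        have htj : t < j := (Finset.mem_filter.1 hj).2
        rwa [classMixed, if_pos htj, extendZero, if_pos hjS]
      · rw [classMixed_of_notMem hjS (hy.eq_zero j (Finset.mem_filter.1 hj).1 hjS)]
        simp) g hg
  have h2 := hasSum_coverings_of_hasSum_path hy.no_rm le_rfl (al.extend G.LM.card) y ht g h1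
  -- The paths use length `G.LM.card`; variables off `S` are zero and drop out, which returns to `S`
  -- and to the original length of `al`.
  rw [zeroPad_yyExtend hc, jt_yyExtend hc, hgen_eq_of_zero hy.subset (fun j hj hjS =>
    classMixed_of_notMem hjS (hy.eq_zero j hj hjS)) (fun j _ => rfl)] at h2
  exact h2

/-- The partition function, as a product. -/
noncomputable def Z (G : RailYard) (S : Finset ℤ) (y : ℤ → ℝ) (al : YY S.card) : ℝ :=
  (∏ m ∈ Finset.Icc G.l G.r, G.colFactor y m) * jt (hgen S y) al.1

theorem Z_pos (hy : G.IsClassWeight S X y) (al : YY S.card) : 0 < Z G S y al :=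
  -- The partition has as many parts as there are positive variables, so the length condition for
  -- positivity is empty.
  mul_pos (Finset.prod_pos fun _ hm => hy.colFactor_pos hm)
    (jt_hgen_pos (fun j hj => by rw [hy.eq_of_mem j hj]; exact hy.pos) al
      fun i hi => absurd i.2 (not_lt.2 hi))

theorem hasSum_weight (hy : G.IsClassWeight S X y) (al : YY S.card) :
    HasSum (fun M : G.coverings (zeroPad al.1) fun _ => 0 => G.weight y M.1) (Z G S y al) := by
  have hcm : ∀ j ∈ G.LM, classMixed S G.r y (fun j => (y j : ℂ)) j = y j := fun j hj =>
    classMixed_of_le (mem_LM.1 hj).1.2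
  -- At `t = r` no `(L,-)` column lies to the right: the constant test function is admissible, the
  -- convergence condition is empty and no variable changes.
  have h := hy.hasSum_coverings (t := G.r) (Finset.mem_Icc.2 ⟨G.hlr, le_rfl⟩) al
    (fun j => (y j : ℂ)) (fun i _ _ _ j hj => by
      have h1 := Finset.mem_filter.1 hj
      have h2 := (mem_LM.1 h1.1).1.2
      omega) (fun _ => 1) (fun mu => by
      rw [one_mul, hgen_eq_of_zero (subset_refl (G.LMgt G.r)) (fun j hj hj' => absurd hj hj')
        fun j hj => (hcm j (Finset.mem_filter.1 hj).1).symm])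
  have e1 : ∀ m ∈ Finset.Icc G.l G.r, G.colFactor (if G.r < m then fun j => (y j : ℂ) else
      classMixed S G.r y fun j => (y j : ℂ)) m = ((G.colFactor y m : ℝ) : ℂ) := by
    intro m hm
    rw [if_neg (not_lt.2 (Finset.mem_Icc.1 hm).2), ← colFactor_ofReal]
    unfold colFactor
    rw [classMixed_of_le (Finset.mem_Icc.1 hm).2]
    congr 1
    refine Finset.prod_congr rfl fun j hj => ?_
    rw [hcm j (Finset.mem_filter.1 hj).1]
  rw [Finset.prod_congr rfl e1, hgen_eq_of_zero (subset_refl S) (fun j hj hj' => absurd hj hj')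
    (fun j hj => hcm j (hy.subset hj)), jt_hgen_ofReal, ← Complex.ofReal_prod,
    ← Complex.ofReal_mul] at h
  simp only [mul_one] at h
  exact Complex.hasSum_ofReal.1 h

theorem gibbsWellDefined (hy : G.IsClassWeight S X y) (al : YY S.card) :
    G.GibbsWellDefined y (zeroPad al.1) fun _ => 0 := by
  refine ⟨fun M _ => Finset.prod_nonneg fun m hm => pow_nonneg (hy.nonneg m hm) _,
    (hy.hasSum_weight al).summable, ?_⟩
  rw [partitionFunction, (hy.hasSum_weight al).tsum_eq]
  exact hy.Z_pos al

theorem hasSum_columnLaw_one (hy : G.IsClassWeight S X y) {t : ℤ} (ht : t ∈ Finset.Icc G.l G.r)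
    (al : YY S.card) :
    HasSum (fun mu : YY (G.LMgt t).card =>
      G.columnLaw y (zeroPad al.1) (fun _ => 0) (t + 1) (zeroPad mu.1)) 1 := by
  have ht' := Finset.mem_Icc.1 ht
  have hZ := hy.hasSum_weight al
  have h := hasSum_columnLaw hZ (fun M hM => exists_hasPartition hy.no_rm hM (m := t + 1) (by omega)
    (by omega) le_rfl) (fun _ => 1) (fun _ => 1) (fun _ _ _ => rfl) (S := Z G S y al)
    ((Complex.hasSum_ofReal.2 hZ).congr_fun fun M => mul_one _)
  rw [div_self (by exact_mod_cast (hy.Z_pos al).ne')] at h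
  simp only [mul_one] at h
  exact Complex.hasSum_ofReal.1 (by rw [Complex.ofReal_one]; exact h)

end IsClassWeight

end RailYard

namespace RailYard

variable {G : RailYard}

namespace IsClassWeight

variable {S : Finset ℤ} {X : ℝ} {y : ℤ → ℝ}

theorem mul_lt_one (hy : G.IsClassWeight S X y) {i j : ℤ} (hi : i ∈ Finset.Icc G.l G.r)
    (hb : G.b i = PM.plus) (ha : G.a i = G.a j) (hj : j ∈ G.LMfrom (i + 1)) : y i * y j < 1 :=
  hy.conv i hi (ha.trans (mem_LM.1 (Finset.mem_filter.1 hj).1).2.1) hb j hj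

theorem pairFactor_ne_zero (hy : G.IsClassWeight S X y) {i j : ℤ} (hi : i ∈ Finset.Icc G.l G.r)
    (hb : G.b i = PM.plus) (hj : j ∈ G.LMfrom (i + 1)) :
    G.pairFactor (fun k => (y k : ℂ)) i j ≠ 0 := by
  have hjn := hy.LM_nonneg (Finset.mem_filter.1 hj).1
  have h0 := mul_nonneg (hy.nonneg i hi) hjn
  unfold pairFactor
  split_ifs with ha
  · have := hy.mul_lt_one hi hb ha hj
    have h1 : 1 - y i * y j ≠ 0 := (sub_pos.2 this).ne'
    exact one_div_ne_zero (by beta_reduce; exact_mod_cast h1)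
  · have h1 : 1 + y i * y j ≠ 0 := by positivity
    beta_reduce
    exact_mod_cast h1

theorem colFactor_eq_prod_pairFactor (v : ℤ → ℂ) {i : ℤ} (hb : G.b i = PM.plus) :
    G.colFactor v i = ∏ j ∈ G.LMfrom (i + 1), G.pairFactor v i j := by
  rw [colFactor, if_pos hb]
  refine Finset.prod_congr rfl fun j hj => ?_
  rw [pairFactor, (mem_LM.1 (Finset.mem_filter.1 hj).1).2.1]

/-- Columns on the right of `t` keep their factors, which cancel. For a `+` column up to `t`, only
pairs with a column of `S` on the right of `t` have a changed variable. -/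
theorem prod_colFactor_div (hy : G.IsClassWeight S X y) {t : ℤ} (ht : t ∈ Finset.Icc G.l G.r)
    (u : ℤ → ℂ) :
    (∏ m ∈ Finset.Icc G.l G.r,
        G.colFactor (if t < m then fun j => (y j : ℂ) else classMixed S t y u) m) /
      ∏ m ∈ Finset.Icc G.l G.r, G.colFactor (fun j => (y j : ℂ)) m =
    ∏ i ∈ (Finset.Icc G.l t).filter (fun i => G.b i = PM.plus),
      ∏ j ∈ (G.LMgt t).filter (fun j => j ∈ S),
        G.pairFactor (classMixed S t y u) i j / G.pairFactor (fun k => (y k : ℂ)) i j := by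
  classical
  have ht' := Finset.mem_Icc.1 ht
  have hne : ∀ m ∈ Finset.Icc G.l G.r, G.colFactor (fun j => (y j : ℂ)) m ≠ 0 := fun m hm => by
    rw [colFactor_ofReal]
    exact_mod_cast (hy.colFactor_pos hm).ne'
  rw [← Finset.prod_div_distrib]
  have hsub : (Finset.Icc G.l t).filter (fun i => G.b i = PM.plus) ⊆ Finset.Icc G.l G.r :=
    fun i hi => by
      have := Finset.mem_Icc.1 (Finset.mem_filter.1 hi).1
      exact Finset.mem_Icc.2 ⟨this.1, this.2.trans ht'.2⟩
  rw [← Finset.prod_subset hsub]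
  · refine Finset.prod_congr rfl fun i hi => ?_
    obtain ⟨hi1, hb⟩ := Finset.mem_filter.1 hi
    have hit := (Finset.mem_Icc.1 hi1).2
    rw [if_neg (not_lt.2 hit), colFactor_eq_prod_pairFactor _ hb, colFactor_eq_prod_pairFactor _ hb,
      ← Finset.prod_div_distrib]
    refine (Finset.prod_subset ?_ ?_).symm
    · intro j hj
      obtain ⟨hj1, hj2⟩ := Finset.mem_filter.1 (Finset.mem_filter.1 hj).1
      exact Finset.mem_filter.2 ⟨hj1, by omega⟩
    · intro j hj hj'
      have hjLM := (Finset.mem_filter.1 hj).1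
      have h1 : classMixed S t y u j = y j := by
        by_cases htj : t < j
        · have hjS : j ∉ S := fun hjS =>
            hj' (Finset.mem_filter.2 ⟨Finset.mem_filter.2 ⟨hjLM, htj⟩, hjS⟩)
          rw [classMixed_of_notMem hjS (hy.eq_zero j hjLM hjS), hy.eq_zero j hjLM hjS,
            Complex.ofReal_zero]
        · exact classMixed_of_le (not_lt.1 htj)
      have h2 : G.pairFactor (classMixed S t y u) i j = G.pairFactor (fun k => (y k : ℂ)) i j := by
        unfold pairFactor
        rw [h1, classMixed_of_le hit]
      rw [h2]
      exact div_self (hy.pairFactor_ne_zero (hsub hi) hb hj)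
  · intro m hm hm'
    by_cases htm : t < m
    · rw [if_pos htm]
      exact div_self (hne m hm)
    · have hb : G.b m ≠ PM.plus := fun hb => hm' (Finset.mem_filter.2
        ⟨Finset.mem_Icc.2 ⟨(Finset.mem_Icc.1 hm).1, not_lt.1 htm⟩, hb⟩)
      simp only [colFactor, if_neg hb, div_one]

theorem hasSum_columnLaw_mul (hy : G.IsClassWeight S X y) {t : ℤ} (ht : t ∈ Finset.Icc G.l G.r)
    (al : YY S.card) (u : ℤ → ℂ)
    (hconv : ∀ i ∈ Finset.Icc G.l t, G.a i = LR.L → G.b i = PM.plus → ∀ j ∈ G.LMgt t, j ∈ S →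
      ‖(y i : ℂ) * u j‖ < 1) :
    HasSum (fun mu : YY (G.LMgt t).card =>
      (G.columnLaw y (zeroPad al.1) (fun _ => 0) (t + 1) (zeroPad mu.1) : ℂ) *
        (jt (hgen (G.LMgt t) (extendZero S fun j => u j / X)) mu.1 /
          jt (hgen (G.LMgt t) (extendZero S fun _ => (1 : ℂ))) mu.1))
      (jt (hgen S (classMixed S t y u)) al.1 / jt (hgen S fun j => (y j : ℂ)) al.1 *
        ∏ i ∈ (Finset.Icc G.l t).filter (fun i => G.b i = PM.plus),
          ∏ j ∈ (G.LMgt t).filter (fun j => j ∈ S),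
            G.pairFactor (classMixed S t y u) i j / G.pairFactor (fun k => (y k : ℂ)) i j) := by
  have ht' := Finset.mem_Icc.1 ht
  have hX : (X : ℂ) ≠ 0 := by exact_mod_cast hy.pos.ne'
  have hcard : (G.LMgt t).card ≤ G.LM.card := card_LMfrom_le (t + 1)
  -- The test function is needed at two lengths, that of the paths and that of the column law; its
  -- value is unaffected by padding.
  let g : (N : ℕ) → YY N → ℂ := fun N mu =>
    jt (hgen (G.LMgt t) (extendZero S fun j => u j / X)) mu.1 /
      jt (hgen (G.LMgt t) (extendZero S fun _ => (1 : ℂ))) mu.1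
  have h1 := hy.hasSum_coverings ht al u hconv (g G.LM.card) fun mu =>
    jt_extendZero_div_mul (G.LMgt t) S (fun j => u j / X) hX mu (fun j hj => by
      have hjLM := (Finset.mem_filter.1 hj).1
      by_cases hjS : j ∈ S
      · simp [extendZero, hjS, hy.eq_of_mem j hjS]
      · simp [extendZero, hjS, hy.eq_zero j hjLM hjS]) (fun j hj => by
      obtain ⟨hjLM, htj⟩ := Finset.mem_filter.1 hj
      by_cases hjS : j ∈ S
      · simp only [classMixed, if_pos htj, extendZero, if_pos hjS]
        field_simp
      · simp [classMixed, htj, extendZero, hjS])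
  have h2 := hasSum_columnLaw (N := (G.LMgt t).card) (hy.hasSum_weight al)
    (fun M hM => exists_hasPartition hy.no_rm hM (m := t + 1) (by omega) (by omega) le_rfl)
    (g (G.LMgt t).card) (fun M => g G.LM.card (G.colPart G.LM.card M.1 (t + 1)))
    (fun M mu hmu => by
      rw [colPart_eq_extend hy.no_rm M.2 (by omega) (by omega) hcard hmu]
      exact congrArg₂ (· / ·) (jt_yyExtend hcard mu _ _) (jt_yyExtend hcard mu _ _)) h1
  rw [← hy.prod_colFactor_div ht u, div_mul_div_comm, mul_comm (jt _ _), mul_comm (jt _ _)]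
  rw [Z, Complex.ofReal_mul, Complex.ofReal_prod, ← jt_hgen_ofReal] at h2
  simp_rw [colFactor_ofReal]
  exact h2

end IsClassWeight

end RailYard

/-! ### Weight classes and the two kinds of auxiliary weights -/

namespace RailYard

variable {G : RailYard}

/-- The number of strictly larger values is strictly monotone on the value set. Hence all weights of
one class are equal, as the homogeneity argument requires. -/
theorem IsNthGreatest.unique {x : ℤ → ℝ} {i : ℕ} {v v' : ℝ} (h : G.IsNthGreatest x i v)
    (h' : G.IsNthGreatest x i v') : v = v' := by
  have key : ∀ {v v' : ℝ}, v < v' → G.IsNthGreatest x i v → ¬ G.IsNthGreatest x i v' := by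
    intro v v' hlt h h'
    have hss : ((G.values x).filter fun w => v' < w) ⊂ (G.values x).filter fun w => v < w := by
      refine Finset.ssubset_iff_of_subset (fun w hw => ?_) |>.2
        ⟨v', Finset.mem_filter.2 ⟨h'.1, hlt⟩, fun hc => lt_irrefl _ (Finset.mem_filter.1 hc).2⟩
      exact Finset.mem_filter.2 ⟨(Finset.mem_filter.1 hw).1, hlt.trans (Finset.mem_filter.1 hw).2⟩
    have := Finset.card_lt_card hss
    have h1 := h.2
    have h2 := h'.2
    omega
  rcases lt_trichotomy v v' with hlt | heq | hlt
  · exact absurd h' (key hlt h)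
  · exact heq
  · exact absurd h (key hlt h')

theorem mem_cls {x : ℤ → ℝ} {i : ℕ} {j : ℤ} :
    j ∈ G.cls x i ↔ j ∈ G.LM ∧ G.IsNthGreatest x i (x j) := by
  classical
  rw [cls, Finset.mem_filter]

theorem mem_positions {x : ℤ → ℝ} {sigma : Fin G.LM.card ≃ G.LM} {i : ℕ} {q : Fin G.LM.card} :
    q ∈ G.positions x sigma i ↔ G.IsNthGreatest x i (x (sigma q)) := by
  classical
  rw [positions, Finset.mem_filter]
  exact and_iff_right (Finset.mem_univ q)

theorem cls_subset (x : ℤ → ℝ) (i : ℕ) : G.cls x i ⊆ G.LM := fun _ h => (mem_cls.1 h).1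

theorem exists_eq_on_cls {x : ℤ → ℝ} (hxpos : ∀ j ∈ G.LM, 0 < x j) (i : ℕ) :
    ∃ X : ℝ, 0 < X ∧ ∀ j ∈ G.cls x i, x j = X := by
  rcases (G.cls x i).eq_empty_or_nonempty with h | ⟨k, hk⟩
  · exact ⟨1, one_pos, by simp [h]⟩
  · refine ⟨x k, hxpos k (cls_subset x i hk), fun j hj => ?_⟩
    exact (mem_cls.1 hj).2.unique (mem_cls.1 hk).2

theorem card_positions (x : ℤ → ℝ) (sigma : Fin G.LM.card ≃ G.LM) (i : ℕ) :
    (G.positions x sigma i).card = (G.cls x i).card := by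
  refine Finset.card_bij (fun q _ => (sigma q : ℤ)) ?_ ?_ ?_
  · intro q hq
    exact mem_cls.2 ⟨(sigma q).2, mem_positions.1 hq⟩
  · intro q _ q' _ h
    exact sigma.injective (Subtype.ext h)
  · intro j hj
    obtain ⟨h1, h2⟩ := mem_cls.1 hj
    refine ⟨sigma.symm ⟨j, h1⟩, mem_positions.2 ?_, by simp⟩
    simpa using h2

/-- `lamClass` as a partition. -/
noncomputable def lamClassYY (x : ℤ → ℝ) {lam : Fin G.LM.card → ℕ} (hlam : Antitone lam)
    (sigma : Fin G.LM.card ≃ G.LM) (i : ℕ) : YY (G.positions x sigma i).card :=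
  ⟨G.lamClass x lam sigma i, hlam.comp_monotone (OrderEmbedding.monotone _)⟩

theorem normalizedSchur_eq_jt (x : ℤ → ℝ) {i : ℕ} {X : ℝ} (hX : ∀ j ∈ G.cls x i, x j = X) (t : ℤ)
    (u : ℤ → ℂ) {N : ℕ} (mu : Fin N → ℕ) :
    G.normalizedSchur x i t u mu =
      jt (hgen (G.LMgt t) (extendZero (G.cls x i) fun j => u j / X)) mu /
        jt (hgen (G.LMgt t) (extendZero (G.cls x i) fun _ => (1 : ℂ))) mu := by
  rw [← schur_eq_jt, ← schur_eq_jt, normalizedSchur]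
  congr 2
  all_goals
    funext j
    by_cases hj : (j : ℤ) ∈ G.cls x i <;> simp [extendZero, hj, hX]

theorem schurRatio_eq_jt (x : ℤ → ℝ) (lam : Fin G.LM.card → ℕ) (sigma : Fin G.LM.card ≃ G.LM)
    (i : ℕ) (t : ℤ) (u : ℤ → ℂ) {y : ℤ → ℝ} (hy : ∀ j ∈ G.cls x i, y j = x j) :
    G.schurRatio x lam sigma i t u =
      jt (hgen (G.cls x i) (classMixed (G.cls x i) t y u)) (G.lamClass x lam sigma i) /
        jt (hgen (G.cls x i) fun j => (y j : ℂ)) (G.lamClass x lam sigma i) := by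
  rw [schurRatio, schur_eq_jt _ _ (G.mixed x u t), schur_eq_jt _ _ fun j => (x j : ℂ)]
  congr 2
  · refine hgen_eq_of_zero (subset_refl _) (fun j hj hj' => absurd hj hj') fun j hj => ?_
    by_cases htj : t < j
    · have : j ∈ G.LMgt t := Finset.mem_filter.2 ⟨cls_subset x i hj, htj⟩
      rw [mixed, if_pos this, classMixed, if_pos htj, extendZero, if_pos hj]
    · have : j ∉ G.LMgt t := fun h => htj (Finset.mem_filter.1 h).2
      rw [mixed, if_neg this, classMixed_of_le (not_lt.1 htj), hy j hj]
  · exact hgen_eq_of_zero (subset_refl _) (fun j hj hj' => absurd hj hj') fun j hj => by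
      rw [hy j hj]

/-- Changing `R` to `L` could create new `(L,-)` columns only from `(R,-)` ones, which are excluded.
-/
theorem allL_LM
    (hab : ∀ j ∈ Finset.Icc G.l G.r, ¬ (G.a j = LR.R ∧ G.b j = PM.minus)) : G.allL.LM = G.LM := by
  ext j
  rw [mem_LM, mem_LM]
  refine and_congr_right fun hj => ?_
  constructor
  · rintro ⟨-, hb⟩
    refine ⟨?_, hb⟩
    rcases ha : G.a j with _ | _
    · rfl
    · exact absurd ⟨ha, hb⟩ (hab j (Finset.mem_Icc.2 hj))
  · exact fun h => ⟨rfl, h.2⟩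

theorem notMem_LM_of_plus {i : ℤ} (hb : G.b i = PM.plus) : i ∉ G.LM := by simp [mem_LM, hb]

theorem firstWeight_of_plus (x : ℤ → ℝ) {i : ℤ} (hb : G.b i = PM.plus) :
    G.firstWeight x i = x i := if_neg fun h => notMem_LM_of_plus hb h.1

theorem firstWeight_of_mem (x : ℤ → ℝ) {j : ℤ} (hj : j ∈ G.cls x 1) :
    G.firstWeight x j = x j := if_neg fun h => h.2 hj

theorem otherWeight_of_plus (x : ℤ → ℝ) (k : ℕ) {i : ℤ} (hb : G.b i = PM.plus) :
    G.otherWeight x k i = 0 := if_neg fun h => notMem_LM_of_plus hb (cls_subset x k h)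

theorem otherWeight_of_mem (x : ℤ → ℝ) (k : ℕ) {j : ℤ} (hj : j ∈ G.cls x k) :
    G.otherWeight x k j = x j := if_pos hj

theorem isClassWeight_firstWeight {x : ℤ → ℝ} (hx : ∀ j ∈ Finset.Icc G.l G.r, 0 ≤ x j)
    (hab : ∀ j ∈ Finset.Icc G.l G.r, ¬ (G.a j = LR.R ∧ G.b j = PM.minus))
    (hconv : ∀ i ∈ Finset.Icc G.l G.r, ∀ j ∈ Finset.Icc G.l G.r, i < j → G.a i = G.a j →
      G.b i = PM.plus → G.b j = PM.minus → x i * x j < 1) {X : ℝ} (hX : 0 < X)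
    (hxX : ∀ j ∈ G.cls x 1, x j = X) :
    G.IsClassWeight (G.cls x 1) X (G.firstWeight x) where
  no_rm := hab
  subset := cls_subset x 1
  pos := hX
  nonneg j hj := by
    unfold firstWeight
    split_ifs
    · exact le_rfl
    · exact hx j hj
  eq_of_mem j hj := (firstWeight_of_mem x hj).trans (hxX j hj)
  eq_zero j hj hj' := if_pos ⟨hj, hj'⟩
  conv i hi ha hb j hj := by
    obtain ⟨hj1, hij⟩ := Finset.mem_filter.1 hj
    obtain ⟨hjm, haj, hbj⟩ := mem_LM.1 hj1
    rw [firstWeight_of_plus x hb, firstWeight]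
    split_ifs
    · simp
    · exact hconv i hi j (Finset.mem_Icc.2 hjm) (by omega) (ha.trans haj.symm) hb hbj

/-- The `+` columns have weight 0, so the added Cauchy-type convergence conditions on the all-`L`
graph hold trivially. -/
theorem isClassWeight_otherWeight {x : ℤ → ℝ}
    (hxpos : ∀ j ∈ G.LM, 0 < x j)
    (hab : ∀ j ∈ Finset.Icc G.l G.r, ¬ (G.a j = LR.R ∧ G.b j = PM.minus)) (k : ℕ) {X : ℝ}
    (hX : 0 < X) (hxX : ∀ j ∈ G.cls x k, x j = X) :
    G.allL.IsClassWeight (G.cls x k) X (G.otherWeight x k) where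
  no_rm j _ h := by cases h.1
  subset := by
    rw [allL_LM hab]
    exact cls_subset x k
  pos := hX
  nonneg j _ := by
    unfold otherWeight
    split_ifs with h
    · exact (hxpos j (cls_subset x k h)).le
    · exact le_rfl
  eq_of_mem j hj := (if_pos hj).trans (hxX j hj)
  eq_zero j _ hj' := if_neg hj'
  conv i _ _ hb j _ := by
    rw [otherWeight_of_plus (G := G) x k hb, zero_mul]
    exact one_pos

theorem prod_pairFactor_firstWeight (x : ℤ → ℝ) (t : ℤ) (u : ℤ → ℂ) :
    ∏ i ∈ (Finset.Icc G.l t).filter (fun i => G.b i = PM.plus),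
      ∏ j ∈ (G.LMgt t).filter (fun j => j ∈ G.cls x 1),
        G.pairFactor (classMixed (G.cls x 1) t (G.firstWeight x) u) i j /
          G.pairFactor (fun k => (G.firstWeight x k : ℂ)) i j = G.xizProd x t u := by
  rw [xizProd]
  refine Finset.prod_congr rfl fun i hi => ?_
  obtain ⟨hi1, hb⟩ := Finset.mem_filter.1 hi
  refine Finset.prod_congr (by congr) fun j hj => ?_
  obtain ⟨hj1, hj2⟩ := Finset.mem_filter.1 hj
  have htj : t < j := (Finset.mem_filter.1 hj1).2
  have hi2 : i ∉ G.LMgt t := fun h => notMem_LM_of_plus hb (Finset.mem_filter.1 h).1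
  unfold pairFactor
  beta_reduce
  rw [classMixed_of_le (Finset.mem_Icc.1 hi1).2, classMixed, if_pos htj, extendZero, if_pos hj2,
    firstWeight_of_plus x hb, firstWeight_of_mem x hj2, mixed, mixed, if_neg hi2, if_pos hj1]

theorem prod_pairFactor_otherWeight (x : ℤ → ℝ) (k : ℕ) (t : ℤ) (u : ℤ → ℂ) (T : Finset ℤ) :
    ∏ i ∈ (Finset.Icc G.l t).filter (fun i => G.b i = PM.plus), ∏ j ∈ T,
        G.allL.pairFactor (classMixed (G.cls x k) t (G.otherWeight x k) u) i j /
          G.allL.pairFactor (fun k' => (G.otherWeight x k k' : ℂ)) i j = 1 := by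
  refine Finset.prod_eq_one fun i hi => Finset.prod_eq_one fun j _ => ?_
  obtain ⟨hi1, hb⟩ := Finset.mem_filter.1 hi
  unfold pairFactor
  beta_reduce
  rw [classMixed_of_le (Finset.mem_Icc.1 hi1).2, otherWeight_of_plus x k hb]
  simp

end RailYard

/-! ### The two families of identities -/

theorem lemma3p2 (G : RailYard) (x : ℤ → ℝ)
    (hx : ∀ j ∈ Finset.Icc G.l G.r, 0 ≤ x j)
    (hxpos : ∀ j ∈ G.LM, 0 < x j)
    (hLM : G.LM.Nonempty)
    (hab : ∀ j ∈ Finset.Icc G.l G.r, ¬ (G.a j = LR.R ∧ G.b j = PM.minus))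
    (hconv : ∀ i ∈ Finset.Icc G.l G.r, ∀ j ∈ Finset.Icc G.l G.r, i < j → G.a i = G.a j →
      G.b i = PM.plus → G.b j = PM.minus → x i * x j < 1)
    (lam : Fin G.LM.card → ℕ) (hlam : Antitone lam)
    (sigma : Fin G.LM.card ≃ G.LM)
    (t : ℤ) (ht : t ∈ Finset.Icc G.l G.r) :
    (G.GibbsWellDefined (G.firstWeight x) (zeroPad (G.lamClass x lam sigma 1)) (fun _ => 0) ∧
      HasSum (fun mu : YY (G.LMgt t).card => G.rhoFirst x lam sigma t mu) 1 ∧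
      ∀ u : ℤ → ℂ,
        (∀ i ∈ Finset.Icc G.l t, G.a i = LR.L → G.b i = PM.plus →
          ∀ j ∈ G.LMgt t, j ∈ G.cls x 1 → ‖(x i : ℂ) * u j‖ < 1) →
        HasSum
          (fun mu : YY (G.LMgt t).card =>
            (G.rhoFirst x lam sigma t mu : ℂ) * G.normalizedSchur x 1 t u mu.1)
          (G.schurRatio x lam sigma 1 t u * G.xizProd x t u)) ∧
    (∀ i ∈ Finset.Icc 2 (G.values x).card,
      G.allL.GibbsWellDefined (G.otherWeight x i) (zeroPad (G.lamClass x lam sigma i))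
        (fun _ => 0) ∧
      HasSum (fun mu : YY (G.LMgt t).card => G.rhoOther x lam sigma i t mu) 1 ∧
      ∀ u : ℤ → ℂ,
        HasSum
          (fun mu : YY (G.LMgt t).card =>
            (G.rhoOther x lam sigma i t mu : ℂ) * G.normalizedSchur x i t u mu.1)
          (G.schurRatio x lam sigma i t u)) := by
  -- The class partition is indexed by positions `q`, the variables by columns. The two counts are
  -- equal but not by definition, so the partition is transported by padding, which changes neither
  -- its sequence nor its Schur functions.
  have hcard := fun i => (RailYard.card_positions (G := G) x sigma i).le
  have hpad : ∀ i, zeroPad ((RailYard.lamClassYY x hlam sigma i).extend (G.cls x i).card).1 =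
      zeroPad (G.lamClass x lam sigma i) := fun i => zeroPad_yyExtend (hcard i) _
  have hjt : ∀ i (v : ℤ → ℂ), jt (hgen (G.cls x i) v)
      ((RailYard.lamClassYY x hlam sigma i).extend (G.cls x i).card).1 =
      jt (hgen (G.cls x i) v) (G.lamClass x lam sigma i) := fun i v => jt_yyExtend (hcard i) _ _ _
  constructor
  · obtain ⟨X, hX, hxX⟩ := RailYard.exists_eq_on_cls hxpos 1
    have hy := RailYard.isClassWeight_firstWeight hx hab hconv hX hxX
    have h1 := hy.gibbsWellDefined ((RailYard.lamClassYY x hlam sigma 1).extend _)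
    have h2 := hy.hasSum_columnLaw_one ht ((RailYard.lamClassYY x hlam sigma 1).extend _)
    rw [hpad] at h1 h2
    refine ⟨h1, h2, fun u hu => ?_⟩
    have h3 := hy.hasSum_columnLaw_mul ht ((RailYard.lamClassYY x hlam sigma 1).extend _) u
      (fun i hi ha hb => by
        rw [RailYard.firstWeight_of_plus x hb]
        exact hu i hi ha hb)
    rw [hpad, hjt, hjt, RailYard.prod_pairFactor_firstWeight, ← RailYard.schurRatio_eq_jt x lam
      sigma 1 t u fun j hj => RailYard.firstWeight_of_mem x hj] at h3
    refine h3.congr_fun fun mu => ?_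
    rw [RailYard.normalizedSchur_eq_jt x hxX]
    rfl
  · intro i _
    obtain ⟨X, hX, hxX⟩ := RailYard.exists_eq_on_cls hxpos i
    have hy := RailYard.isClassWeight_otherWeight hxpos hab i hX hxX
    have hT : G.allL.LMgt t = G.LMgt t := by rw [RailYard.LMgt, RailYard.allL_LM hab, RailYard.LMgt]
    have h1 := hy.gibbsWellDefined ((RailYard.lamClassYY x hlam sigma i).extend _)
    have h2 := hy.hasSum_columnLaw_one ht ((RailYard.lamClassYY x hlam sigma i).extend _)
    rw [hpad] at h1 h2
    rw [hT] at h2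
    refine ⟨h1, h2, fun u => ?_⟩
    -- The convergence condition holds for every `u`, because the `+` columns have weight 0.
    have h3 := hy.hasSum_columnLaw_mul ht ((RailYard.lamClassYY x hlam sigma i).extend _) u
      (fun k _ _ hb j _ _ => by
        rw [RailYard.otherWeight_of_plus (G := G) x i hb]
        simp)
    have h4 := RailYard.prod_pairFactor_otherWeight (G := G) x i t u
    rw [hpad, hjt, hjt, ← RailYard.schurRatio_eq_jt x lam sigma i t u fun j hj =>
      RailYard.otherWeight_of_mem x i hj,
      hT] at h3
    have h5 := h3.congr_fun (g := fun mu : YY (G.LMgt t).card =>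
      (G.rhoOther x lam sigma i t mu : ℂ) * G.normalizedSchur x i t u mu.1) fun mu => by
        rw [RailYard.normalizedSchur_eq_jt x hxX]
        rfl
    have h6 := h4 ((G.LMgt t).filter fun j => j ∈ G.cls x i)
    exact ((congrArg (G.schurRatio x lam sigma i t u * ·) h6).trans (mul_one _)) ▸ h5
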